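/- \textbf{Setup.} Let $\Delta$ be a Dynkin diagram of type $A_n$ ($n\ge 1$), $D_n$ ($n\ge 4$) or $E_6$ with vertex set $I$, simple roots $\Pi=\{\alpha_i\}_{i\in I}$, set of positive roots $\Phi^+$, simple reflections $r_i$, Weyl group $W$ and longest element $w_0$ of length $N$. Let $Q$ be a Dynkin quiver obtained by orienting the edges of $\Delta$, and let $r_iQ$ be the quiver obtained by reversing all arrows at $i$. A reduced expression $\widetilde w_0=r_{i_1}\cdots r_{i_N}$ of $w_0$ is adapted to $Q$ if $i_k$ is a source of $r_{i_{k-1}}\cdots r_{i_1}Q$ for every $k$. The reduced expressions of $w_0$ adapted to $Q$ form one commutation class $[Q]$ (a class under the moves $r_kr_l=r_lr_k$ for distinct non-adjacent $k,l$); it is non-empty. A reduced expression $\widetilde w=r_{i_1}\cdots r_{i_N}$ of $w_0$ enumerates $\Phi^+$ as $\beta_k=r_{i_1}\cdots r_{i_{k-1}}(\alpha_{i_k})$. A sequence is a function $m:\Phi^+\to\mathbb Z_{\ge 0}$; write $m_k=m(\beta_k)$ and $\mathrm{wt}(m)=\sum_\beta m(\beta)\beta$. A positive root is identified with its indicator function,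 and a pair is the indicator function of a two-element subset of $\Phi^+$. Write $m'<^b_{\widetilde w}m$ if there are $k\le s$ such that $m'_t=m_t$ for $t<k$, $m'_k<m_k$, $m'_t=m_t$ for $t>s$, and $m'_s<m_s$. Write $m'\prec^b_Q m$ if $m'<^b_{\widetilde w}m$ for all $\widetilde w\in[Q]$. A pair $p$ is $[Q]$-simple if there is no sequence $m$ with $m\prec^b_Q p$ and $\mathrm{wt}(m)=\mathrm{wt}(p)$. The distance $\mathrm{dist}_Q(p)$ is $0$ if $p$ is $[Q]$-simple; otherwise it is the largest $k$ for which there is a chain $p^{(1)}\prec^b_Q\cdots\prec^b_Q p^{(k)}=p$ of non-$[Q]$-simple pairs of weight $\mathrm{wt}(p)$. For $\gamma\in\Phi^+\setminus\Pi$, the $[Q]$-radius is $$\mathrm{rds}_Q(\gamma)=\max\{\mathrm{dist}_Q(p)\mid p\text{ a pair},\ \gamma\prec^b_Q p,\ \mathrm{wt}(p)=\gamma\},$$ and the multiplicity of $\gamma=\sum_i n_i\alpha_i$ is $\mathrm{mul}(\gamma)=\max_i n_i$. \textbf{Theorem.} For every $\gamma\in\Phi^+\setminus\Pi$ and every Dynkin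 quiver $Q$ of type $A_n$ ($n\ge1$), $D_n$ ($n\ge4$) or $E_6$, the radius $\mathrm{rds}_Q(\gamma)$ is well defined and $$\mathrm{rds}_Q(\gamma)=\mathrm{mul}(\gamma).$$ Hence $\mathrm{rds}_Q(\gamma)=\mathrm{rds}_{Q'}(\gamma)$ for any two Dynkin quivers $Q,Q'$ of the same such type; that is, the radius does not depend on the orientation. -/

import Mathlib

namespace QRadius

/-! ### Finite Cartan data of types A, D, E₆ (up to a relabelling of the vertices) -/

/-- `C` is the Cartan matrix of type `A_n` for some `n ≥ 1` (Mathlib's `CartanMatrix.A n` is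
the `n × n` Cartan matrix of the path with `n` vertices). -/
def IsTypeA {I : Type*} (C : Matrix I I ℤ) : Prop :=
  ∃ n : ℕ, 1 ≤ n ∧ ∃ e : I ≃ Fin n, C = (CartanMatrix.A n).submatrix e e

/-- `C` is the Cartan matrix of type `D_n` for some `n ≥ 4`. -/
def IsTypeD {I : Type*} (C : Matrix I I ℤ) : Prop :=
  ∃ n : ℕ, 4 ≤ n ∧ ∃ e : I ≃ Fin n, C = (CartanMatrix.D n).submatrix e e

/-- `C` is the Cartan matrix of type `E₆`. -/
def IsTypeE6 {I : Type*} (C : Matrix I I ℤ) : Prop :=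
  ∃ e : I ≃ Fin 6, C = CartanMatrix.E₆.submatrix e e

section Roots

variable {I : Type*} [Fintype I] [DecidableEq I]

/-- The simple root `α_i`, as an element of the root lattice `I → ℤ` (coordinates are the
coefficients with respect to the simple roots). -/
def simpleRoot (i : I) : I → ℤ := Pi.single i 1

/-- The simple coroot `h_i`, as a linear form on the root lattice: `⟨h_i, α_j⟩ = a_ij`. -/
def simpleCoroot (C : Matrix I I ℤ) (i : I) : Module.Dual ℤ (I → ℤ) :=
  LinearMap.proj i ∘ₗ C.mulVecLin

/-- The simple reflection `r_i : v ↦ v - ⟨h_i, v⟩ α_i`. -/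
def simpleReflection (C : Matrix I I ℤ) (i : I) : Module.End ℤ (I → ℤ) :=
  Module.preReflection (simpleRoot i) (simpleCoroot C i)

/-- The Weyl group element `r_{i_1} ⋯ r_{i_t}` expressed by the word `[i_1, …, i_t]`. -/
def wordProd (C : Matrix I I ℤ) (w : List I) : Module.End ℤ (I → ℤ) :=
  (w.map (simpleReflection C)).prod

/-- Roots: the images of the simple roots under the Weyl group. -/
def IsRoot (C : Matrix I I ℤ) (β : I → ℤ) : Prop :=
  ∃ (w : List I) (i : I), β = wordProd C w (simpleRoot i)

/-- Positive roots: the roots with nonnegative coefficients. -/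
def IsPositiveRoot (C : Matrix I I ℤ) (β : I → ℤ) : Prop :=
  IsRoot C β ∧ ∀ i, 0 ≤ β i

/-- The multiplicity of `γ = ∑ n_i α_i` in the positive cone: the largest coefficient `n_i`. -/
def mul (γ : I → ℤ) : ℕ := Finset.univ.sup fun i => (γ i).toNat

/-! ### Reduced expressions and commutation classes -/

/-- The word `w` is a reduced expression (of the Weyl group element that it expresses). -/
def IsReduced (C : Matrix I I ℤ) (w : List I) : Prop :=
  ∀ w' : List I, wordProd C w' = wordProd C w → w.length ≤ w'.length

/-- The word `w` is a reduced expression of the longest element `w₀` of the Weyl group. -/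
def IsLongestReduced (C : Matrix I I ℤ) (w : List I) : Prop :=
  IsReduced C w ∧ ∀ w' : List I, IsReduced C w' → w'.length ≤ w.length

/-- One commutation move `r_k r_l = r_l r_k`, for distinct non-adjacent `k` and `l`. -/
inductive CommutationMove (C : Matrix I I ℤ) : List I → List I → Prop
  | swap (u v : List I) (k l : I) (h : C k l = 0) :
      CommutationMove C (u ++ k :: l :: v) (u ++ l :: k :: v)

/-- Commutation equivalence `w ∼ w'`; so `w' ∈ [w]`. -/
def CommutationEquiv (C : Matrix I I ℤ) (w w' : List I) : Prop :=
  Relation.EqvGen (CommutationMove C) w w'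

/-- The root `β_k = r_{i_1} ⋯ r_{i_{k-1}}(α_{i_k})` of the word `w = [i_1, …, i_t]`
(indices start at `0`). -/
def rootAt (C : Matrix I I ℤ) (w : List I) (k : Fin w.length) : I → ℤ :=
  wordProd C (w.take k) (simpleRoot (w.get k))

/-! ### Sequences of positive roots and their orders

A sequence `(m_1, …, m_ℓ)` of nonnegative integers, read as the collection
`(m_1 β_1, …, m_ℓ β_ℓ)`, is the multiset of roots in which `β_k` occurs `m_k` times. Passing to
another reduced expression rearranges the entries and leaves the multiset as it is. -/

/-- `m` is a sequence for the reduced expression `w`: all its members are among the `β_k`. -/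
def IsSequence (C : Matrix I I ℤ) (w : List I) (m : Multiset (I → ℤ)) : Prop :=
  ∀ β ∈ m, ∃ k, rootAt C w k = β

/-- A pair: a sequence with two distinct members, each of multiplicity one.
The weight of a sequence `m` is `m.sum`. -/
def IsPair (C : Matrix I I ℤ) (w : List I) (p : Multiset (I → ℤ)) : Prop :=
  IsSequence C w p ∧ p.Nodup ∧ p.card = 2

/-- The bi-lexicographic order `m' <^b_w m`: at the first and at the last position where
the entries differ, the entry of `m'` is the smaller one. -/
def BiLexLT (C : Matrix I I ℤ) (w : List I) (m' m : Multiset (I → ℤ)) : Prop :=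
  ∃ k s : Fin w.length, k ≤ s ∧
    (∀ t, t < k → m'.count (rootAt C w t) = m.count (rootAt C w t)) ∧
    m'.count (rootAt C w k) < m.count (rootAt C w k) ∧
    (∀ t, s < t → m'.count (rootAt C w t) = m.count (rootAt C w t)) ∧
    m'.count (rootAt C w s) < m.count (rootAt C w s)

/-- The coarser order `m' ≺^b_[w] m`: `m' <^b_{w'} m` for every `w' ∈ [w]`. -/
def ClassLT (C : Matrix I I ℤ) (w : List I) (m' m : Multiset (I → ℤ)) : Prop :=
  ∀ w', CommutationEquiv C w w' → BiLexLT C w' m' m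

/-- A pair `p` is `[w]`-simple if no sequence of the same weight is below it. -/
def IsSimplePair (C : Matrix I I ℤ) (w : List I) (p : Multiset (I → ℤ)) : Prop :=
  ¬ ∃ m, IsSequence C w m ∧ ClassLT C w m p ∧ m.sum = p.sum

/-- A chain `p⁽¹⁾ ≺^b_[w] ⋯ ≺^b_[w] p⁽ᵏ⁾ = p` of non-`[w]`-simple pairs of the weight of `p`. -/
def IsDistChain (C : Matrix I I ℤ) (w : List I) (p : Multiset (I → ℤ))
    (c : List (Multiset (I → ℤ))) : Prop :=
  (∀ q ∈ c, IsPair C w q ∧ ¬ IsSimplePair C w q ∧ q.sum = p.sum) ∧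
    c.IsChain (ClassLT C w) ∧ c.getLast? = some p

/-- `dist_[w](p) = k`: `k = 0` if `p` is `[w]`-simple, and otherwise `k` is the largest length of
a chain of non-`[w]`-simple pairs of the same weight that ends in `p`. -/
def IsDist (C : Matrix I I ℤ) (w : List I) (p : Multiset (I → ℤ)) (k : ℕ) : Prop :=
  (IsSimplePair C w p ∧ k = 0) ∨
    (¬ IsSimplePair C w p ∧ IsGreatest {l | ∃ c, IsDistChain C w p c ∧ c.length = l} k)

/-- `rds_[w](γ) = r`: the maximum of `dist_[w](p)` over the pairs `p` of weight `γ` with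
`γ ≺^b_[w] p`. -/
def IsRadius (C : Matrix I I ℤ) (w : List I) (γ : I → ℤ) (r : ℕ) : Prop :=
  IsGreatest {k | ∃ p, IsPair C w p ∧ ClassLT C w {γ} p ∧ p.sum = γ ∧ IsDist C w p k} r

/-! ### Dynkin quivers and adapted reduced expressions -/

/-- `Q` (with `Q i j` meaning that there is an arrow `i → j`) is a Dynkin quiver: every edge of
the simply laced Dynkin diagram of `C` carries exactly one of its two directions, and there are
no other arrows. -/
def IsDynkinQuiver (C : Matrix I I ℤ) (Q : I → I → Prop) : Prop :=
  (∀ i j, Q i j → C i j = -1) ∧ ∀ i j, C i j = -1 → (Q i j ↔ ¬ Q j i)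

/-- `i` is a source: no arrow enters it. -/
def IsSource (Q : I → I → Prop) (i : I) : Prop := ∀ j, ¬ Q j i

/-- `r_i Q`: the quiver `Q` with all arrows incident with `i` reversed. -/
def reflectAt (i : I) (Q : I → I → Prop) : I → I → Prop :=
  fun j k => if j = i ∨ k = i then Q k j else Q j k

/-- The word `[i_1, i_2, …]` is adapted to `Q`: each `i_k` is a source of
`r_{i_{k-1}} ⋯ r_{i_1} Q`. -/
def IsAdapted : (I → I → Prop) → List I → Prop
  | _, [] => True
  | Q, i :: w => IsSource Q i ∧ IsAdapted (reflectAt i Q) w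

/-- `w` represents the commutation class `[Q]`: it is a reduced expression of `w₀` adapted
to `Q`. -/
def Represents (C : Matrix I I ℤ) (w : List I) (Q : I → I → Prop) : Prop :=
  IsLongestReduced C w ∧ IsAdapted Q w

end Roots

end QRadius

/-! Write ⟨x, y⟩ for the Euler form of `Q`; its symmetrisation is the Cartan form. Positive roots
are handled as nonnegative vectors of norm two. Reflection at a source preserves the Euler form
(`euler_reflectAt`), so comparisons inside an adapted word reduce to those with a simple root at a
source. Hence, if x comes before y, then ⟨x, y⟩ ≤ 0 ≤ ⟨y, x⟩ (`pairwise_rootsOf`). In particular ⟨y,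
x⟩ > 0 forces x before y. The order `Prec` generated by these relations consists exactly of the
comparisons common to all words of the class, because any up-closed set of roots can be commuted to
the end of the word (`exists_partition`). For pairs of equal weight, ≺ therefore means nesting with
respect to `Prec`.

Let γ be a root. A pair of weight γ has Cartan product -1, so it can be written (a, b) with ⟨a, b⟩ <
0; it then lies above {γ} and is not simple. The integer ⟨a, b⟩ drops strictly each time a pair is
replaced by one that surrounds it (`NoCrossing.euler_lt`), and it never falls below minus the
multiplicity of γ (`EulerBound`). So a chain has at most as many members as the multiplicity.
Conversely, `HasNestedPairs` supplies a nested family of exactly that size. `isRadius_mul` combines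
these facts.

For the strict drop, let (α', β') surround (α, β). Then α' differs by a root ±δ from α or from β. In
the first case the sign law and convexity suffice. In the second, if the drop failed, there would be
orthogonal roots β, β' with both β ≺ β' and β + δ ≺ β' + δ. Adapted reflections, possibly after
reversing all arrows, turn δ into a simple root at a source j, and further reflections away from j
make j the only source. `NoCrossing` forbids what is left. In type A it follows from `InjPath`: path
vectors from j are the dimension vectors of injective modules, and everything below one of them is
again of this kind. Type D uses this as well, and treats the remaining shapes by their Euler values
and by sets closed under `Prec`. Type E₆ is a computation over the 32 orientations.

The bound holds because -⟨α, β⟩ is a coefficient of a reflection of α + β; in types A and D all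
coefficients are at most two, and the thin case is elementary. Nested pairs for multiplicity two in
type D come from writing γ = 2c + l₀ + l₁ + l₂ as in D₄. Both statements are computed for E₆. -/

namespace QRadius

/-! ### The Cartan form, simple reflections and vectors of norm two -/

section Forms

variable {I : Type*} [Fintype I] [DecidableEq I]

/-- The symmetric bilinear form of a simply laced Cartan matrix. -/
def form (C : Matrix I I ℤ) (x y : I → ℤ) : ℤ := x ⬝ᵥ C.mulVec y

/-- A simply laced Cartan matrix of finite type with connected diagram. -/
structure IsSimplyLaced (C : Matrix I I ℤ) : Prop where
  symm : ∀ i j, C i j = C j i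
  diag : ∀ i, C i i = 2
  offDiag : ∀ i j, i ≠ j → C i j = 0 ∨ C i j = -1
  pos : ∀ v : I → ℤ, v ≠ 0 → 0 < form C v v
  bdd : ∃ B : ℤ, ∀ v : I → ℤ, (∀ i, 0 ≤ v i) → form C v v = 2 → ∀ i, v i ≤ B
  conn : ∀ i j, Relation.ReflTransGen (fun a b => C a b = -1) i j

/-- Nonnegative vectors of norm two. -/
def PosRoot (C : Matrix I I ℤ) (x : I → ℤ) : Prop := (∀ i, 0 ≤ x i) ∧ form C x x = 2

open Classical in
/-- The matrix of the Euler form of the quiver `Q`. -/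
noncomputable def eulerMatrix (Q : I → I → Prop) : Matrix I I ℤ :=
  Matrix.of fun i j => if i = j then 1 else if Q i j then -1 else 0

/-- The Euler form of the quiver `Q`. -/
noncomputable def euler (Q : I → I → Prop) (x y : I → ℤ) : ℤ :=
  x ⬝ᵥ (eulerMatrix Q).mulVec y

variable {C : Matrix I I ℤ} {Q : I → I → Prop}

@[simp] lemma form_add_left (x y z : I → ℤ) : form C (x + y) z = form C x z + form C y z := by
  simp [form, add_dotProduct]

@[simp] lemma form_add_right (x y z : I → ℤ) : form C x (y + z) = form C x y + form C x z := by
  simp [form, Matrix.mulVec_add, dotProduct_add]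

@[simp] lemma form_sub_left (x y z : I → ℤ) : form C (x - y) z = form C x z - form C y z := by
  simp [form, sub_dotProduct]

@[simp] lemma form_sub_right (x y z : I → ℤ) : form C x (y - z) = form C x y - form C x z := by
  simp [form, Matrix.mulVec_sub, dotProduct_sub]

@[simp] lemma form_smul_left (a : ℤ) (x y : I → ℤ) : form C (a • x) y = a * form C x y := by
  rw [form, smul_dotProduct, smul_eq_mul, form]

@[simp] lemma form_smul_right (a : ℤ) (x y : I → ℤ) : form C x (a • y) = a * form C x y := by
  rw [form, Matrix.mulVec_smul, dotProduct_smul, smul_eq_mul, form]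

@[simp] lemma form_neg_left (x y : I → ℤ) : form C (-x) y = -form C x y := by simp [form]

@[simp] lemma form_neg_right (x y : I → ℤ) : form C x (-y) = -form C x y := by
  simp [form, Matrix.mulVec_neg]

@[simp] lemma euler_add_left (x y z : I → ℤ) : euler Q (x + y) z = euler Q x z + euler Q y z := by
  simp [euler, add_dotProduct]

@[simp] lemma euler_add_right (x y z : I → ℤ) :
    euler Q x (y + z) = euler Q x y + euler Q x z := by
  simp [euler, Matrix.mulVec_add, dotProduct_add]

@[simp] lemma euler_sub_left (x y z : I → ℤ) : euler Q (x - y) z = euler Q x z - euler Q y z := by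
  simp [euler, sub_dotProduct]

@[simp] lemma euler_sub_right (x y z : I → ℤ) :
    euler Q x (y - z) = euler Q x y - euler Q x z := by
  simp [euler, Matrix.mulVec_sub, dotProduct_sub]

@[simp] lemma euler_smul_left (a : ℤ) (x y : I → ℤ) : euler Q (a • x) y = a * euler Q x y := by
  rw [euler, smul_dotProduct, smul_eq_mul, euler]

@[simp] lemma euler_smul_right (a : ℤ) (x y : I → ℤ) : euler Q x (a • y) = a * euler Q x y := by
  rw [euler, Matrix.mulVec_smul, dotProduct_smul, smul_eq_mul, euler]

@[simp] lemma euler_neg_left (x y : I → ℤ) : euler Q (-x) y = -euler Q x y := by simp [euler]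

lemma form_simpleRoot_left (i : I) (x : I → ℤ) : form C (simpleRoot i) x = C.mulVec x i := by
  simp [form, simpleRoot]

lemma IsSimplyLaced.form_comm (hC : IsSimplyLaced C) (x y : I → ℤ) : form C x y = form C y x := by
  have hT : C.transpose = C := by ext i j; exact hC.symm j i
  rw [form, Matrix.dotProduct_mulVec, ← Matrix.mulVec_transpose, hT, dotProduct_comm, form]

lemma IsSimplyLaced.form_simpleRoot (hC : IsSimplyLaced C) (i j : I) :
    form C (simpleRoot i) (simpleRoot j) = C i j := by
  rw [form_simpleRoot_left]
  simp [simpleRoot]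

lemma simpleReflection_apply (hC : IsSimplyLaced C) (i : I) (x : I → ℤ) :
    simpleReflection C i x = x - form C x (simpleRoot i) • simpleRoot i := by
  rw [hC.form_comm, form_simpleRoot_left]
  simp [simpleReflection, Module.preReflection_apply, simpleCoroot]

lemma form_simpleReflection (hC : IsSimplyLaced C) (i : I) (x y : I → ℤ) :
    form C (simpleReflection C i x) (simpleReflection C i y) = form C x y := by
  have h1 := hC.form_comm (simpleRoot i) y
  have h2 := hC.form_simpleRoot i i
  rw [hC.diag] at h2
  simp only [simpleReflection_apply hC, form_sub_left, form_sub_right, form_smul_left,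
    form_smul_right, h1, h2]
  ring

@[simp] lemma simpleReflection_simpleRoot (hC : IsSimplyLaced C) (i : I) :
    simpleReflection C i (simpleRoot i) = -simpleRoot i := by
  rw [simpleReflection_apply hC, hC.form_simpleRoot, hC.diag]
  module

lemma simpleReflection_simpleReflection (hC : IsSimplyLaced C) (i : I) (x : I → ℤ) :
    simpleReflection C i (simpleReflection C i x) = x := by
  have h2 := hC.form_simpleRoot i i
  rw [hC.diag] at h2
  simp only [simpleReflection_apply hC, form_sub_left, form_smul_left, h2]
  module

lemma simpleReflection_mul_self (hC : IsSimplyLaced C) (i : I) :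
    simpleReflection C i * simpleReflection C i = 1 :=
  LinearMap.ext fun x => simpleReflection_simpleReflection hC i x

lemma IsSimplyLaced.posRoot_simpleRoot (hC : IsSimplyLaced C) (i : I) :
    PosRoot C (simpleRoot i) := by
  refine ⟨fun j => ?_, by rw [hC.form_simpleRoot, hC.diag]⟩
  by_cases h : j = i <;> simp [simpleRoot, h]

/-- Removing one coordinate changes the norm by twice an integer, since the diagonal entries are 2;
induct on the size of the support. -/
lemma IsSimplyLaced.even (hC : IsSimplyLaced C) (v : I → ℤ) : Even (form C v v) := by
  classical
  induction hs : (Finset.univ.filter fun i => v i ≠ 0).card using Nat.strong_induction_on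
    generalizing v with
  | _ n ih =>
    by_cases h0 : v = 0
    · simp [h0, form]
    · obtain ⟨i, hi⟩ := Function.ne_iff.1 h0
      have hlt : (Finset.univ.filter fun k => (v - v i • simpleRoot i) k ≠ 0).card < n := by
        rw [← hs]
        apply Finset.card_lt_card
        rw [Finset.ssubset_iff_of_subset]
        · exact ⟨i, by simpa using hi, by simp [simpleRoot]⟩
        · intro k
          simp only [Finset.mem_filter, Finset.mem_univ, true_and]
          intro hk hvk
          rcases eq_or_ne k i with rfl | hne
          · simp [simpleRoot] at hk
          · simp [simpleRoot, hne, hvk] at hk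
      have := ih _ hlt _ rfl
      have h2 := hC.form_simpleRoot i i
      rw [hC.diag] at h2
      have h1 := hC.form_comm (simpleRoot i) v
      simp only [form_sub_left, form_sub_right, form_smul_left, form_smul_right, h1, h2] at this
      obtain ⟨r, hr⟩ := this
      exact ⟨r + v i * form C v (simpleRoot i) - v i ^ 2, by linarith⟩

lemma form_eq_sum (x y : I → ℤ) : form C x y = ∑ i, ∑ j, x i * C i j * y j := by
  simp [form, dotProduct, Matrix.mulVec, Finset.mul_sum, mul_assoc]

/-- A vector of norm two has coefficients of one sign. -/
lemma IsSimplyLaced.nonneg_or_nonpos (hC : IsSimplyLaced C) {v : I → ℤ} (hv : form C v v = 2) :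
    (∀ i, 0 ≤ v i) ∨ ∀ i, v i ≤ 0 := by
  set p : I → ℤ := fun i => max (v i) 0
  set q : I → ℤ := fun i => max (-v i) 0
  have hpq : v = p - q := by
    ext i
    rcases le_total 0 (v i) with h | h <;> simp [p, q, h]
  have hcross : form C p q ≤ 0 := by
    rw [form_eq_sum]
    refine Finset.sum_nonpos fun i _ => Finset.sum_nonpos fun j _ => ?_
    rcases eq_or_ne i j with rfl | hij
    · rcases le_total 0 (v i) with h | h <;> simp [p, q, h]
    · have h1 : 0 ≤ p i := le_max_right _ _
      have h2 : 0 ≤ q j := le_max_right _ _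
      rcases hC.offDiag i j hij with h | h <;> rw [h]
      · simp
      · nlinarith [mul_nonneg h1 h2]
  have key : form C v v = form C p p + form C q q - 2 * form C p q := by
    rw [hpq]
    simp only [form_sub_left, form_sub_right, hC.form_comm q p]
    ring
  by_cases hp : p = 0
  · right
    intro i
    have := congrFun hp i
    simpa [p] using this
  · by_cases hq : q = 0
    · left
      intro i
      have := congrFun hq i
      simpa [q] using this
    -- If both parts were nonzero, each would have norm at least 2 by evenness, and the cross term
    -- only increases the total, which would be at least 4.
    · obtain ⟨a, ha⟩ := hC.even p
      obtain ⟨b, hb⟩ := hC.even q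
      have := hC.pos p hp
      have := hC.pos q hq
      omega

lemma IsSimplyLaced.posRoot_or_neg (hC : IsSimplyLaced C) {v : I → ℤ} (hv : form C v v = 2) :
    PosRoot C v ∨ PosRoot C (-v) := by
  rcases hC.nonneg_or_nonpos hv with h | h
  · exact .inl ⟨h, hv⟩
  · exact .inr ⟨fun i => by simpa using h i, by simpa using hv⟩

lemma PosRoot.ne_zero {x : I → ℤ} (hx : PosRoot C x) : x ≠ 0 := by
  rintro rfl
  have := hx.2
  simp [form] at this

lemma PosRoot.not_neg {x : I → ℤ} (hx : PosRoot C x) (h : PosRoot C (-x)) : False :=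
  hx.ne_zero (funext fun i => le_antisymm (by simpa using h.1 i) (hx.1 i))

/-- Cauchy's inequality for vectors of norm two. -/
lemma IsSimplyLaced.form_le_one (hC : IsSimplyLaced C) {x y : I → ℤ} (hx : form C x x = 2)
    (hy : form C y y = 2) (hne : x ≠ y) : form C x y ≤ 1 := by
  have := hC.pos (x - y) (sub_ne_zero.2 hne)
  simp only [form_sub_left, form_sub_right, hC.form_comm y x] at this
  omega

/-- The reflection changes only the coefficient at i. If the image is negative, all other
coefficients of x vanish, and norm two leaves only x = α_i. -/
lemma PosRoot.simpleReflection (hC : IsSimplyLaced C) {x : I → ℤ} (hx : PosRoot C x) {i : I}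
    (hne : x ≠ simpleRoot i) : PosRoot C (simpleReflection C i x) := by
  have h2 : form C (QRadius.simpleReflection C i x) (QRadius.simpleReflection C i x) = 2 := by
    rw [form_simpleReflection hC, hx.2]
  rcases hC.posRoot_or_neg h2 with h | h
  · exact h
  · exfalso
    apply hne
    have hk : ∀ k, k ≠ i → x k = 0 := by
      intro k hk
      have h1 := h.1 k
      simp only [simpleReflection_apply hC, simpleRoot, Pi.neg_apply, Pi.sub_apply, Pi.smul_apply,
        Pi.single_eq_of_ne hk, smul_zero, sub_zero] at h1
      exact le_antisymm (by simpa using h1) (hx.1 k)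
    have hxi : x = x i • simpleRoot i := by
      ext k
      rcases eq_or_ne k i with rfl | hki
      · simp [simpleRoot]
      · simp [simpleRoot, hki, hk k hki]
    have h3 := hx.2
    rw [hxi] at h3
    simp only [form_smul_left, form_smul_right, hC.form_simpleRoot, hC.diag] at h3
    have h4 := hx.1 i
    have : x i = 1 := by nlinarith
    rw [hxi, this, one_smul]

end Forms

/-! ### The Euler form of a Dynkin quiver and reflection at a source -/

section Quivers

variable {I : Type*} [Fintype I] [DecidableEq I] {C : Matrix I I ℤ} {Q : I → I → Prop}

lemma IsDynkinQuiver.irrefl (hC : IsSimplyLaced C) (hQ : IsDynkinQuiver C Q) (i : I) :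
    ¬ Q i i := by
  intro h
  have := hQ.1 i i h
  rw [hC.diag] at this
  omega

lemma IsDynkinQuiver.asymm (hC : IsSimplyLaced C) (hQ : IsDynkinQuiver C Q) {i j : I}
    (h : Q i j) : ¬ Q j i := (hQ.2 i j (hQ.1 i j h)).1 h

lemma IsDynkinQuiver.reverse (hC : IsSimplyLaced C) (hQ : IsDynkinQuiver C Q) :
    IsDynkinQuiver C (fun i j => Q j i) := by
  refine ⟨fun i j h => hC.symm i j ▸ hQ.1 j i h, fun i j h => hQ.2 j i (hC.symm i j ▸ h)⟩

lemma IsDynkinQuiver.reflectAt (hC : IsSimplyLaced C) (hQ : IsDynkinQuiver C Q) (i : I) :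
    IsDynkinQuiver C (reflectAt i Q) := by
  constructor
  · intro a b h
    unfold QRadius.reflectAt at h
    split_ifs at h
    · rw [hC.symm]; exact hQ.1 _ _ h
    · exact hQ.1 _ _ h
  · intro a b h
    have h1 := hQ.2 a b h
    have h2 := hQ.2 b a (hC.symm a b ▸ h)
    unfold QRadius.reflectAt
    by_cases ha : a = i <;> by_cases hb : b = i <;> simp [ha, hb] at * <;> tauto

lemma eulerMatrix_add_transpose (hC : IsSimplyLaced C) (hQ : IsDynkinQuiver C Q) :
    eulerMatrix Q + (eulerMatrix Q).transpose = C := by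
  ext i j
  rcases eq_or_ne i j with rfl | hij
  · simp [eulerMatrix, hC.diag]
  · simp only [eulerMatrix, Matrix.add_apply, Matrix.of_apply, hij, if_false, hij.symm,
      Matrix.transpose_apply]
    rcases hC.offDiag i j hij with h | h
    · have h1 : ¬ Q i j := fun hq => by have := hQ.1 i j hq; omega
      have h2 : ¬ Q j i := fun hq => by
        have := hQ.1 j i hq
        rw [hC.symm] at this
        omega
      simp [h1, h2, h]
    · have := hQ.2 i j h
      by_cases hq : Q i j
      · simp [hq, this.1 hq, h]
      · have : Q j i := by tauto
        simp [hq, this, h]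

lemma euler_add_euler (hC : IsSimplyLaced C) (hQ : IsDynkinQuiver C Q) (x y : I → ℤ) :
    euler Q x y + euler Q y x = form C x y := by
  rw [form, ← eulerMatrix_add_transpose hC hQ, Matrix.add_mulVec, dotProduct_add, euler, euler,
    Matrix.dotProduct_mulVec y, Matrix.mulVec_transpose, dotProduct_comm x]
  rw [dotProduct_comm x]

lemma euler_self (hC : IsSimplyLaced C) (hQ : IsDynkinQuiver C Q) {x : I → ℤ}
    (hx : form C x x = 2) : euler Q x x = 1 := by
  have := euler_add_euler hC hQ x x
  omega

lemma euler_eq_sum (x y : I → ℤ) : euler Q x y = ∑ i, ∑ j, x i * eulerMatrix Q i j * y j := by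
  simp [euler, dotProduct, Matrix.mulVec, Finset.mul_sum, mul_assoc]

lemma euler_reverse (hC : IsSimplyLaced C) (hQ : IsDynkinQuiver C Q) (x y : I → ℤ) :
    euler (fun i j => Q j i) x y = euler Q y x := by
  rw [euler_eq_sum, euler_eq_sum, Finset.sum_comm]
  refine Finset.sum_congr rfl fun i _ => Finset.sum_congr rfl fun j _ => ?_
  simp only [eulerMatrix, Matrix.of_apply, eq_comm (a := j)]
  ring

/-- Pairing with a simple root at a source on the right. -/
lemma euler_simpleRoot_source (hC : IsSimplyLaced C) (hQ : IsDynkinQuiver C Q) {i : I}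
    (hi : IsSource Q i) (x : I → ℤ) : euler Q x (simpleRoot i) = x i := by
  rw [euler, simpleRoot, Matrix.mulVec_single_one]
  simp only [dotProduct, Matrix.col_apply, eulerMatrix, Matrix.of_apply, hi _, if_false]
  simp

lemma euler_source_simpleRoot (hC : IsSimplyLaced C) (hQ : IsDynkinQuiver C Q) {i : I}
    (hi : IsSource Q i) (x : I → ℤ) :
    euler Q (simpleRoot i) x = - simpleReflection C i x i := by
  have h1 := euler_add_euler hC hQ (simpleRoot i) x
  rw [euler_simpleRoot_source hC hQ hi] at h1
  rw [simpleReflection_apply hC, ← hC.form_comm, Pi.sub_apply, Pi.smul_apply]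
  simp [simpleRoot] at h1 ⊢
  omega

/-- At a source, the off-diagonal part of row i of the Euler matrix is that of the Cartan matrix,
and the off-diagonal part of column i is zero. Reversing the arrows at i exchanges the two, which
produces the two correction terms. -/
lemma euler_reflectAt_eq (hC : IsSimplyLaced C) (hQ : IsDynkinQuiver C Q) {i : I}
    (hi : IsSource Q i) (x y : I → ℤ) :
    euler (reflectAt i Q) x y = euler Q x y + x i * (2 * y i - form C (simpleRoot i) y)
      - (2 * x i - form C (simpleRoot i) x) * y i := by
  classical
  have hcol : ∀ z : I → ℤ, ∑ k, (if k = i then 0 else C i k * z k)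
      = form C (simpleRoot i) z - 2 * z i := by
    intro z
    rw [form_simpleRoot_left, Matrix.mulVec, dotProduct, eq_sub_iff_add_eq,
      ← Finset.sum_erase_add Finset.univ _ (Finset.mem_univ i)]
    rw [← Finset.sum_erase_add Finset.univ (fun k => C i k * z k) (Finset.mem_univ i)]
    simp only [if_true, add_zero, hC.diag]
    congr 1
    refine Finset.sum_congr rfl fun k hk => ?_
    simp [Finset.ne_of_mem_erase hk]
  have hentry : ∀ a b, eulerMatrix (reflectAt i Q) a b = eulerMatrix Q a b
      - (if a = i then (if b = i then 0 else C i b) else 0)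
      + (if b = i then (if a = i then 0 else C i a) else 0) := by
    intro a b
    have h0 : ∀ k, k ≠ i → C i k = if Q i k then -1 else 0 := by
      intro k hk
      split_ifs with h
      · exact hQ.1 _ _ h
      · rcases hC.offDiag i k hk.symm with h' | h'
        · exact h'
        · exact absurd ((hQ.2 i k h').2 (hi k)) h
    have h1 : ∀ p q, (p = i ∨ q = i) → reflectAt i Q p q = Q q p := by
      intro p q h
      simp [reflectAt, h]
    by_cases ha : a = i <;> by_cases hb : b = i
    · simp [eulerMatrix, ha, hb]
    · simp only [eulerMatrix, Matrix.of_apply, h1 a b (.inl ha)]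
      subst ha
      simp [hb, Ne.symm hb, h0 b hb, hi b]
    · simp only [eulerMatrix, Matrix.of_apply, h1 a b (.inr hb)]
      subst hb
      simp [ha, h0 a ha, hi a]
    · have h2 : reflectAt i Q a b = Q a b := by simp [reflectAt, ha, hb]
      simp only [eulerMatrix, Matrix.of_apply, h2]
      simp [ha, hb]
  rw [euler_eq_sum, euler_eq_sum]
  have : ∀ a b, x a * eulerMatrix (reflectAt i Q) a b * y b = x a * eulerMatrix Q a b * y b
      - (if a = i then x i * (if b = i then 0 else C i b * y b) else 0)
      + (if b = i then (if a = i then 0 else C i a * x a) * y i else 0) := by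
    intro a b
    rw [hentry]
    by_cases ha : a = i <;> by_cases hb : b = i <;> simp [ha, hb] <;> ring
  have e1 : ∑ a, ∑ b, (if a = i then x i * (if b = i then 0 else C i b * y b) else 0)
      = x i * (form C (simpleRoot i) y - 2 * y i) := by
    rw [Finset.sum_eq_single_of_mem i (Finset.mem_univ i) fun a _ ha => by simp [ha]]
    simp only [if_true, ← Finset.mul_sum, hcol]
  have e2 : ∑ a, ∑ b, (if b = i then (if a = i then 0 else C i a * x a) * y i else 0)
      = (form C (simpleRoot i) x - 2 * x i) * y i := by
    rw [← hcol, Finset.sum_mul]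
    refine Finset.sum_congr rfl fun a _ => ?_
    rw [Finset.sum_ite_eq' Finset.univ i, if_pos (Finset.mem_univ i)]
  simp only [this, Finset.sum_add_distrib, Finset.sum_sub_distrib, e1, e2]
  ring

/-- Reflection at a source preserves the Euler form. -/
lemma euler_reflectAt (hC : IsSimplyLaced C) (hQ : IsDynkinQuiver C Q) {i : I}
    (hi : IsSource Q i) (x y : I → ℤ) :
    euler (reflectAt i Q) (simpleReflection C i x) (simpleReflection C i y) = euler Q x y := by
  have h1 : ∀ z, euler Q (simpleRoot i) z = form C (simpleRoot i) z - z i := by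
    intro z
    have := euler_add_euler hC hQ (simpleRoot i) z
    rw [euler_simpleRoot_source hC hQ hi] at this
    omega
  have h3 := hC.form_simpleRoot i i
  rw [hC.diag] at h3
  have h4 : (simpleRoot i : I → ℤ) i = 1 := by simp [simpleRoot]
  rw [euler_reflectAt_eq hC hQ hi]
  simp only [simpleReflection_apply hC, euler_sub_left, euler_sub_right, euler_smul_left,
    euler_smul_right, form_sub_right, form_smul_right, h3, Pi.sub_apply, Pi.smul_apply, h4,
    euler_simpleRoot_source hC hQ hi, h1, smul_eq_mul, hC.form_comm _ (simpleRoot i)]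
  ring

/-- The quiver obtained by reflecting successively at the letters of a word. -/
def reflectWord : List I → (I → I → Prop) → I → I → Prop
  | [], Q => Q
  | i :: w, Q => reflectWord w (reflectAt i Q)

lemma reflectWord_append (u v : List I) (Q : I → I → Prop) :
    reflectWord (u ++ v) Q = reflectWord v (reflectWord u Q) := by
  induction u generalizing Q with
  | nil => rfl
  | cons i u ih => exact ih _

lemma isAdapted_append (u v : List I) (Q : I → I → Prop) :
    IsAdapted Q (u ++ v) ↔ IsAdapted Q u ∧ IsAdapted (reflectWord u Q) v := by
  induction u generalizing Q with
  | nil => simp [IsAdapted, reflectWord]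
  | cons i u ih => simp [IsAdapted, reflectWord, ih, and_assoc]

lemma IsDynkinQuiver.reflectWord (hC : IsSimplyLaced C) (hQ : IsDynkinQuiver C Q) (w : List I) :
    IsDynkinQuiver C (reflectWord w Q) := by
  induction w generalizing Q with
  | nil => exact hQ
  | cons i w ih => exact ih (hQ.reflectAt hC i)

end Quivers

/-! ### Reduced words, their roots and inversion sets -/

section Words

variable {I : Type*} [Fintype I] [DecidableEq I] {C : Matrix I I ℤ} {Q : I → I → Prop}

@[simp] lemma wordProd_nil : wordProd C ([] : List I) = 1 := rfl

@[simp] lemma wordProd_cons (i : I) (w : List I) :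
    wordProd C (i :: w) = simpleReflection C i * wordProd C w := by simp [wordProd]

@[simp] lemma wordProd_append (u v : List I) :
    wordProd C (u ++ v) = wordProd C u * wordProd C v := by simp [wordProd]

lemma wordProd_reverse_mul (hC : IsSimplyLaced C) (w : List I) :
    wordProd C w.reverse * wordProd C w = 1 := by
  induction w with
  | nil => simp
  | cons i w ih =>
    rw [List.reverse_cons, wordProd_append, wordProd_cons, wordProd_cons, wordProd_nil, mul_one,
      mul_assoc, ← mul_assoc (simpleReflection C i), simpleReflection_mul_self hC, one_mul, ih]

lemma wordProd_mul_reverse (hC : IsSimplyLaced C) (w : List I) :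
    wordProd C w * wordProd C w.reverse = 1 := by
  simpa using wordProd_reverse_mul hC w.reverse

lemma wordProd_reverse_apply (hC : IsSimplyLaced C) (w : List I) (x : I → ℤ) :
    wordProd C w.reverse (wordProd C w x) = x := by
  rw [← Module.End.mul_apply, wordProd_reverse_mul hC, Module.End.one_apply]

lemma wordProd_apply_reverse (hC : IsSimplyLaced C) (w : List I) (x : I → ℤ) :
    wordProd C w (wordProd C w.reverse x) = x := by
  simpa using wordProd_reverse_apply hC w.reverse x

lemma form_wordProd (hC : IsSimplyLaced C) (w : List I) (x y : I → ℤ) :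
    form C (wordProd C w x) (wordProd C w y) = form C x y := by
  induction w with
  | nil => simp
  | cons i w ih => simp [form_simpleReflection hC, ih]

/-- An adapted word transports the Euler form. -/
lemma euler_wordProd (hC : IsSimplyLaced C) (hQ : IsDynkinQuiver C Q) {w : List I}
    (hw : IsAdapted Q w) (x y : I → ℤ) :
    euler Q (wordProd C w x) (wordProd C w y) = euler (reflectWord w Q) x y := by
  induction w generalizing Q with
  | nil => simp [reflectWord]
  | cons i w ih =>
    have h := euler_reflectAt hC hQ hw.1 (simpleReflection C i (wordProd C w x))
      (simpleReflection C i (wordProd C w y))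
    rw [simpleReflection_simpleReflection hC, simpleReflection_simpleReflection hC] at h
    rw [wordProd_cons, Module.End.mul_apply, Module.End.mul_apply, ← h]
    exact ih (hQ.reflectAt hC i) hw.2

/-- The list of the roots of a word. -/
def rootsOf (C : Matrix I I ℤ) : List I → List (I → ℤ)
  | [] => []
  | i :: w => simpleRoot i :: (rootsOf C w).map (simpleReflection C i)

@[simp] lemma length_rootsOf (w : List I) : (rootsOf C w).length = w.length := by
  induction w with
  | nil => rfl
  | cons i w ih => simp [rootsOf, ih]

lemma rootsOf_append (u v : List I) :
    rootsOf C (u ++ v) = rootsOf C u ++ (rootsOf C v).map (wordProd C u) := by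
  induction u with
  | nil =>
    exact (List.map_id _).symm
  | cons i u ih => simp [rootsOf, ih, Function.comp_def]

lemma rootAt_eq (w : List I) (k : Fin w.length) :
    rootAt C w k = (rootsOf C w)[(k : ℕ)]'(by simp) := by
  induction w with
  | nil => exact k.elim0
  | cons i w ih =>
    rcases k with ⟨_ | k, hk⟩
    · simp [rootAt, rootsOf]
    · have := ih ⟨k, by simpa using hk⟩
      simp only [rootAt, rootsOf, List.getElem_cons_succ, List.getElem_map,
        List.take_succ_cons, wordProd_cons, Module.End.mul_apply] at this ⊢
      rw [← this]
      rfl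

lemma exists_rootAt_iff (w : List I) (x : I → ℤ) :
    (∃ k, rootAt C w k = x) ↔ x ∈ rootsOf C w := by
  simp only [rootAt_eq, List.mem_iff_getElem]
  constructor
  · rintro ⟨k, hk⟩
    exact ⟨k, by simp, hk⟩
  · rintro ⟨k, hk, h⟩
    exact ⟨⟨k, by simpa using hk⟩, h⟩

lemma mem_rootsOf {w : List I} {x : I → ℤ} (hx : x ∈ rootsOf C w) :
    ∃ u i v, w = u ++ i :: v ∧ x = wordProd C u (simpleRoot i) := by
  induction w generalizing x with
  | nil => simp [rootsOf] at hx
  | cons k w ih =>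
    simp only [rootsOf, List.mem_cons, List.mem_map] at hx
    rcases hx with rfl | ⟨y, hy, rfl⟩
    · exact ⟨[], k, w, by simp, by simp⟩
    · obtain ⟨u, i, v, rfl, rfl⟩ := ih hy
      exact ⟨k :: u, i, v, by simp, by simp⟩

/-- Words all of whose roots are positive and distinct, as a recursive condition. -/
def GoodWord (C : Matrix I I ℤ) : List I → Prop
  | [] => True
  | i :: w => GoodWord C w ∧ simpleRoot i ∉ rootsOf C w

lemma GoodWord.posRoot (hC : IsSimplyLaced C) {w : List I} (hw : GoodWord C w) {x : I → ℤ}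
    (hx : x ∈ rootsOf C w) : PosRoot C x := by
  induction w generalizing x with
  | nil => simp [rootsOf] at hx
  | cons i w ih =>
    simp only [rootsOf, List.mem_cons, List.mem_map] at hx
    rcases hx with rfl | ⟨y, hy, rfl⟩
    · exact hC.posRoot_simpleRoot i
    · exact (ih hw.1 hy).simpleReflection hC fun h => hw.2 (h ▸ hy)

lemma simpleReflection_injective (hC : IsSimplyLaced C) (i : I) :
    Function.Injective (simpleReflection C i) :=
  Function.LeftInverse.injective (simpleReflection_simpleReflection hC i)

lemma GoodWord.nodup (hC : IsSimplyLaced C) {w : List I} (hw : GoodWord C w) :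
    (rootsOf C w).Nodup := by
  induction w with
  | nil => simp [rootsOf]
  | cons i w ih =>
    refine List.nodup_cons.2 ⟨?_, (ih hw.1).map (simpleReflection_injective hC i)⟩
    rw [List.mem_map]
    rintro ⟨y, hy, h⟩
    have h1 : y = -simpleRoot i := by
      rw [← simpleReflection_simpleRoot hC, ← h, simpleReflection_simpleReflection hC]
    exact (hC.posRoot_simpleRoot i).not_neg (h1 ▸ hw.1.posRoot hC hy)

/-- Inversions of a word are among its roots, up to sign. -/
lemma mem_rootsOf_of_inversion (hC : IsSimplyLaced C) {w : List I} {x : I → ℤ}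
    (hx : PosRoot C x) (h : PosRoot C (-wordProd C w.reverse x)) :
    x ∈ rootsOf C w ∨ -x ∈ rootsOf C w := by
  induction w generalizing x with
  | nil => exact (hx.not_neg (by simpa using h)).elim
  | cons i w ih =>
    by_cases hxi : x = simpleRoot i
    · left
      simp [rootsOf, hxi]
    · have := ih (hx.simpleReflection hC hxi) (by simpa using h)
      rcases this with h1 | h1
      · left
        refine List.mem_cons_of_mem _ (List.mem_map.2 ⟨_, h1, ?_⟩)
        exact simpleReflection_simpleReflection hC i x
      · right
        refine List.mem_cons_of_mem _ (List.mem_map.2 ⟨_, h1, ?_⟩)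
        rw [map_neg, simpleReflection_simpleReflection hC i x]

/-- Inversions of any word are among its roots up to sign, and goodness fixes the sign. For the
converse, the first simple root is not a root of the tail, so the inverse of the tail keeps it
positive, and the extra reflection makes it negative. -/
lemma GoodWord.mem_iff (hC : IsSimplyLaced C) {w : List I} (hw : GoodWord C w) {x : I → ℤ}
    (hx : PosRoot C x) : x ∈ rootsOf C w ↔ PosRoot C (-wordProd C w.reverse x) := by
  constructor
  · intro h
    induction w generalizing x with
    | nil => simp [rootsOf] at h
    | cons i w ih =>
      simp only [rootsOf, List.mem_cons, List.mem_map] at h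
      simp only [List.reverse_cons, wordProd_append, wordProd_cons, wordProd_nil, mul_one,
        Module.End.mul_apply]
      rcases h with rfl | ⟨y, hy, rfl⟩
      · rw [simpleReflection_simpleRoot hC, map_neg, neg_neg]
        have h2 : form C (wordProd C w.reverse (simpleRoot i))
            (wordProd C w.reverse (simpleRoot i)) = 2 := by rw [form_wordProd hC, hx.2]
        rcases hC.posRoot_or_neg h2 with h3 | h3
        · exact h3
        · rcases mem_rootsOf_of_inversion hC hx h3 with h4 | h4
          · exact absurd h4 hw.2
          · exact (hx.not_neg (hw.1.posRoot hC h4)).elim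
      · rw [simpleReflection_simpleReflection hC]
        exact ih hw.1 (hw.1.posRoot hC hy) hy
  · intro h
    rcases mem_rootsOf_of_inversion hC hx h with h1 | h1
    · exact h1
    · exact (hx.not_neg (hw.posRoot hC h1)).elim

lemma GoodWord.not_mem_iff (hC : IsSimplyLaced C) {w : List I} (hw : GoodWord C w) {x : I → ℤ}
    (hx : PosRoot C x) : x ∉ rootsOf C w ↔ PosRoot C (wordProd C w.reverse x) := by
  have h2 : form C (wordProd C w.reverse x) (wordProd C w.reverse x) = 2 := by
    rw [form_wordProd hC, hx.2]
  rw [hw.mem_iff hC hx]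
  constructor
  · intro h
    exact (hC.posRoot_or_neg h2).resolve_right h
  · intro h h'
    exact h.not_neg h'

/-- The inversions depend only on the Weyl group element. Each of them occurs, up to sign, among the
roots of any other word for that element, so such a word is at least as long. The map `g` selects
the sign that occurs. -/
lemma GoodWord.isReduced (hC : IsSimplyLaced C) {w : List I} (hw : GoodWord C w) :
    IsReduced C w := by
  classical
  intro w' h
  have hinv : wordProd C w'.reverse = wordProd C w.reverse := by
    calc wordProd C w'.reverse = wordProd C w'.reverse * (wordProd C w * wordProd C w.reverse) := by
          rw [wordProd_mul_reverse hC, mul_one]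
      _ = _ := by rw [← mul_assoc, ← h, wordProd_reverse_mul hC, one_mul]
  let g : (I → ℤ) → (I → ℤ) := fun x => if x ∈ rootsOf C w' then x else -x
  have h1 : (rootsOf C w).toFinset.image g ⊆ (rootsOf C w').toFinset := by
    intro y hy
    simp only [Finset.mem_image, List.mem_toFinset] at hy ⊢
    obtain ⟨x, hx, rfl⟩ := hy
    have hp := hw.posRoot hC hx
    have := mem_rootsOf_of_inversion hC (w := w') hp (hinv ▸ (hw.mem_iff hC hp).1 hx)
    by_cases h3 : x ∈ rootsOf C w'
    · simp [g, h3]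
    · simp [g, h3, this.resolve_left h3]
  have h2 : Set.InjOn g (rootsOf C w).toFinset := by
    intro x hx y hy hxy
    rw [Finset.mem_coe, List.mem_toFinset] at hx hy
    have hpx := hw.posRoot hC hx
    have hpy := hw.posRoot hC hy
    simp only [g] at hxy
    split_ifs at hxy
    · exact hxy
    · exact (hpy.not_neg (hxy ▸ hpx)).elim
    · exact (hpx.not_neg (by rw [hxy]; exact hpy)).elim
    · exact neg_injective hxy
  calc w.length = (rootsOf C w).toFinset.card := by
        rw [List.toFinset_card_of_nodup (hw.nodup hC), length_rootsOf]
    _ = ((rootsOf C w).toFinset.image g).card := (Finset.card_image_of_injOn h2).symm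
    _ ≤ (rootsOf C w').toFinset.card := Finset.card_le_card h1
    _ ≤ (rootsOf C w').length := List.toFinset_card_le _
    _ = w'.length := length_rootsOf _

lemma wordProd_conj (hC : IsSimplyLaced C) {u : List I} {i k : I}
    (h : simpleRoot i = wordProd C u (simpleRoot k)) :
    simpleReflection C i * wordProd C u = wordProd C u * simpleReflection C k := by
  refine LinearMap.ext fun x => ?_
  simp only [Module.End.mul_apply, simpleReflection_apply hC, map_sub, map_smul]
  rw [h, form_wordProd hC]

/-- Exchange argument: if α_i is a root of the tail, the first letter cancels against the letter
that produces this root, and a shorter word results. -/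
lemma IsReduced.goodWord (hC : IsSimplyLaced C) {w : List I} (hw : IsReduced C w) :
    GoodWord C w := by
  induction w with
  | nil => trivial
  | cons i w ih =>
    refine ⟨ih fun w' h => ?_, fun hmem => ?_⟩
    · have := hw (i :: w') (by simp [h])
      simpa using this
    · obtain ⟨u, k, v, rfl, hk⟩ := mem_rootsOf hmem
      have := hw (u ++ v) (by
        rw [wordProd_cons, wordProd_append, wordProd_append, ← mul_assoc, wordProd_conj hC hk,
          wordProd_cons, mul_assoc, ← mul_assoc (simpleReflection C k),
          simpleReflection_mul_self hC, one_mul])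
      simp at this

/-- Goodness is defined by prepending, so the new root is followed through the removal of the first
letter k. It could turn negative only as -α_k; then α_k would be an inversion of the tail, which
goodness excludes. -/
lemma GoodWord.append_singleton (hC : IsSimplyLaced C) {w : List I} (hw : GoodWord C w) {i : I}
    (h : PosRoot C (wordProd C w (simpleRoot i))) : GoodWord C (w ++ [i]) := by
  induction w with
  | nil => simp [GoodWord, rootsOf]
  | cons k w ih =>
    have hnk : simpleRoot k ∉ rootsOf C w := hw.2
    have hpos : PosRoot C (wordProd C w (simpleRoot i)) := by
      have h2 : form C (wordProd C w (simpleRoot i)) (wordProd C w (simpleRoot i)) = 2 := by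
        rw [form_wordProd hC, (hC.posRoot_simpleRoot i).2]
      rcases hC.posRoot_or_neg h2 with h3 | h3
      · exact h3
      · by_cases h4 : -wordProd C w (simpleRoot i) = simpleRoot k
        · have h5 := (hw.1.not_mem_iff hC (hC.posRoot_simpleRoot k)).1 hnk
          rw [← h4, map_neg, wordProd_reverse_apply hC] at h5
          exact ((hC.posRoot_simpleRoot i).not_neg h5).elim
        · have h5 := h3.simpleReflection hC h4
          rw [map_neg] at h5
          rw [wordProd_cons] at h
          exact (h.not_neg h5).elim
    refine ⟨ih hw.1 hpos, ?_⟩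
    change simpleRoot k ∉ rootsOf C (w ++ [i])
    rw [rootsOf_append, List.mem_append]
    rintro (h1 | h1)
    · exact hnk h1
    · simp only [rootsOf, List.map_nil, List.map_cons, List.mem_singleton] at h1
      rw [wordProd_cons, Module.End.mul_apply, ← h1, simpleReflection_simpleRoot hC] at h
      exact (hC.posRoot_simpleRoot k).not_neg h

lemma IsSimplyLaced.finite_posRoot (hC : IsSimplyLaced C) : {x | PosRoot C x}.Finite := by
  obtain ⟨B, hB⟩ := hC.bdd
  refine (Set.finite_Icc (0 : I → ℤ) fun _ => B).subset fun x hx => ?_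
  exact ⟨fun i => hx.1 i, fun i => hB x hx.1 hx.2 i⟩

lemma GoodWord.length_le (hC : IsSimplyLaced C) {w : List I} (hw : GoodWord C w) :
    w.length ≤ hC.finite_posRoot.toFinset.card := by
  classical
  rw [← length_rootsOf (C := C), ← List.toFinset_card_of_nodup (hw.nodup hC)]
  apply Finset.card_le_card
  intro x hx
  simpa using hw.posRoot hC (by simpa using hx)

lemma eq_sum_simpleRoot (x : I → ℤ) : x = ∑ i, x i • simpleRoot i := by
  ext k
  simp [simpleRoot, Pi.single_apply]

lemma wordProd_nonpos {w : List I}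
    (h : ∀ i k, wordProd C w (simpleRoot i) k ≤ 0) {x : I → ℤ} (hx : ∀ i, 0 ≤ x i) (k : I) :
    wordProd C w x k ≤ 0 := by
  rw [eq_sum_simpleRoot x, map_sum, Finset.sum_apply]
  refine Finset.sum_nonpos fun i _ => ?_
  rw [map_smul, Pi.smul_apply, smul_eq_mul]
  exact mul_nonpos_of_nonneg_of_nonpos (hx i) (h i k)

lemma PosRoot.not_nonpos {x : I → ℤ} (hx : PosRoot C x) (h : ∀ i, x i ≤ 0) : False :=
  hx.ne_zero (funext fun i => le_antisymm (h i) (hx.1 i))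

/-- The roots of a reduced expression of the longest element are all the positive roots. -/
lemma IsLongestReduced.mem_rootsOf (hC : IsSimplyLaced C) {w : List I}
    (hw : IsLongestReduced C w) {x : I → ℤ} (hx : PosRoot C x) : x ∈ rootsOf C w := by
  have hg := hw.1.goodWord hC
  -- A missing simple root could be prepended to give a longer reduced word.
  have hall : ∀ i, simpleRoot i ∈ rootsOf C w := by
    intro i
    by_contra h
    have := hw.2 (i :: w) (GoodWord.isReduced hC ⟨hg, h⟩)
    simp at this
  by_contra h
  refine ((hg.not_mem_iff hC hx).1 h).not_nonpos fun k => wordProd_nonpos (fun i l => ?_) hx.1 k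
  have := ((hg.mem_iff hC (hC.posRoot_simpleRoot i)).1 (hall i)).1 l
  simpa using this

/-- A positive root outside the list would be the image under w of a nonnegative vector, hence
nonpositive. So the roots of w exhaust the positive roots, and their number bounds the length of
every reduced word. -/
lemma isLongestReduced_of_neg (hC : IsSimplyLaced C) {w : List I} (hw : GoodWord C w)
    (h : ∀ i, PosRoot C (-wordProd C w (simpleRoot i))) : IsLongestReduced C w := by
  classical
  refine ⟨hw.isReduced hC, fun w' hw' => ?_⟩
  refine ((hw'.goodWord hC).length_le hC).trans ?_
  rw [← length_rootsOf (C := C) w, ← List.toFinset_card_of_nodup (hw.nodup hC)]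
  apply Finset.card_le_card
  intro x hx
  have hx' : PosRoot C x := by simpa using hx
  rw [List.mem_toFinset]
  by_contra hn
  have h1 := (hw.not_mem_iff hC hx').1 hn
  refine hx'.not_nonpos fun k => ?_
  rw [← wordProd_apply_reverse hC w x]
  exact wordProd_nonpos (fun i l => by simpa using (h i).1 l) h1.1 k

end Words

/-! ### Adapted words: sign law, existence and rearrangement -/

section AdaptedWords

variable {I : Type*} [Fintype I] [DecidableEq I] {C : Matrix I I ℤ} {Q : I → I → Prop}

/-- The value is minus the i-th coefficient of r_i x, which is again a positive root. -/
lemma euler_source_nonpos (hC : IsSimplyLaced C) (hQ : IsDynkinQuiver C Q) {i : I}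
    (hi : IsSource Q i) {x : I → ℤ} (hx : PosRoot C x) (hne : x ≠ simpleRoot i) :
    euler Q (simpleRoot i) x ≤ 0 := by
  rw [euler_source_simpleRoot hC hQ hi]
  have := (hx.simpleReflection hC hne).1 i
  omega

lemma euler_nonpos_of_not_mem (hC : IsSimplyLaced C) (hQ : IsDynkinQuiver C Q) {w : List I}
    (hw : GoodWord C w) (ha : IsAdapted Q w) {x y : I → ℤ} (hx : x ∈ rootsOf C w)
    (hy : PosRoot C y) (hyw : y ∉ rootsOf C w) : euler Q x y ≤ 0 := by
  induction w generalizing Q x y with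
  | nil => simp [rootsOf] at hx
  | cons i w ih =>
    simp only [rootsOf, List.mem_cons, List.mem_map, not_or] at hx hyw
    rcases hx with rfl | ⟨z, hz, rfl⟩
    · exact euler_source_nonpos hC hQ ha.1 hy hyw.1
    · rw [← euler_reflectAt hC hQ ha.1, simpleReflection_simpleReflection hC]
      refine ih (hQ.reflectAt hC i) hw.1 ha.2 hz (hy.simpleReflection hC hyw.1) fun h => ?_
      exact hyw.2 ⟨_, h, simpleReflection_simpleReflection hC i y⟩

/-- Reflecting away the first letter transports the Euler form to the reflected quiver, for which
the tail is adapted. Only comparisons with a simple root at a source need an argument. -/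
lemma pairwise_rootsOf (hC : IsSimplyLaced C) (hQ : IsDynkinQuiver C Q) {w : List I}
    (hw : GoodWord C w) (ha : IsAdapted Q w) :
    (rootsOf C w).Pairwise fun x y => euler Q x y ≤ 0 ∧ 0 ≤ euler Q y x := by
  induction w generalizing Q with
  | nil => simp [rootsOf]
  | cons i w ih =>
    refine List.pairwise_cons.2 ⟨?_, ?_⟩
    · intro y hy
      have hy' : y ∈ rootsOf C (i :: w) := List.mem_cons_of_mem _ hy
      have hp := hw.posRoot hC hy'
      have hne : y ≠ simpleRoot i := by
        rintro rfl
        exact (List.nodup_cons.1 (hw.nodup hC)).1 hy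
      refine ⟨euler_source_nonpos hC hQ ha.1 hp hne, ?_⟩
      rw [euler_simpleRoot_source hC hQ ha.1]
      exact hp.1 i
    · rw [List.pairwise_map]
      refine (ih (hQ.reflectAt hC i) hw.1 ha.2).imp fun {x y} h => ?_
      rw [← euler_reflectAt hC hQ ha.1, ← euler_reflectAt hC hQ ha.1,
        simpleReflection_simpleReflection hC, simpleReflection_simpleReflection hC]
      exact h

/-- A Dynkin quiver has no oriented cycles. -/
lemma IsDynkinQuiver.exists_minimal (hC : IsSimplyLaced C) (hQ : IsDynkinQuiver C Q)
    {J : Finset I} (hJ : J.Nonempty) : ∃ j ∈ J, ∀ k ∈ J, ¬ Q k j := by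
  classical
  by_contra! h
  -- If every member of J received an arrow from J, each column of the Euler sum of the indicator of
  -- J would contribute at most 1 - 1, contradicting positive definiteness.
  set x : I → ℤ := fun i => if i ∈ J then 1 else 0
  have hx : x ≠ 0 := by
    obtain ⟨j, hj⟩ := hJ
    intro h0
    have := congrFun h0 j
    simp [x, hj] at this
  have hE : euler Q x x ≤ 0 := by
    rw [euler_eq_sum, Finset.sum_comm]
    refine Finset.sum_nonpos fun j _ => ?_
    by_cases hj : j ∈ J
    · obtain ⟨k, hk, hkj⟩ := h j hj
      have hne : k ≠ j := by
        rintro rfl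
        exact hQ.irrefl hC k hkj
      rw [← Finset.add_sum_erase _ _ (Finset.mem_univ j),
        ← Finset.add_sum_erase _ _ (Finset.mem_erase.2 ⟨hne, Finset.mem_univ k⟩)]
      have : ∑ i ∈ (Finset.univ.erase j).erase k, x i * eulerMatrix Q i j * x j ≤ 0 := by
        refine Finset.sum_nonpos fun i hi => ?_
        have hij : i ≠ j := Finset.ne_of_mem_erase (Finset.mem_of_mem_erase hi)
        simp only [x, eulerMatrix, Matrix.of_apply, hij, if_false, hj]
        split_ifs <;> simp
      have h1 : x j * eulerMatrix Q j j * x j = 1 := by simp [x, hj, eulerMatrix]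
      have h2 : x k * eulerMatrix Q k j * x j = -1 := by simp [x, hj, hk, eulerMatrix, hne, hkj]
      omega
    · simp [x, hj]
  have := euler_add_euler hC hQ x x
  have := hC.pos x hx
  omega

/-- Every Dynkin quiver has an adapted reduced expression of the longest element. -/
theorem exists_represents (hC : IsSimplyLaced C) (hQ : IsDynkinQuiver C Q) :
    ∃ w, Represents C w Q := by
  classical
  -- Lengths of good words are bounded by the number of positive roots, so a good adapted word of
  -- maximal length exists; it is shown to represent the longest element.
  set P : ℕ → Prop := fun n => ∃ w, GoodWord C w ∧ IsAdapted Q w ∧ w.length = n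
  have hb : ∀ n, P n → n ≤ hC.finite_posRoot.toFinset.card := by
    rintro n ⟨w, hw, -, rfl⟩
    exact hw.length_le hC
  have h0 : P 0 := ⟨[], trivial, trivial, rfl⟩
  obtain ⟨w, hw, ha, hlen⟩ := Nat.findGreatest_spec (P := P) (Nat.zero_le _) h0
  have hmax : ∀ n, P n → n ≤ w.length := fun n hn => by
    rw [hlen]
    exact Nat.le_findGreatest (hb n hn) hn
  have hQ' := hQ.reflectWord hC w
  have hsrc : ∀ i, IsSource (reflectWord w Q) i → ¬ PosRoot C (wordProd C w (simpleRoot i)) := by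
    intro i hi hp
    have := hmax (w.length + 1) ⟨w ++ [i], hw.append_singleton hC hp,
      (isAdapted_append _ _ _).2 ⟨ha, hi, trivial⟩, by simp⟩
    omega
  have hnorm : ∀ i, form C (wordProd C w (simpleRoot i)) (wordProd C w (simpleRoot i)) = 2 := by
    intro i
    rw [form_wordProd hC, (hC.posRoot_simpleRoot i).2]
  refine ⟨w, isLongestReduced_of_neg hC hw fun j => ?_, ha⟩
  -- Among the vertices whose simple root still has a positive image, take i with no arrow coming
  -- from another such vertex. By maximality i is not a source, so an arrow k → i exists and α_k has
  -- a negative image. Then -w α_k is listed and w α_i is not, so their Euler form should be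
  -- nonpositive; the arrow makes it 1.
  by_contra hj
  have hJ : (Finset.univ.filter fun i => PosRoot C (wordProd C w (simpleRoot i))).Nonempty :=
    ⟨j, by simpa using (hC.posRoot_or_neg (hnorm j)).resolve_right hj⟩
  obtain ⟨i, hi, hmin⟩ := hQ'.exists_minimal hC hJ
  simp only [Finset.mem_filter, Finset.mem_univ, true_and] at hi hmin
  have hns : ¬ IsSource (reflectWord w Q) i := fun h => hsrc i h hi
  simp only [IsSource, not_forall, not_not] at hns
  obtain ⟨k, hk⟩ := hns
  have hkn : PosRoot C (-wordProd C w (simpleRoot k)) :=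
    (hC.posRoot_or_neg (hnorm k)).resolve_left fun h => hmin k h hk
  have h1 : -wordProd C w (simpleRoot k) ∈ rootsOf C w := by
    rw [hw.mem_iff hC hkn, map_neg, wordProd_reverse_apply hC, neg_neg]
    exact hC.posRoot_simpleRoot k
  have h2 : wordProd C w (simpleRoot i) ∉ rootsOf C w := by
    rw [hw.not_mem_iff hC hi, wordProd_reverse_apply hC]
    exact hC.posRoot_simpleRoot i
  have h3 := euler_nonpos_of_not_mem hC hQ hw ha h1 hi h2
  rw [euler_neg_left, euler_wordProd hC hQ ha] at h3
  have hne : k ≠ i := by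
    rintro rfl
    exact hQ'.irrefl hC k hk
  have h4 : euler (reflectWord w Q) (simpleRoot k) (simpleRoot i) = -1 := by
    simp [euler, simpleRoot, eulerMatrix, hne, hk]
  omega

lemma simpleReflection_comm (hC : IsSimplyLaced C) {k l : I} (h : C k l = 0) :
    simpleReflection C k * simpleReflection C l = simpleReflection C l * simpleReflection C k := by
  have h1 := hC.form_simpleRoot k l
  have h2 := hC.form_simpleRoot l k
  rw [h] at h1
  rw [hC.symm, h] at h2
  refine LinearMap.ext fun x => ?_
  simp only [Module.End.mul_apply, simpleReflection_apply hC, form_sub_left, form_smul_left, h1, h2]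
  module

lemma reflectAt_comm (k l : I) (Q : I → I → Prop) :
    reflectAt k (reflectAt l Q) = reflectAt l (reflectAt k Q) := by
  funext a b
  unfold reflectAt
  by_cases h1 : a = k ∨ b = k <;> by_cases h2 : a = l ∨ b = l <;>
    simp [h1, h2, or_comm (a := b = k), or_comm (a := b = l)]

lemma isSource_reflectAt_iff (hC : IsSimplyLaced C) (hQ : IsDynkinQuiver C Q) {k l : I}
    (h : C k l = 0) : IsSource (reflectAt k Q) l ↔ IsSource Q l := by
  have hne : k ≠ l := by
    rintro rfl
    rw [hC.diag] at h
    omega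
  have h1 : ¬ Q k l := fun hq => by have := hQ.1 _ _ hq; omega
  have h2 : ¬ Q l k := fun hq => by have := hQ.1 _ _ hq; rw [hC.symm] at this; omega
  refine forall_congr' fun j => ?_
  by_cases hj : j = k
  · subst hj
    simp [reflectAt, h1, h2]
  · simp [reflectAt, hj, hne.symm]

lemma CommutationMove.invariants (hC : IsSimplyLaced C) {w w' : List I}
    (h : CommutationMove C w w') :
    wordProd C w = wordProd C w' ∧ w.length = w'.length ∧
      ∀ Q, IsDynkinQuiver C Q → (IsAdapted Q w ↔ IsAdapted Q w') := by
  obtain ⟨u, v, k, l, h⟩ := h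
  refine ⟨?_, by simp, fun Q hQ => ?_⟩
  · simp only [wordProd_append, wordProd_cons]
    rw [← mul_assoc (simpleReflection C k), simpleReflection_comm hC h, mul_assoc]
  · rw [isAdapted_append, isAdapted_append]
    have hQ' := hQ.reflectWord hC u
    have h' : C l k = 0 := by rw [hC.symm, h]
    simp only [IsAdapted, isSource_reflectAt_iff hC hQ' h, isSource_reflectAt_iff hC hQ' h',
      reflectAt_comm l k]
    tauto

lemma CommutationEquiv.invariants (hC : IsSimplyLaced C) {w w' : List I}
    (h : CommutationEquiv C w w') :
    wordProd C w = wordProd C w' ∧ w.length = w'.length ∧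
      ∀ Q, IsDynkinQuiver C Q → (IsAdapted Q w ↔ IsAdapted Q w') := by
  induction h with
  | rel _ _ h => exact h.invariants hC
  | refl _ => exact ⟨rfl, rfl, fun _ _ => Iff.rfl⟩
  | symm _ _ _ ih => exact ⟨ih.1.symm, ih.2.1.symm, fun Q hQ => (ih.2.2 Q hQ).symm⟩
  | trans _ _ _ _ _ ih1 ih2 =>
    exact ⟨ih1.1.trans ih2.1, ih1.2.1.trans ih2.2.1,
      fun Q hQ => (ih1.2.2 Q hQ).trans (ih2.2.2 Q hQ)⟩

lemma CommutationEquiv.isReduced (hC : IsSimplyLaced C) {w w' : List I}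
    (h : CommutationEquiv C w w') (hw : IsReduced C w) : IsReduced C w' := by
  obtain ⟨h1, h2, -⟩ := h.invariants hC
  intro v hv
  rw [← h2]
  exact hw v (hv.trans h1.symm)

lemma CommutationEquiv.represents (hC : IsSimplyLaced C) (hQ : IsDynkinQuiver C Q) {w w' : List I}
    (h : CommutationEquiv C w w') (hw : Represents C w Q) : Represents C w' Q := by
  obtain ⟨h1, h2, h3⟩ := h.invariants hC
  exact ⟨⟨h.isReduced hC hw.1.1, fun v hv => h2 ▸ hw.1.2 v hv⟩, (h3 Q hQ).1 hw.2⟩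

lemma CommutationEquiv.append {u u' : List I} (h : CommutationEquiv C u u') (a b : List I) :
    CommutationEquiv C (a ++ u ++ b) (a ++ u' ++ b) := by
  induction h with
  | rel _ _ h =>
    obtain ⟨u, v, k, l, h⟩ := h
    have := CommutationMove.swap (C := C) (a ++ u) (v ++ b) k l h
    exact .rel _ _ (by simpa using this)
  | refl _ => exact .refl _
  | symm _ _ _ ih => exact .symm _ _ ih
  | trans _ _ _ _ _ ih1 ih2 => exact .trans _ _ _ ih1 ih2

lemma commutationEquiv_append_singleton {u : List I} {i : I} (h : ∀ k ∈ u, C k i = 0) :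
    CommutationEquiv C (u ++ [i]) (i :: u) := by
  induction u with
  | nil => exact .refl _
  | cons k u ih =>
    have h1 := (ih fun l hl => h l (List.mem_cons_of_mem _ hl)).append [k] []
    have h2 := CommutationMove.swap (C := C) [] u k i (h k (by simp))
    have h3 : CommutationEquiv C (k :: u ++ [i]) (k :: i :: u) := by simpa using h1
    exact .trans _ _ _ h3 (.rel _ _ h2)

lemma wordProd_simpleRoot_of_orthogonal (hC : IsSimplyLaced C) {u : List I} {i : I}
    (h : ∀ k ∈ u, C k i = 0) : wordProd C u (simpleRoot i) = simpleRoot i := by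
  induction u with
  | nil => simp
  | cons k u ih =>
    rw [wordProd_cons, Module.End.mul_apply, ih fun l hl => h l (List.mem_cons_of_mem _ hl),
      simpleReflection_apply hC, hC.form_simpleRoot, hC.symm, h k (by simp), zero_smul, sub_zero]

lemma simpleReflection_rootsOf_of_orthogonal (hC : IsSimplyLaced C) {u : List I} {i : I}
    (h : ∀ k ∈ u, C k i = 0) : (rootsOf C u).map (simpleReflection C i) = rootsOf C u := by
  conv_rhs => rw [← List.map_id (rootsOf C u)]
  refine List.map_congr_left fun x hx => ?_
  obtain ⟨v, k, v', rfl, rfl⟩ := mem_rootsOf hx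
  have h1 : wordProd C v (simpleRoot i) = simpleRoot i :=
    wordProd_simpleRoot_of_orthogonal hC fun l hl => h l (by simp [hl])
  have h2 : form C (wordProd C v (simpleRoot k)) (simpleRoot i) = 0 := by
    rw [← h1, form_wordProd hC, hC.form_simpleRoot]
    exact h k (by simp)
  rw [simpleReflection_apply hC, h2, zero_smul, sub_zero, id]

/-- The strict order on positive roots generated by the positivity of the Euler form. -/
def Prec (C : Matrix I I ℤ) (Q : I → I → Prop) : (I → ℤ) → (I → ℤ) → Prop :=
  Relation.TransGen fun x y => PosRoot C x ∧ PosRoot C y ∧ x ≠ y ∧ 0 < euler Q y x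

/-- The roots of an adapted word can be rearranged so that an up-closed set comes last. -/
lemma exists_partition (hC : IsSimplyLaced C) (hQ : IsDynkinQuiver C Q)
    {D : (I → ℤ) → Prop}
    (hD : ∀ x y, D x → PosRoot C x → PosRoot C y → 0 < euler Q y x → D y) {w : List I}
    (hw : IsReduced C w) (ha : IsAdapted Q w) :
    ∃ u v, CommutationEquiv C w (u ++ v) ∧ (∀ x ∈ rootsOf C u, ¬ D x) ∧
      ∀ x ∈ (rootsOf C v).map (wordProd C u), D x := by
  induction w using List.reverseRecOn with
  | nil => exact ⟨[], [], .refl _, by simp [rootsOf], by simp [rootsOf]⟩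
  | append_singleton w i ih =>
    have hw' : IsReduced C w := by
      intro w' h
      have := hw (w' ++ [i]) (by simp [h])
      simpa using this
    obtain ⟨u, v, he, hu, hv⟩ := ih hw' ((isAdapted_append _ _ _).1 ha).1
    have he' : CommutationEquiv C (w ++ [i]) (u ++ v ++ [i]) := by simpa using he.append [] [i]
    -- If the root of the last letter is in D, the letter stays at the end. Otherwise it must be
    -- commuted to the left past all of v.
    by_cases hlast : D (wordProd C (u ++ v) (simpleRoot i))
    · refine ⟨u, v ++ [i], by simpa using he', hu, fun x hx => ?_⟩
      rw [rootsOf_append, List.map_append, List.mem_append] at hx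
      rcases hx with hx | hx
      · exact hv x hx
      · simp only [rootsOf, List.map_nil, List.map_cons, List.mem_singleton] at hx
        rw [hx]
        simpa using hlast
    · have hgood := (he'.isReduced hC hw).goodWord hC
      have hadap := ((he'.invariants hC).2.2 Q hQ).1 ha
      -- Scan v from the right. At the first letter l not orthogonal to i, either l = i and the last
      -- root would be negative, or l is adjacent to i and the Euler form of the last root with the
      -- root of l is 1. As the root of l is in D, the last root would then be in D too.
      have horth : ∀ v1 v2, v = v1 ++ v2 → ∀ k ∈ v2, C k i = 0 := by
        intro v1 v2
        induction v2 generalizing v1 with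
        | nil => simp
        | cons k v2 ih2 =>
          intro hv12
          have h2 := ih2 (v1 ++ [k]) (by simp [hv12])
          intro l hl
          rcases List.mem_cons.1 hl with rfl | hl
          · by_contra hli
            have hlastroot : wordProd C (u ++ v) (simpleRoot i)
                = wordProd C (u ++ v1) (simpleReflection C l (simpleRoot i)) := by
              rw [hv12, ← List.append_assoc, wordProd_append, wordProd_cons]
              simp [wordProd_simpleRoot_of_orthogonal hC h2]
            have hposlast : PosRoot C (wordProd C (u ++ v) (simpleRoot i)) := by
              refine hgood.posRoot hC ?_
              rw [rootsOf_append]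
              simp [rootsOf]
            have hmemx : wordProd C (u ++ v1) (simpleRoot l)
                ∈ (rootsOf C v).map (wordProd C u) := by
              rw [hv12, rootsOf_append]
              simp [rootsOf]
            have hposx : PosRoot C (wordProd C (u ++ v1) (simpleRoot l)) := by
              refine hgood.posRoot hC ?_
              rw [rootsOf_append, rootsOf_append]
              exact List.mem_append_left _ (List.mem_append_right _ hmemx)
            by_cases hil : l = i
            · subst hil
              rw [hlastroot, simpleReflection_simpleRoot hC, map_neg] at hposlast
              exact hposx.not_neg hposlast
            · refine hlast (hD _ _ (hv _ hmemx) hposx hposlast ?_)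
              have hadap' : IsAdapted Q (u ++ v1) ∧ IsSource (reflectWord (u ++ v1) Q) l := by
                rw [hv12, List.append_assoc, isAdapted_append] at hadap
                rw [List.append_assoc, isAdapted_append] at hadap
                rw [isAdapted_append, reflectWord_append]
                exact ⟨⟨hadap.1, hadap.2.1⟩, hadap.2.2.1⟩
              rw [hlastroot, euler_wordProd hC hQ hadap'.1,
                euler_simpleRoot_source hC (hQ.reflectWord hC _) hadap'.2,
                simpleReflection_apply hC, hC.form_simpleRoot]
              have := (hC.offDiag l i hil).resolve_left hli
              rw [hC.symm, this]
              simp [simpleRoot, hil]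
          · exact h2 l hl
      have horth := horth [] v rfl
      refine ⟨u ++ [i], v, ?_, ?_, ?_⟩
      · have h3 : CommutationEquiv C (u ++ v ++ [i]) (u ++ [i] ++ v) := by
          simpa using (commutationEquiv_append_singleton horth).append u []
        exact .trans _ _ _ he' h3
      · intro x hx
        rw [rootsOf_append, List.mem_append] at hx
        rcases hx with hx | hx
        · exact hu x hx
        · simp only [rootsOf, List.map_nil, List.map_cons, List.mem_singleton] at hx
          rw [hx]
          simpa [wordProd_simpleRoot_of_orthogonal hC horth] using hlast
      · intro x hx
        apply hv
        rw [← simpleReflection_rootsOf_of_orthogonal hC horth, List.map_map]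
        simpa using hx

end AdaptedWords

/-! ### The class order on pairs as nesting -/

section ClassOrder

variable {I : Type*} [Fintype I] [DecidableEq I] {C : Matrix I I ℤ} {Q : I → I → Prop}
  {w : List I}

/-- The position of a root in the enumeration defined by a word. -/
def pos (C : Matrix I I ℤ) (w : List I) (x : I → ℤ) : ℕ := (rootsOf C w).idxOf x

lemma pos_lt_length {x : I → ℤ} (hx : x ∈ rootsOf C w) : pos C w x < w.length := by
  rw [← length_rootsOf (C := C)]
  exact List.idxOf_lt_length_of_mem hx

lemma rootAt_pos {x : I → ℤ} (hx : x ∈ rootsOf C w) :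
    rootAt C w ⟨pos C w x, pos_lt_length hx⟩ = x := by
  rw [rootAt_eq]
  exact List.getElem_idxOf _

lemma pos_rootAt (hC : IsSimplyLaced C) (hw : IsReduced C w) (k : Fin w.length) :
    pos C w (rootAt C w k) = k := by
  rw [rootAt_eq, pos]
  exact List.Nodup.idxOf_getElem ((hw.goodWord hC).nodup hC) _ _

lemma pos_injOn {x y : I → ℤ} (hx : x ∈ rootsOf C w) (hy : y ∈ rootsOf C w)
    (h : pos C w x = pos C w y) : x = y := by
  rw [← rootAt_pos hx, ← rootAt_pos hy]
  congr 1
  exact Fin.ext h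

lemma rootAt_posRoot (hC : IsSimplyLaced C) (hw : IsReduced C w) (k : Fin w.length) :
    PosRoot C (rootAt C w k) :=
  (hw.goodWord hC).posRoot hC ((exists_rootAt_iff w _).1 ⟨k, rfl⟩)

lemma Represents.mem (hC : IsSimplyLaced C) (hw : Represents C w Q) {x : I → ℤ}
    (hx : PosRoot C x) : x ∈ rootsOf C w := hw.1.mem_rootsOf hC hx

lemma Represents.euler_sign (hC : IsSimplyLaced C) (hQ : IsDynkinQuiver C Q)
    (hw : Represents C w Q) {x y : I → ℤ} (hx : PosRoot C x) (hy : PosRoot C y)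
    (h : pos C w x < pos C w y) : euler Q x y ≤ 0 ∧ 0 ≤ euler Q y x := by
  have hp := pairwise_rootsOf hC hQ (hw.1.1.goodWord hC) hw.2
  have := List.pairwise_iff_getElem.1 hp (pos C w x) (pos C w y)
    (List.idxOf_lt_length_of_mem (hw.mem hC hx)) (List.idxOf_lt_length_of_mem (hw.mem hC hy)) h
  simpa [pos] using this

lemma Represents.pos_lt_of_euler_pos (hC : IsSimplyLaced C) (hQ : IsDynkinQuiver C Q)
    (hw : Represents C w Q) {x y : I → ℤ} (hx : PosRoot C x) (hy : PosRoot C y) (hne : x ≠ y)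
    (h : 0 < euler Q y x) : pos C w x < pos C w y := by
  rcases lt_trichotomy (pos C w x) (pos C w y) with h1 | h1 | h1
  · exact h1
  · exact absurd (pos_injOn (hw.mem hC hx) (hw.mem hC hy) h1) hne
  · have := (hw.euler_sign hC hQ hy hx h1).1
    omega

lemma Represents.pos_lt_of_euler_neg (hC : IsSimplyLaced C) (hQ : IsDynkinQuiver C Q)
    (hw : Represents C w Q) {x y : I → ℤ} (hx : PosRoot C x) (hy : PosRoot C y)
    (h : euler Q x y < 0) : pos C w x < pos C w y := by
  rcases lt_trichotomy (pos C w x) (pos C w y) with h1 | h1 | h1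
  · exact h1
  · have := pos_injOn (hw.mem hC hx) (hw.mem hC hy) h1
    subst this
    have := euler_self hC hQ hx.2
    omega
  · have := (hw.euler_sign hC hQ hy hx h1).2
    omega

lemma Prec.posRoot {x y : I → ℤ} (h : Prec C Q x y) : PosRoot C x ∧ PosRoot C y := by
  induction h with
  | single h => exact ⟨h.1, h.2.1⟩
  | tail _ h ih => exact ⟨ih.1, h.2.1⟩

lemma Represents.pos_lt_of_prec (hC : IsSimplyLaced C) (hQ : IsDynkinQuiver C Q)
    (hw : Represents C w Q) {x y : I → ℤ} (h : Prec C Q x y) : pos C w x < pos C w y := by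
  induction h with
  | single h => exact hw.pos_lt_of_euler_pos hC hQ h.1 h.2.1 h.2.2.1 h.2.2.2
  | tail _ h ih => exact ih.trans (hw.pos_lt_of_euler_pos hC hQ h.1 h.2.1 h.2.2.1 h.2.2.2)

/-- Move the up-set generated by x to the end of the word. The root y is outside it and so comes
earlier. Hence `Prec` contains every comparison shared by the whole class. -/
lemma Represents.exists_pos_lt (hC : IsSimplyLaced C) (hQ : IsDynkinQuiver C Q)
    (hw : Represents C w Q) {x y : I → ℤ} (hx : PosRoot C x) (hy : PosRoot C y) (hne : x ≠ y)
    (h : ¬ Prec C Q x y) : ∃ w', CommutationEquiv C w w' ∧ pos C w' y < pos C w' x := by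
  set D : (I → ℤ) → Prop := fun z => z = x ∨ Prec C Q x z
  obtain ⟨u, v, he, hu, hv⟩ := exists_partition hC hQ (D := D) (by
    rintro a b ha hpa hpb hE
    by_cases hab : a = b
    · exact hab ▸ ha
    · have hstep : Prec C Q a b := .single ⟨hpa, hpb, hab, hE⟩
      rcases ha with rfl | ha
      · exact .inr hstep
      · exact .inr (ha.trans hstep)) hw.1.1 hw.2
  refine ⟨u ++ v, he, ?_⟩
  have hw' := he.represents hC hQ hw
  have hmx := hw'.mem hC hx
  have hmy := hw'.mem hC hy
  have hDx : D x := .inl rfl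
  have hDy : ¬ D y := by
    rintro (rfl | h')
    · exact hne rfl
    · exact h h'
  rw [rootsOf_append, List.mem_append] at hmx hmy
  have hxu : x ∉ rootsOf C u := fun h' => hu x h' hDx
  have hyu : y ∈ rootsOf C u := hmy.resolve_right fun h' => hDy (hv y h')
  rw [pos, pos, rootsOf_append, List.idxOf_append_of_mem hyu, List.idxOf_append_of_notMem hxu]
  have := List.idxOf_lt_length_of_mem hyu
  omega

lemma biLexLT_of_between (hC : IsSimplyLaced C) (hw : IsReduced C w) {a b : I → ℤ}
    (ha : a ∈ rootsOf C w) (hb : b ∈ rootsOf C w) (hab : pos C w a < pos C w b)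
    {m : Multiset (I → ℤ)} (hm : ∀ z ∈ m, pos C w a < pos C w z ∧ pos C w z < pos C w b) :
    BiLexLT C w m {a, b} := by
  have hne : a ≠ b := by
    rintro rfl
    omega
  have hma : a ∉ m := fun h => by have := hm a h; omega
  have hmb : b ∉ m := fun h => by have := hm b h; omega
  refine ⟨⟨_, pos_lt_length ha⟩, ⟨_, pos_lt_length hb⟩, hab.le, ?_, ?_, ?_, ?_⟩
  · intro t ht
    have ht' : pos C w (rootAt C w t) < pos C w a := by
      rw [pos_rootAt hC hw]
      exact ht
    rw [Multiset.count_eq_zero_of_notMem, Multiset.count_eq_zero_of_notMem]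
    · simp only [Multiset.insert_eq_cons, Multiset.mem_cons, Multiset.mem_singleton]
      rintro (h | h) <;> rw [h] at ht' <;> omega
    · intro h
      have := hm _ h
      omega
  · rw [rootAt_pos ha, Multiset.count_eq_zero_of_notMem hma, Multiset.count_pos]
    simp
  · intro t ht
    have ht' : pos C w b < pos C w (rootAt C w t) := by
      rw [pos_rootAt hC hw]
      exact ht
    rw [Multiset.count_eq_zero_of_notMem, Multiset.count_eq_zero_of_notMem]
    · simp only [Multiset.insert_eq_cons, Multiset.mem_cons, Multiset.mem_singleton]
      rintro (h | h) <;> rw [h] at ht' <;> omega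
    · intro h
      have := hm _ h
      omega
  · rw [rootAt_pos hb, Multiset.count_eq_zero_of_notMem hmb, Multiset.count_pos]
    simp

lemma Represents.classLT_of_prec (hC : IsSimplyLaced C) (hQ : IsDynkinQuiver C Q)
    (hw : Represents C w Q) {a b : I → ℤ} (hab : Prec C Q a b)
    {m : Multiset (I → ℤ)} (hm : ∀ z ∈ m, Prec C Q a z ∧ Prec C Q z b) :
    ClassLT C w m {a, b} := by
  intro w' he
  have hw' := he.represents hC hQ hw
  refine biLexLT_of_between hC hw'.1.1 (hw'.mem hC hab.posRoot.1) (hw'.mem hC hab.posRoot.2)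
    (hw'.pos_lt_of_prec hC hQ hab) fun z hz => ?_
  exact ⟨hw'.pos_lt_of_prec hC hQ (hm z hz).1, hw'.pos_lt_of_prec hC hQ (hm z hz).2⟩

/-- Equal sums force the two pairs to be disjoint, since a common member would make them equal. All
four roots then lie between the extreme positions of difference, and those positions carry members
of {a, b}. -/
lemma between_of_biLexLT (hC : IsSimplyLaced C) (hw : IsReduced C w) {a b c d : I → ℤ}
    (ha : a ∈ rootsOf C w) (hb : b ∈ rootsOf C w) (hc : c ∈ rootsOf C w) (hd : d ∈ rootsOf C w)
    (hne : pos C w a < pos C w b) (hsum : a + b = c + d) (h : BiLexLT C w {c, d} {a, b}) :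
    pos C w a < pos C w c ∧ pos C w a < pos C w d ∧ pos C w c < pos C w b ∧
      pos C w d < pos C w b := by
  obtain ⟨k, s, hks, hk, hk', hs, hs'⟩ := h
  have hca : c ≠ a := by
    rintro rfl
    have : b = d := add_left_cancel hsum
    subst this
    omega
  have hda : d ≠ a := by
    rintro rfl
    have : b = c := by rw [add_comm c] at hsum; exact add_left_cancel hsum
    subst this
    rw [Multiset.pair_comm] at hk'
    omega
  have hcb : c ≠ b := by
    rintro rfl
    have : a = d := by rw [add_comm a] at hsum; exact add_left_cancel hsum
    exact hda this.symm
  have hdb : d ≠ b := by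
    rintro rfl
    exact hca (add_right_cancel hsum).symm
  have hka := pos_rootAt hC hw k
  have hsa := pos_rootAt hC hw s
  have hlow : ∀ x ∈ rootsOf C w,
      ({c, d} : Multiset (I → ℤ)).count x ≠ ({a, b} : Multiset (I → ℤ)).count x →
      (k : ℕ) ≤ pos C w x ∧ pos C w x ≤ s := by
    intro x hx hcount
    constructor
    · by_contra hlt
      have := hk ⟨_, pos_lt_length hx⟩ (by
        rw [Fin.lt_def]
        exact not_le.1 hlt)
      rw [rootAt_pos hx] at this
      exact hcount this
    · by_contra hlt
      have := hs ⟨_, pos_lt_length hx⟩ (by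
        rw [Fin.lt_def]
        exact not_le.1 hlt)
      rw [rootAt_pos hx] at this
      exact hcount this
  have hab : a ≠ b := by
    rintro rfl
    omega
  have hca' := hlow a ha (by simp [hca.symm, hda.symm, hab])
  have hcb' := hlow b hb (by simp [hcb.symm, hdb.symm, hab.symm])
  have hc' := hlow c hc (by
    rw [Multiset.count_eq_zero_of_notMem (s := {a, b}) (by simp [hca, hcb])]
    exact (Multiset.count_pos.2 (by simp)).ne')
  have hd' := hlow d hd (by
    rw [Multiset.count_eq_zero_of_notMem (s := {a, b}) (by simp [hda, hdb])]
    exact (Multiset.count_pos.2 (by simp)).ne')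
  have hk2 : rootAt C w k ∈ ({a, b} : Multiset (I → ℤ)) :=
    Multiset.count_pos.1 (lt_of_le_of_lt (Nat.zero_le _) hk')
  have hs2 : rootAt C w s ∈ ({a, b} : Multiset (I → ℤ)) :=
    Multiset.count_pos.1 (lt_of_le_of_lt (Nat.zero_le _) hs')
  simp only [Multiset.insert_eq_cons, Multiset.mem_cons, Multiset.mem_singleton] at hk2 hs2
  have n1 : pos C w c ≠ pos C w a := fun h => hca (pos_injOn hc ha h)
  have n2 : pos C w d ≠ pos C w a := fun h => hda (pos_injOn hd ha h)
  have n3 : pos C w c ≠ pos C w b := fun h => hcb (pos_injOn hc hb h)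
  have n4 : pos C w d ≠ pos C w b := fun h => hdb (pos_injOn hd hb h)
  rcases hk2 with h1 | h1 <;> rcases hs2 with h2 | h2 <;> rw [h1] at hka <;> rw [h2] at hsa <;>
    omega

/-- For pairs of the same weight, `ClassLT` means nesting for the order `Prec`. -/
lemma Represents.prec_of_classLT (hC : IsSimplyLaced C) (hQ : IsDynkinQuiver C Q)
    (hw : Represents C w Q) {a b c d : I → ℤ} (ha : PosRoot C a) (hb : PosRoot C b)
    (hc : PosRoot C c) (hd : PosRoot C d) (hE : euler Q a b < 0) (hsum : a + b = c + d)
    (h : ClassLT C w {c, d} {a, b}) :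
    Prec C Q a c ∧ Prec C Q a d ∧ Prec C Q c b ∧ Prec C Q d b := by
  have key : ∀ w', CommutationEquiv C w w' → pos C w' a < pos C w' c ∧
      pos C w' a < pos C w' d ∧ pos C w' c < pos C w' b ∧ pos C w' d < pos C w' b := by
    intro w' he
    have hw' := he.represents hC hQ hw
    exact between_of_biLexLT hC hw'.1.1 (hw'.mem hC ha) (hw'.mem hC hb) (hw'.mem hC hc)
      (hw'.mem hC hd) (hw'.pos_lt_of_euler_neg hC hQ ha hb hE) hsum (h w' he)
  have h0 := key w (.refl _)
  refine ⟨?_, ?_, ?_, ?_⟩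
  · by_contra hn
    obtain ⟨w', he, hlt⟩ := hw.exists_pos_lt hC hQ ha hc (by rintro rfl; omega) hn
    have := key w' he
    omega
  · by_contra hn
    obtain ⟨w', he, hlt⟩ := hw.exists_pos_lt hC hQ ha hd (by rintro rfl; omega) hn
    have := key w' he
    omega
  · by_contra hn
    obtain ⟨w', he, hlt⟩ := hw.exists_pos_lt hC hQ hc hb (by rintro rfl; omega) hn
    have := key w' he
    omega
  · by_contra hn
    obtain ⟨w', he, hlt⟩ := hw.exists_pos_lt hC hQ hd hb (by rintro rfl; omega) hn
    have := key w' he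
    omega

end ClassOrder

/-! ### Reduction of crossing configurations and the strict drop of the Euler form -/

section Transport

variable {I : Type*} [Fintype I] [DecidableEq I] {C : Matrix I I ℤ} {Q : I → I → Prop}

/-- The simple root at a source is above no other root, so a chain that does not start there never
meets it, and every step survives the reflection. -/
lemma Prec.reflectAt (hC : IsSimplyLaced C) (hQ : IsDynkinQuiver C Q) {i : I}
    (hi : IsSource Q i) {x y : I → ℤ} (h : Prec C Q x y) (hx : x ≠ simpleRoot i) :
    Prec C (reflectAt i Q) (simpleReflection C i x) (simpleReflection C i y) := by
  have step : ∀ a b, (PosRoot C a ∧ PosRoot C b ∧ a ≠ b ∧ 0 < euler Q b a) → a ≠ simpleRoot i →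
      b ≠ simpleRoot i ∧ Prec C (QRadius.reflectAt i Q) (simpleReflection C i a)
        (simpleReflection C i b) := by
    rintro a b ⟨ha, hb, hab, hE⟩ hai
    have hbi : b ≠ simpleRoot i := by
      rintro rfl
      have := euler_source_nonpos hC hQ hi ha hai
      omega
    refine ⟨hbi, .single ⟨ha.simpleReflection hC hai, hb.simpleReflection hC hbi,
      fun h => hab (simpleReflection_injective hC i h), ?_⟩⟩
    rwa [euler_reflectAt hC hQ hi]
  suffices y ≠ simpleRoot i ∧
      Prec C (QRadius.reflectAt i Q) (simpleReflection C i x) (simpleReflection C i y) from this.2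
  induction h with
  | single h => exact step _ _ h hx
  | tail _ h ih => exact ⟨(step _ _ h ih.1).1, ih.2.trans (step _ _ h ih.1).2⟩

lemma Prec.wordProd (hC : IsSimplyLaced C) (hQ : IsDynkinQuiver C Q) {u : List I}
    (ha : IsAdapted Q u) {x y : I → ℤ} (h : Prec C Q x y) (hx : x ∉ rootsOf C u) :
    Prec C (reflectWord u Q) (wordProd C u.reverse x) (wordProd C u.reverse y) := by
  induction u generalizing Q x y with
  | nil => simpa [reflectWord] using h
  | cons i u ih =>
    simp only [rootsOf, List.mem_cons, List.mem_map, not_or] at hx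
    simp only [List.reverse_cons, wordProd_append, wordProd_cons, wordProd_nil, mul_one,
      Module.End.mul_apply]
    refine ih (hQ.reflectAt hC i) ha.2 (h.reflectAt hC hQ ha.1 hx.1) fun h' => hx.2 ⟨_, h', ?_⟩
    exact simpleReflection_simpleReflection hC i x

lemma Prec.reverse (hC : IsSimplyLaced C) (hQ : IsDynkinQuiver C Q) {x y : I → ℤ}
    (h : Prec C Q x y) : Prec C (fun i j => Q j i) y x := by
  induction h with
  | single h => exact .single ⟨h.2.1, h.1, h.2.2.1.symm, by rw [euler_reverse hC hQ]; exact h.2.2.2⟩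
  | tail _ h ih =>
    exact .head ⟨h.2.1, h.1, h.2.2.1.symm, by rw [euler_reverse hC hQ]; exact h.2.2.2⟩ ih

/-- The two comparabilities `β ≺ β'` and `β + α_j ≺ β' + α_j` exclude each other when `j` is the
only source and `β`, `β'` are orthogonal roots with the same `j`-coefficient that form a root
with `α_j`. -/
def NoCrossing (C : Matrix I I ℤ) : Prop :=
  ∀ (Q : I → I → Prop) (j : I) (β β' : I → ℤ), IsDynkinQuiver C Q → IsSource Q j →
    (∀ i, IsSource Q i → i = j) → PosRoot C β → PosRoot C β' →
    form C β (simpleRoot j) = -1 → form C β' (simpleRoot j) = -1 →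
    euler Q β β' = 0 → euler Q β' β = 0 → β j = β' j →
    Prec C Q β β' → Prec C Q (β + simpleRoot j) (β' + simpleRoot j) → False

open Classical in
/-- The indicator of an arrow. -/
noncomputable def arrow (Q : I → I → Prop) (i j : I) : ℤ := if Q i j then 1 else 0

/-- `Q` arises from `Q₀` by reflecting `f i` times at each vertex `i`. -/
def IsFiring (C : Matrix I I ℤ) (Q₀ : I → I → Prop) (j : I) (f : I → ℕ) (Q : I → I → Prop) :
    Prop :=
  f j = 0 ∧ ∀ u v, C u v = -1 → (f u : ℤ) - f v = arrow Q₀ u v - arrow Q u v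

/-- The firing numbers of neighbours differ by at most one and vanish at j; the diagram is
connected. -/
lemma exists_bound_of_isFiring (hC : IsSimplyLaced C) (Q₀ : I → I → Prop) (j : I) :
    ∃ B : I → ℕ, ∀ f Q, IsFiring C Q₀ j f Q → ∀ v, f v ≤ B v := by
  suffices ∀ v, ∃ b, ∀ f Q, IsFiring C Q₀ j f Q → f v ≤ b by
    choose B hB using this
    exact ⟨B, fun f Q h v => hB v f Q h⟩
  intro v
  induction hC.conn j v with
  | refl => exact ⟨0, fun f Q h => h.1.le⟩
  | @tail u v _ h ih =>
    obtain ⟨b, hb⟩ := ih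
    refine ⟨b + 1, fun f Q hf => ?_⟩
    have h1 := hb f Q hf
    have h2 := hf.2 u v h
    unfold arrow at h2
    split_ifs at h2 <;> omega

/-- Reflections away from `j` reduce to the case in which `j` is the only source. -/
lemma NoCrossing.of_source (hN : NoCrossing C) (hC : IsSimplyLaced C) (hQ : IsDynkinQuiver C Q)
    {j : I} (hj : IsSource Q j) {β β' : I → ℤ} (hβ : PosRoot C β) (hβ' : PosRoot C β')
    (h1 : form C β (simpleRoot j) = -1) (h2 : form C β' (simpleRoot j) = -1)
    (h3 : euler Q β β' = 0) (h4 : euler Q β' β = 0) (h5 : β j = β' j)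
    (h6 : Prec C Q β β') (h7 : Prec C Q (β + simpleRoot j) (β' + simpleRoot j)) : False := by
  classical
  -- The initial quiver is kept fixed as a reference. The bound on firing numbers makes repeated
  -- reflection at sources other than j terminate.
  obtain ⟨Q₀, f, B, hfire, hB⟩ : ∃ Q₀ f, ∃ B : I → ℕ, IsFiring C Q₀ j f Q ∧
      ∀ f Q, IsFiring C Q₀ j f Q → ∀ v, f v ≤ B v := by
    obtain ⟨B, hB⟩ := exists_bound_of_isFiring hC Q j
    exact ⟨Q, fun _ => 0, B, ⟨rfl, by simp⟩, hB⟩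
  induction hn : ∑ v, (B v - f v) using Nat.strong_induction_on generalizing f Q β β' with
  | _ n ih =>
  by_cases huniq : ∀ i, IsSource Q i → i = j
  · exact hN Q j β β' hQ hj huniq hβ hβ' h1 h2 h3 h4 h5 h6 h7
  push Not at huniq
  obtain ⟨i, hi, hij⟩ := huniq
  -- Two sources are never adjacent, so r_i fixes α_j and j remains a source.
  have hCij : C i j = 0 := (hC.offDiag i j hij).resolve_right fun h => by
    by_cases h' : Q i j
    · exact hj i h'
    · have := hQ.2 i j h
      exact hi j (by tauto)
  have hsj : simpleReflection C i (simpleRoot j) = simpleRoot j := by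
    rw [simpleReflection_apply hC, hC.form_simpleRoot, hC.symm, hCij, zero_smul, sub_zero]
  have hne : ∀ x, form C x (simpleRoot j) = -1 → x ≠ simpleRoot i := by
    rintro x hx rfl
    rw [hC.form_simpleRoot] at hx
    omega
  have hne' : β + simpleRoot j ≠ simpleRoot i := by
    intro h
    have := congrFun h j
    have h0 := hβ.1 j
    simp [simpleRoot, hij.symm] at this
    omega
  have hjc : ∀ x : I → ℤ, simpleReflection C i x j = x j := by
    intro x
    simp [simpleReflection_apply hC, simpleRoot, hij.symm]
  have hfire' : IsFiring C Q₀ j (f + Pi.single i 1) (reflectAt i Q) := by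
    refine ⟨by simp [hfire.1, hij.symm], fun u v huv => ?_⟩
    have h := hfire.2 u v huv
    have huv' : u ≠ v := by
      rintro rfl
      rw [hC.diag] at huv
      omega
    have hquv := hQ.2 u v huv
    by_cases hu : u = i
    · subst hu
      have hv : ¬ Q v u := hi v
      have h0 : Q u v := by tauto
      simp only [arrow, QRadius.reflectAt, h0, if_true, true_or, hv, if_false, Pi.add_apply,
        Pi.single_eq_same, Pi.single_eq_of_ne huv'.symm] at h ⊢
      push_cast
      omega
    · by_cases hv : v = i
      · subst hv
        have hv : ¬ Q u v := hi u
        have h0 : Q v u := by tauto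
        simp only [arrow, QRadius.reflectAt, h0, if_true, or_true, hv, if_false, Pi.add_apply,
          Pi.single_eq_same, Pi.single_eq_of_ne huv'] at h ⊢
        push_cast
        omega
      · simpa [arrow, QRadius.reflectAt, hu, hv] using h
  have hlt : ∑ v, (B v - (f + Pi.single i 1 : I → ℕ) v) < n := by
    rw [← hn]
    refine Finset.sum_lt_sum (fun v _ => ?_) ⟨i, Finset.mem_univ i, ?_⟩
    · simp only [Pi.add_apply]
      omega
    · have := hB _ _ hfire' i
      simp only [Pi.add_apply, Pi.single_eq_same] at this ⊢
      omega
  refine ih _ hlt (hQ.reflectAt hC i) ?_ (hβ.simpleReflection hC (hne β h1))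
    (hβ'.simpleReflection hC (hne β' h2)) ?_ ?_ ?_ ?_ ?_ ?_ ?_ _ hfire' rfl
  · exact (isSource_reflectAt_iff hC hQ hCij).2 hj
  · rw [← hsj, form_simpleReflection hC, h1]
  · rw [← hsj, form_simpleReflection hC, h2]
  · rw [euler_reflectAt hC hQ hi, h3]
  · rw [euler_reflectAt hC hQ hi, h4]
  · rw [hjc, hjc, h5]
  · exact h6.reflectAt hC hQ hi (hne β h1)
  · have := h7.reflectAt hC hQ hi hne'
    rwa [map_add, map_add, hsj] at this

/-- Convexity is visible in the Euler form: ⟨x + y, x⟩ and ⟨y, x + y⟩ both equal 1 + ⟨y, x⟩, which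
is positive when x precedes y. -/
lemma Represents.pos_convex (hC : IsSimplyLaced C) (hQ : IsDynkinQuiver C Q) {w : List I}
    (hw : Represents C w Q) {x y : I → ℤ} (hx : PosRoot C x) (hy : PosRoot C y)
    (hxy : PosRoot C (x + y)) (h : pos C w x < pos C w y) :
    pos C w x < pos C w (x + y) ∧ pos C w (x + y) < pos C w y := by
  have hE := hw.euler_sign hC hQ hx hy h
  have h1 := euler_self hC hQ hx.2
  have h2 := euler_self hC hQ hy.2
  constructor
  · refine hw.pos_lt_of_euler_pos hC hQ hx hxy (fun h => hy.ne_zero (by simpa using h)) ?_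
    rw [euler_add_left]
    omega
  · refine hw.pos_lt_of_euler_pos hC hQ hxy hy (fun h => hx.ne_zero (by simpa using h)) ?_
    rw [euler_add_right]
    omega

lemma Represents.pos_lt_of_add_lt (hC : IsSimplyLaced C) (hQ : IsDynkinQuiver C Q) {w : List I}
    (hw : Represents C w Q) {x y : I → ℤ} (hx : PosRoot C x) (hy : PosRoot C y)
    (hxy : PosRoot C (x + y)) (h : pos C w (x + y) < pos C w y) :
    pos C w x < pos C w (x + y) := by
  rcases lt_trichotomy (pos C w x) (pos C w y) with h1 | h1 | h1
  · exact (hw.pos_convex hC hQ hx hy hxy h1).1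
  · have := pos_injOn (hw.mem hC hx) (hw.mem hC hy) h1
    subst this
    have h2 := hxy.2
    have h3 := hx.2
    simp only [form_add_left, form_add_right] at h2
    omega
  · rw [add_comm] at hxy h
    have := (hw.pos_convex hC hQ hy hx hxy h1).1
    omega

lemma Represents.lt_pos_of_lt_add (hC : IsSimplyLaced C) (hQ : IsDynkinQuiver C Q) {w : List I}
    (hw : Represents C w Q) {x y : I → ℤ} (hx : PosRoot C x) (hy : PosRoot C y)
    (hxy : PosRoot C (x + y)) (h : pos C w x < pos C w (x + y)) :
    pos C w (x + y) < pos C w y := by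
  rcases lt_trichotomy (pos C w x) (pos C w y) with h1 | h1 | h1
  · exact (hw.pos_convex hC hQ hx hy hxy h1).2
  · have := pos_injOn (hw.mem hC hx) (hw.mem hC hy) h1
    subst this
    have h2 := hxy.2
    have h3 := hx.2
    simp only [form_add_left, form_add_right] at h2
    omega
  · rw [add_comm] at hxy h
    have := (hw.pos_convex hC hQ hy hx hxy h1).2
    rw [add_comm] at h this
    omega

/-- A positive root becomes a simple root at a source after an adapted sequence of reflections
which keeps all later roots positive. -/
lemma Represents.exists_prefix (hC : IsSimplyLaced C) (hQ : IsDynkinQuiver C Q) {w : List I}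
    (hw : Represents C w Q) {δ : I → ℤ} (hδ : PosRoot C δ) :
    ∃ u j, GoodWord C u ∧ IsAdapted Q u ∧ IsSource (reflectWord u Q) j ∧
      wordProd C u.reverse δ = simpleRoot j ∧
      ∀ x, PosRoot C x → pos C w δ < pos C w x → x ∉ rootsOf C u := by
  have hg := hw.1.1.goodWord hC
  obtain ⟨u, j, v, hwuv, hδu⟩ := QRadius.mem_rootsOf (hw.mem hC hδ)
  have hred : IsReduced C u := by
    intro w' h
    have := hw.1.1 (w' ++ j :: v) (by rw [hwuv]; simp [h])
    rw [hwuv] at this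
    simpa using this
  have hu := hred.goodWord hC
  have hapt := hw.2
  rw [hwuv, isAdapted_append] at hapt
  refine ⟨u, j, hu, hapt.1, hapt.2.1, by rw [hδu, wordProd_reverse_apply hC], fun x hx hlt hxu => ?_⟩
  have hδn : δ ∉ rootsOf C u := by
    rw [hu.not_mem_iff hC hδ, hδu, wordProd_reverse_apply hC]
    exact hC.posRoot_simpleRoot j
  rw [pos, pos, hwuv, rootsOf_append, List.idxOf_append_of_mem hxu,
    List.idxOf_append_of_notMem hδn] at hlt
  have := List.idxOf_lt_length_of_mem hxu
  omega

/-- Crossing configurations in which the common difference comes first. -/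
lemma NoCrossing.of_first (hN : NoCrossing C) (hC : IsSimplyLaced C) (hQ : IsDynkinQuiver C Q)
    {β β' δ : I → ℤ} (hβ : PosRoot C β) (hβ' : PosRoot C β') (hδ : PosRoot C δ)
    (ha : PosRoot C (β' + δ)) (ha' : PosRoot C (β + δ)) (horth : form C β β' = 0)
    (hp1 : Prec C Q (β + δ) (β' + δ)) (hp2 : Prec C Q β β')
    (hp3 : Prec C Q (β' + δ) β) (hE : euler Q (β' + δ) β ≤ euler Q (β + δ) β') : False := by
  obtain ⟨w, hw⟩ := exists_represents hC hQ
  have q1 := hw.pos_lt_of_prec hC hQ hp1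
  have q2 := hw.pos_lt_of_prec hC hQ hp2
  have q3 := hw.pos_lt_of_prec hC hQ hp3
  have hδα : pos C w δ < pos C w (β + δ) := by
    rw [add_comm β δ] at *
    refine hw.pos_lt_of_add_lt hC hQ hδ hβ ha' ?_
    omega
  -- The root δ precedes all the other roots involved, so the reflections that make δ simple keep
  -- them positive and keep their `Prec` relations.
  obtain ⟨u, j, hu, hua, hj, hδj, hlater⟩ := hw.exists_prefix hC hQ hδ
  have hQ' := hQ.reflectWord hC u
  set Q' := reflectWord u Q
  set R := wordProd C u.reverse with hR
  have hEu : ∀ x y, euler Q' (R x) (R y) = euler Q x y := by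
    intro x y
    rw [← euler_wordProd hC hQ hua, hR, wordProd_apply_reverse hC, wordProd_apply_reverse hC]
  have hfu : ∀ x y, form C (R x) (R y) = form C x y := form_wordProd hC _
  have hβn := hlater β hβ (by omega)
  have hβn' := hlater β' hβ' (by omega)
  have han := hlater (β + δ) ha' (by omega)
  have hRβ := (hu.not_mem_iff hC hβ).1 hβn
  have hRβ' := (hu.not_mem_iff hC hβ').1 hβn'
  have f1 : form C β δ = -1 := by
    have h1 := ha'.2
    have h2 := hC.form_comm δ β
    have h3 := hβ.2
    have h4 := hδ.2
    simp only [form_add_left, form_add_right] at h1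
    omega
  have f2 : form C β' δ = -1 := by
    have h1 := ha.2
    have h2 := hC.form_comm δ β'
    have h3 := hβ'.2
    have h4 := hδ.2
    simp only [form_add_left, form_add_right] at h1
    omega
  have c1 : euler Q β δ = R β j := by
    rw [← hEu, hδj, euler_simpleRoot_source hC hQ' hj]
  have c2 : euler Q β' δ = R β' j := by
    rw [← hEu, hδj, euler_simpleRoot_source hC hQ' hj]
  have s1 := euler_add_euler hC hQ β δ
  have s2 := euler_add_euler hC hQ β' δ
  have s3 := euler_add_euler hC hQ β β'
  have e0 := euler_self hC hQ hδ.2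
  have e1 := (hw.euler_sign hC hQ hβ hβ' q2).2
  have e2 := (hw.euler_sign hC hQ ha' ha q1).2
  simp only [euler_add_left, euler_add_right] at hE e2
  -- Put p = ⟨β', β⟩ ≥ 0, so that ⟨β, β'⟩ = -p. Then `hE` reads 2p ≤ ⟨β, δ⟩ - ⟨β', δ⟩ and `e2` reads
  -- ⟨β, δ⟩ - ⟨β', δ⟩ ≤ p. Hence p = 0 and the two coefficients at j agree.
  have hz : euler Q β' β = 0 := by omega
  have hz' : euler Q β β' = 0 := by omega
  have hjj : R β j = R β' j := by omega
  refine hN.of_source hC hQ' hj hRβ hRβ' ?_ ?_ ?_ ?_ hjj ?_ ?_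
  · rw [← hδj, hfu, f1]
  · rw [← hδj, hfu, f2]
  · rw [← hR, hEu, hz']
  · rw [← hR, hEu, hz]
  · exact hp2.wordProd hC hQ hua hβn
  · have := hp1.wordProd hC hQ hua han
    rwa [map_add, map_add, ← hR, hδj] at this

/-- Nested pairs of the same weight have decreasing Euler form. -/
theorem NoCrossing.euler_lt (hN : NoCrossing C) (hC : IsSimplyLaced C) (hQ : IsDynkinQuiver C Q)
    {α β α' β' : I → ℤ} (hα : PosRoot C α) (hβ : PosRoot C β) (hα' : PosRoot C α')
    (hβ' : PosRoot C β') (hsum : α' + β' = α + β) (hγ : PosRoot C (α + β))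
    (h1 : Prec C Q α' α) (h2 : Prec C Q α β) (h3 : Prec C Q β β') :
    euler Q α' β' < euler Q α β := by
  by_contra! hcon
  obtain ⟨w, hw⟩ := exists_represents hC hQ
  have q1 := hw.pos_lt_of_prec hC hQ h1
  have q2 := hw.pos_lt_of_prec hC hQ h2
  have q3 := hw.pos_lt_of_prec hC hQ h3
  have nαα := hα.2
  have nββ := hβ.2
  have nαα' := hα'.2
  have nββ' := hβ'.2
  have fab : form C α β = -1 := by
    have h1 := hγ.2
    have h2 := hC.form_comm α β
    simp only [form_add_left, form_add_right] at h1
    omega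
  have fab' : form C α' β' = -1 := by
    have h1 := hγ.2
    have h2 := hC.form_comm α' β'
    rw [← hsum] at h1
    simp only [form_add_left, form_add_right] at h1
    omega
  have hβ'eq : β' = α + β - α' := by rw [← hsum, add_sub_cancel_left]
  -- The product of α + β = α' + β' with α' is 2 - 1. Both summands are at most 1, so one of them
  -- equals 1 and the corresponding difference has norm two.
  have hsplit : form C α α' + form C β α' = 1 := by
    have : form C (α' + β') α' = 1 := by
      rw [form_add_left, nαα', hC.form_comm β', fab']
      norm_num
    rwa [hsum, form_add_left] at this
  have hle1 : form C α α' ≤ 1 := hC.form_le_one nαα nαα' (by rintro rfl; omega)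
  have hle2 : form C β α' ≤ 1 := hC.form_le_one nββ nαα' (by rintro rfl; omega)
  have hcases : form C α α' = 1 ∨ form C β α' = 1 := by omega
  have hαα := hC.form_comm α α'
  have hβα := hC.form_comm β α'
  rcases hcases with hA | hB
  -- Parallel case: both members are shifted by δ. Convexity places δ after α and β', or before α'
  -- and β, and the sign law then gives a drop of at least one.
  · have hn : form C (α - α') (α - α') = 2 := by
      simp only [form_sub_left, form_sub_right]
      omega
    rcases hC.posRoot_or_neg hn with hδ | hδ
    · generalize hd : α - α' = δ at hδ
      obtain rfl : α = α' + δ := by rw [← hd]; abel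
      obtain rfl : β' = β + δ := by rw [hβ'eq]; abel
      have p1 := hw.lt_pos_of_lt_add hC hQ hα' hδ hα q1
      have p2 := hw.lt_pos_of_lt_add hC hQ hβ hδ hβ' q3
      have e1 := (hw.euler_sign hC hQ hα hδ p1).1
      have e2 := (hw.euler_sign hC hQ hβ hδ (by omega)).2
      have e3 := euler_self hC hQ hδ.2
      simp only [euler_add_left, euler_add_right] at hcon e1
      omega
    · generalize hd : -(α - α') = δ at hδ
      obtain rfl : α' = δ + α := by rw [← hd]; abel
      obtain rfl : β = δ + β' := by rw [hβ'eq]; abel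
      have p1 := hw.pos_lt_of_add_lt hC hQ hδ hα hα' q1
      have e1 := (hw.euler_sign hC hQ hδ hα (by omega)).2
      have e2 := (hw.euler_sign hC hQ hδ hβ (by omega)).1
      have e3 := euler_self hC hQ hδ.2
      simp only [euler_add_left, euler_add_right] at hcon e2
      omega
  -- Crossing case, with δ first or last. Reversing all arrows turns the second possibility into the
  -- first.
  · have hn : form C (β - α') (β - α') = 2 := by
      simp only [form_sub_left, form_sub_right]
      omega
    rcases hC.posRoot_or_neg hn with hδ | hδ
    · generalize hd : β - α' = δ at hδ
      obtain rfl : β = α' + δ := by rw [← hd]; abel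
      obtain rfl : β' = α + δ := by rw [hβ'eq]; abel
      have hz : form C α α' = 0 := by omega
      have hQ' := hQ.reverse hC
      refine hN.of_first hC hQ' hα hα' hδ hβ hβ' hz (h3.reverse hC hQ) (h1.reverse hC hQ)
        (h2.reverse hC hQ) ?_
      rw [euler_reverse hC hQ, euler_reverse hC hQ]
      exact hcon
    · generalize hd : -(β - α') = δ at hδ
      obtain rfl : α' = β + δ := by rw [← hd]; abel
      obtain rfl : α = β' + δ := by rw [hβ'eq]; abel
      have hz : form C β β' = 0 := by
        have e1 := hC.form_comm β' β
        have e2 := hC.form_comm δ β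
        have e3 := hβ'.2
        simp only [form_add_left, form_add_right] at fab hB
        omega
      exact hN.of_first hC hQ hβ hβ' hδ hα hα' hz h1 h3 h2 hcon

end Transport

/-! ### The radius from the three combinatorial properties -/

section Radius

variable {I : Type*} [Fintype I] [DecidableEq I] {C : Matrix I I ℤ} {Q : I → I → Prop}
  {w : List I}

/-- The Euler form of two roots with a root as sum is bounded by the multiplicity. -/
def EulerBound (C : Matrix I I ℤ) : Prop :=
  ∀ (Q : I → I → Prop) (α β : I → ℤ), IsDynkinQuiver C Q → PosRoot C α → PosRoot C β →
    PosRoot C (α + β) → -(mul (α + β) : ℤ) ≤ euler Q α β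

/-- Every non-simple positive root has nested decompositions as many as its multiplicity. -/
def HasNestedPairs (C : Matrix I I ℤ) : Prop :=
  ∀ (Q : I → I → Prop) (γ : I → ℤ), IsDynkinQuiver C Q → PosRoot C γ → (∀ i, γ ≠ simpleRoot i) →
    ∃ L : List ((I → ℤ) × (I → ℤ)), L ≠ [] ∧ L.length = mul γ ∧
      (∀ p ∈ L, PosRoot C p.1 ∧ PosRoot C p.2 ∧ p.1 + p.2 = γ ∧ euler Q p.1 p.2 < 0) ∧
      L.IsChain fun p q => p ≠ q ∧ 0 < euler Q p.1 q.1 ∧ 0 < euler Q q.2 p.2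

lemma form_eq_neg_one_of_add (hC : IsSimplyLaced C) {a b : I → ℤ} (ha : PosRoot C a)
    (hb : PosRoot C b) (hab : PosRoot C (a + b)) : form C a b = -1 := by
  have h1 := hab.2
  have h2 := ha.2
  have h3 := hb.2
  have h4 := hC.form_comm a b
  simp only [form_add_left, form_add_right] at h1
  omega

lemma IsPair.exists_eq (hC : IsSimplyLaced C) (hQ : IsDynkinQuiver C Q) (hw : Represents C w Q)
    {p : Multiset (I → ℤ)} (hp : IsPair C w p) (hγ : PosRoot C p.sum) :
    ∃ a b, p = {a, b} ∧ PosRoot C a ∧ PosRoot C b ∧ a + b = p.sum ∧ euler Q a b < 0 := by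
  obtain ⟨hs, -, hc⟩ := hp
  obtain ⟨a, b, rfl⟩ := Multiset.card_eq_two.1 hc
  have ha : PosRoot C a := by
    obtain ⟨k, rfl⟩ := hs a (by simp)
    exact rootAt_posRoot hC hw.1.1 k
  have hb : PosRoot C b := by
    obtain ⟨k, rfl⟩ := hs b (by simp)
    exact rootAt_posRoot hC hw.1.1 k
  have hsum : ({a, b} : Multiset (I → ℤ)).sum = a + b := by simp
  rw [hsum] at hγ ⊢
  have h1 := form_eq_neg_one_of_add hC ha hb hγ
  have h2 := euler_add_euler hC hQ a b
  rcases lt_or_ge (euler Q a b) 0 with h | h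
  · exact ⟨a, b, rfl, ha, hb, rfl, h⟩
  · exact ⟨b, a, Multiset.pair_comm _ _, hb, ha, add_comm _ _, by omega⟩

lemma prec_add (hC : IsSimplyLaced C) (hQ : IsDynkinQuiver C Q) {a b : I → ℤ}
    (ha : PosRoot C a) (hb : PosRoot C b) (hab : PosRoot C (a + b)) (hE : euler Q a b < 0) :
    Prec C Q a (a + b) ∧ Prec C Q (a + b) b := by
  have h1 := form_eq_neg_one_of_add hC ha hb hab
  have h2 := euler_add_euler hC hQ a b
  have h3 := euler_self hC hQ ha.2
  have h4 := euler_self hC hQ hb.2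
  refine ⟨.single ⟨ha, hab, fun h => hb.ne_zero (by simpa using h), ?_⟩,
    .single ⟨hab, hb, fun h => ha.ne_zero (by simpa using h), ?_⟩⟩
  · rw [euler_add_left]
    omega
  · rw [euler_add_right]
    omega

lemma Represents.isPair (hC : IsSimplyLaced C) (hw : Represents C w Q) {a b : I → ℤ}
    (ha : PosRoot C a) (hb : PosRoot C b) (hne : a ≠ b) : IsPair C w {a, b} := by
  refine ⟨fun x hx => ?_, by simp [hne], by simp⟩
  rw [exists_rootAt_iff]
  simp only [Multiset.insert_eq_cons, Multiset.mem_cons, Multiset.mem_singleton] at hx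
  rcases hx with rfl | rfl
  exacts [hw.mem hC ha, hw.mem hC hb]

lemma Represents.classLT_singleton (hC : IsSimplyLaced C) (hQ : IsDynkinQuiver C Q)
    (hw : Represents C w Q) {a b : I → ℤ} (ha : PosRoot C a) (hb : PosRoot C b)
    (hab : PosRoot C (a + b)) (hE : euler Q a b < 0) : ClassLT C w {a + b} {a, b} := by
  obtain ⟨h1, h2⟩ := prec_add hC hQ ha hb hab hE
  refine hw.classLT_of_prec hC hQ (h1.trans h2) fun z hz => ?_
  rw [Multiset.mem_singleton] at hz
  exact hz ▸ ⟨h1, h2⟩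

lemma Represents.not_isSimplePair (hC : IsSimplyLaced C) (hQ : IsDynkinQuiver C Q)
    (hw : Represents C w Q) {a b : I → ℤ} (ha : PosRoot C a) (hb : PosRoot C b)
    (hab : PosRoot C (a + b)) (hE : euler Q a b < 0) : ¬ IsSimplePair C w {a, b} := by
  rw [IsSimplePair, not_not]
  refine ⟨{a + b}, fun x hx => ?_, hw.classLT_singleton hC hQ ha hb hab hE, by simp⟩
  rw [exists_rootAt_iff]
  rw [Multiset.mem_singleton] at hx
  exact hx ▸ hw.mem hC hab

/-- The innermost pair has value at most -1, and each further pair surrounds the previous one and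
loses at least one by `NoCrossing.euler_lt`. -/
lemma NoCrossing.chain_length (hN : NoCrossing C) (hC : IsSimplyLaced C)
    (hQ : IsDynkinQuiver C Q) (hw : Represents C w Q) {γ : I → ℤ} (hγ : PosRoot C γ)
    {c : List (Multiset (I → ℤ))} (hc : ∀ q ∈ c, IsPair C w q ∧ q.sum = γ)
    (hch : c.IsChain (ClassLT C w)) {a b : I → ℤ} (hlast : c.getLast? = some {a, b})
    (ha : PosRoot C a) (hb : PosRoot C b) (hab : a + b = γ) (hE : euler Q a b < 0) :
    euler Q a b ≤ -(c.length : ℤ) := by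
  induction c using List.reverseRecOn generalizing a b with
  | nil => simp at hlast
  | append_singleton c p ih =>
    rw [List.getLast?_concat, Option.some_inj] at hlast
    subst hlast
    rw [List.isChain_append] at hch
    rcases hq : c.getLast? with _ | q
    · rw [List.getLast?_eq_none_iff] at hq
      subst hq
      simp
      omega
    · have hqc : q ∈ c := List.mem_of_getLast? hq
      have hqp := hc q (by simp [hqc])
      obtain ⟨a', b', rfl, ha', hb', hab', hE'⟩ := hqp.1.exists_eq hC hQ hw (hqp.2 ▸ hγ)
      have h1 := ih (fun r hr => hc r (by simp [hr])) hch.1 hq ha' hb'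
        (hab'.trans hqp.2) hE'
      have hlt : ClassLT C w {a', b'} {a, b} := hch.2.2 _ hq _ (by simp)
      have hs : a + b = a' + b' := by rw [hab, hab', hqp.2]
      obtain ⟨p1, p2, p3, p4⟩ := hw.prec_of_classLT hC hQ ha hb ha' hb' hE hs hlt
      have hγ' : PosRoot C (a' + b') := by rw [← hs, hab]; exact hγ
      obtain ⟨p5, p6⟩ := prec_add hC hQ ha' hb' hγ' hE'
      have := hN.euler_lt hC hQ ha' hb' ha hb hs hγ' p1 (p5.trans p6) p4
      simp only [List.length_append, List.length_cons, List.length_nil]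
      push_cast
      omega

/-- The radius is the multiplicity as soon as the three combinatorial properties hold. -/
theorem isRadius_mul (hC : IsSimplyLaced C) (hN : NoCrossing C) (hB : EulerBound C)
    (hL : HasNestedPairs C) (hQ : IsDynkinQuiver C Q) (hw : Represents C w Q) {γ : I → ℤ}
    (hγ : PosRoot C γ) (hγ' : ∀ i, γ ≠ simpleRoot i) : IsRadius C w γ (mul γ) := by
  have hbound : ∀ p c, IsPair C w p → p.sum = γ → IsDistChain C w p c → c.length ≤ mul γ := by
    rintro p c hp rfl ⟨h1, h2, h3⟩
    obtain ⟨a, b, rfl, ha, hb, hab, hE⟩ := hp.exists_eq hC hQ hw hγ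
    have hk := hN.chain_length hC hQ hw hγ (fun q hq => ⟨(h1 q hq).1, (h1 q hq).2.2⟩) h2 h3
      ha hb hab hE
    have := hB Q a b hQ ha hb (hab ▸ hγ)
    rw [hab] at this
    omega
  constructor
  · obtain ⟨L, hne, hlen, hmem, hchain⟩ := hL Q γ hQ hγ hγ'
    -- The list runs from the innermost pair outwards, so its last member realises the distance.
    set c := L.map fun p => ({p.1, p.2} : Multiset (I → ℤ)) with hc
    have hpne : ∀ p ∈ L, p.1 ≠ p.2 := by
      intro p hp h
      obtain ⟨h1, h2, h3, h4⟩ := hmem p hp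
      rw [h, euler_self hC hQ h2.2] at h4
      omega
    have hlast := List.getLast_mem hne
    obtain ⟨l1, l2, l3, l4⟩ := hmem _ hlast
    have hdist : IsDistChain C w {(L.getLast hne).1, (L.getLast hne).2} c := by
      refine ⟨fun q hq => ?_, ?_, ?_⟩
      · rw [hc, List.mem_map] at hq
        obtain ⟨p, hp, rfl⟩ := hq
        obtain ⟨h1, h2, h3, h4⟩ := hmem p hp
        refine ⟨hw.isPair hC h1 h2 (hpne p hp),
          hw.not_isSimplePair hC hQ h1 h2 (h3 ▸ hγ) h4, ?_⟩
        simp [h3, l3]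
      · rw [hc, List.isChain_map]
        refine hchain.imp_of_mem_imp ?_
        rintro p q hp hq ⟨hpq, e1, e2⟩
        obtain ⟨h1, h2, h3, h4⟩ := hmem p hp
        obtain ⟨h1', h2', h3', h4'⟩ := hmem q hq
        have n1 : q.1 ≠ p.1 := fun h => hpq (Prod.ext h.symm (by
          have := h3.trans h3'.symm
          rw [h] at this
          exact add_left_cancel this))
        have n2 : p.2 ≠ q.2 := fun h => n1 (by
          have := h3'.trans h3.symm
          rw [h] at this
          exact add_right_cancel this)
        have r1 : Prec C Q q.1 p.1 := .single ⟨h1', h1, n1, e1⟩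
        have r2 : Prec C Q p.2 q.2 := .single ⟨h2, h2', n2, e2⟩
        obtain ⟨r3, r4⟩ := prec_add hC hQ h1 h2 (h3 ▸ hγ) h4
        have r5 := r3.trans r4
        refine hw.classLT_of_prec hC hQ ((r1.trans r5).trans r2) fun z hz => ?_
        simp only [Multiset.insert_eq_cons, Multiset.mem_cons, Multiset.mem_singleton] at hz
        rcases hz with rfl | rfl
        · exact ⟨r1, r5.trans r2⟩
        · exact ⟨r1.trans r5, r2⟩
      · rw [hc, List.getLast?_map, List.getLast?_eq_some_getLast hne]
        rfl
    have hpair := hw.isPair hC l1 l2 (hpne _ hlast)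
    have hlt := hw.classLT_singleton hC hQ l1 l2 (l3 ▸ hγ) l4
    refine ⟨_, hpair, l3 ▸ hlt, by simp [l3],
      .inr ⟨hw.not_isSimplePair hC hQ l1 l2 (l3 ▸ hγ) l4, ⟨c, hdist, by simp [hc, hlen]⟩, ?_⟩⟩
    rintro k ⟨c', hc', rfl⟩
    exact hbound _ c' hpair (by simp [l3]) hc'
  · rintro k ⟨p, hp, -, hsum, hd⟩
    rcases hd with ⟨-, rfl⟩ | ⟨-, ⟨c, hc, rfl⟩, -⟩
    · exact Nat.zero_le _
    · exact hbound p c hp hsum hc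

lemma IsPositiveRoot.posRoot (hC : IsSimplyLaced C) {x : I → ℤ} (hx : IsPositiveRoot C x) :
    PosRoot C x := by
  obtain ⟨⟨v, i, rfl⟩, h⟩ := hx
  exact ⟨h, by rw [form_wordProd hC, (hC.posRoot_simpleRoot i).2]⟩

end Radius

/-! ### Bounds for the Euler form, path vectors and closed sets -/

section Tools

variable {I : Type*} [Fintype I] [DecidableEq I] {C : Matrix I I ℤ} {Q : I → I → Prop}

lemma form_eq_sum_right (x y : I → ℤ) : form C x y = ∑ i, y i * form C x (simpleRoot i) := by
  conv_lhs => rw [eq_sum_simpleRoot y]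
  simp only [form, Matrix.mulVec_sum, dotProduct_sum, Matrix.mulVec_smul, dotProduct_smul,
    smul_eq_mul]

lemma le_mul (x : I → ℤ) (i : I) : x i ≤ mul x := by
  have : (x i).toNat ≤ mul x := Finset.le_sup (f := fun i => (x i).toNat) (Finset.mem_univ i)
  omega

lemma PosRoot.exists_pos {x : I → ℤ} (hx : PosRoot C x) : ∃ i, 0 < x i := by
  by_contra! h
  exact hx.not_nonpos h

lemma PosRoot.mul_pos {x : I → ℤ} (hx : PosRoot C x) : 0 < mul x := by
  obtain ⟨i, hi⟩ := hx.exists_pos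
  have := le_mul x i
  omega

lemma mul_le {x : I → ℤ} {n : ℕ} (h : ∀ i, x i ≤ n) : mul x ≤ n :=
  Finset.sup_le fun i _ => by have := h i; omega

/-- A non-simple positive root minus a suitable simple root is a positive root. -/
lemma PosRoot.exists_sub (hC : IsSimplyLaced C) {x : I → ℤ} (hx : PosRoot C x)
    (hne : ∀ i, x ≠ simpleRoot i) : ∃ i, 0 < x i ∧ PosRoot C (x - simpleRoot i) := by
  have h : 0 < ∑ i, x i * form C x (simpleRoot i) := by
    rw [← form_eq_sum_right, hx.2]
    norm_num
  obtain ⟨i, -, hi⟩ := Finset.exists_lt_of_sum_lt (s := Finset.univ) (f := fun _ : I => (0 : ℤ))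
    (g := fun i => x i * form C x (simpleRoot i)) (by simpa using h)
  have hxi := hx.1 i
  have h1 := hC.form_le_one hx.2 (hC.posRoot_simpleRoot i).2 (hne i)
  have h2 : 0 < form C x (simpleRoot i) := by
    by_contra! h'
    have := mul_nonpos_of_nonneg_of_nonpos hxi h'
    linarith
  have h3 : form C x (simpleRoot i) = 1 := by omega
  refine ⟨i, ?_, ?_⟩
  · rw [h3] at hi
    simpa using hi
  · have := hx.simpleReflection hC (hne i)
    rwa [simpleReflection_apply hC, h3, one_smul] at this

lemma euler_nonpos_of_disjoint {x y : I → ℤ} (hx : ∀ i, 0 ≤ x i) (hy : ∀ i, 0 ≤ y i)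
    (h : ∀ i, x i = 0 ∨ y i = 0) : euler Q x y ≤ 0 := by
  rw [euler_eq_sum]
  refine Finset.sum_nonpos fun i _ => Finset.sum_nonpos fun j _ => ?_
  have ha := hx i
  have hb := hy j
  rcases eq_or_ne i j with rfl | hij
  · rcases h i with h | h <;> simp [h]
  · simp only [eulerMatrix, Matrix.of_apply, hij, if_false]
    split_ifs
    · nlinarith
    · simp

/-- Thinness makes the supports disjoint, so ⟨β, α⟩ ≤ 0, while ⟨α, β⟩ + ⟨β, α⟩ = -1. -/
lemma neg_one_le_euler_of_thin (hC : IsSimplyLaced C) (hQ : IsDynkinQuiver C Q) {α β : I → ℤ}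
    (hα : PosRoot C α) (hβ : PosRoot C β) (hab : PosRoot C (α + β))
    (hthin : ∀ i, (α + β) i ≤ 1) : -1 ≤ euler Q α β := by
  have h1 := form_eq_neg_one_of_add hC hα hβ hab
  have h2 := euler_add_euler hC hQ α β
  have h3 : euler Q β α ≤ 0 := by
    refine euler_nonpos_of_disjoint hβ.1 hα.1 fun i => ?_
    have ha := hα.1 i
    have hb := hβ.1 i
    have := hthin i
    rw [Pi.add_apply] at this
    omega
  omega

/-- The Euler form is bounded by the coefficients of positive roots. -/
lemma neg_le_euler_of_coeff_le (hC : IsSimplyLaced C) (hQ : IsDynkinQuiver C Q) {M : ℤ}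
    (hM0 : 0 ≤ M) (hM : ∀ x, PosRoot C x → ∀ i, x i ≤ M) {α β : I → ℤ}
    (hα : PosRoot C α) (hβ : PosRoot C β) (hab : PosRoot C (α + β)) : -M ≤ euler Q α β := by
  by_contra! hlt
  obtain ⟨w, hw⟩ := exists_represents hC hQ
  have hE : euler Q α β < 0 := by omega
  obtain ⟨u, j, hu, hua, hj, hδj, hlater⟩ := hw.exists_prefix hC hQ hα
  have hp := hw.pos_lt_of_prec hC hQ (prec_add hC hQ hα hβ hab hE).1
  have hR := (hu.not_mem_iff hC hab).1 (hlater _ hab hp)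
  have h1 := form_eq_neg_one_of_add hC hα hβ hab
  have h2 := euler_add_euler hC hQ α β
  have h3 := euler_self hC hQ hα.2
  -- Once α has become α_j at a source, ⟨α + β, α⟩ = 1 + ⟨β, α⟩ = -⟨α, β⟩ is the j-th coefficient of
  -- the positive root obtained from α + β.
  have h4 := euler_simpleRoot_source hC (hQ.reflectWord hC u) hj (wordProd C u.reverse (α + β))
  rw [← hδj, ← euler_wordProd hC hQ hua, wordProd_apply_reverse hC,
    wordProd_apply_reverse hC] at h4
  have h5 := hM _ hR j
  rw [← h4, euler_add_left] at h5
  omega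

lemma EulerBound.of_coeff_le_two (hC : IsSimplyLaced C)
    (hM : ∀ x, PosRoot C x → ∀ i, x i ≤ 2) : EulerBound C := by
  intro Q α β hQ hα hβ hab
  rcases le_or_gt (mul (α + β)) 1 with h | h
  · have := neg_one_le_euler_of_thin hC hQ hα hβ hab fun i => by
      have := le_mul (α + β) i
      omega
    have := hab.mul_pos
    omega
  · have := neg_le_euler_of_coeff_le hC hQ (by norm_num) hM hα hβ hab
    omega

lemma exists_nestedPairs_of_mul_eq_one (hC : IsSimplyLaced C) (hQ : IsDynkinQuiver C Q)
    {γ : I → ℤ} (hγ : PosRoot C γ) (hne : ∀ i, γ ≠ simpleRoot i) (h1 : mul γ = 1) :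
    ∃ L : List ((I → ℤ) × (I → ℤ)), L ≠ [] ∧ L.length = mul γ ∧
      (∀ p ∈ L, PosRoot C p.1 ∧ PosRoot C p.2 ∧ p.1 + p.2 = γ ∧ euler Q p.1 p.2 < 0) ∧
      L.IsChain fun p q => p ≠ q ∧ 0 < euler Q p.1 q.1 ∧ 0 < euler Q q.2 p.2 := by
  obtain ⟨i, -, hi⟩ := hγ.exists_sub hC hne
  have hs := hC.posRoot_simpleRoot i
  have hsum : simpleRoot i + (γ - simpleRoot i) = γ := by abel
  have h2 := form_eq_neg_one_of_add hC hs hi (by rwa [hsum])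
  have h3 := euler_add_euler hC hQ (simpleRoot i) (γ - simpleRoot i)
  rcases lt_or_ge (euler Q (simpleRoot i) (γ - simpleRoot i)) 0 with h | h
  · refine ⟨[(simpleRoot i, γ - simpleRoot i)], by simp, by simp [h1], ?_, by simp⟩
    rintro p hp
    rw [List.mem_singleton] at hp
    subst hp
    exact ⟨hs, hi, hsum, h⟩
  · refine ⟨[(γ - simpleRoot i, simpleRoot i)], by simp, by simp [h1], ?_, by simp⟩
    rintro p hp
    rw [List.mem_singleton] at hp
    subst hp
    exact ⟨hi, hs, sub_add_cancel _ _, by dsimp only; omega⟩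

/-- Pairing with a simple root at a vertex with exactly one incoming arrow. -/
lemma euler_simpleRoot_of_unique {u v : I} (hne : u ≠ v)
    (h : ∀ k, k ≠ v → (Q k v ↔ k = u)) (y : I → ℤ) : euler Q y (simpleRoot v) = y v - y u := by
  rw [euler, simpleRoot, Matrix.mulVec_single_one, dotProduct, sub_eq_add_neg,
    ← Finset.add_sum_erase _ _ (Finset.mem_univ v),
    ← Finset.add_sum_erase _ _ (Finset.mem_erase.2 ⟨hne, Finset.mem_univ u⟩)]
  have h1 : ∑ k ∈ (Finset.univ.erase v).erase u, y k * (eulerMatrix Q).col v k = 0 := by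
    refine Finset.sum_eq_zero fun k hk => ?_
    have hku := Finset.ne_of_mem_erase hk
    have hkv := Finset.ne_of_mem_erase (Finset.mem_of_mem_erase hk)
    simp [eulerMatrix, hkv, h k hkv, hku]
  rw [h1]
  simp [eulerMatrix, hne, (h u hne).2 rfl]

/-- Vectors supported on a directed path from the source `j`, with the end of the path. -/
inductive InjPath (Q : I → I → Prop) (j : I) : I → (I → ℤ) → Prop
  | base : InjPath Q j j (simpleRoot j)
  | step {u v : I} {x : I → ℤ} (hx : InjPath Q j u x) (hne : u ≠ v)
      (h : ∀ k, k ≠ v → (Q k v ↔ k = u)) (hv : x v = 0) : InjPath Q j v (x + simpleRoot v)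

/-- The contributions y v - y u of successive vertices telescope. This identity characterises the
dimension vector of the injective module at v. -/
lemma InjPath.euler_eq (hC : IsSimplyLaced C) (hQ : IsDynkinQuiver C Q) {j v : I}
    (hj : IsSource Q j) {x : I → ℤ} (h : InjPath Q j v x) (y : I → ℤ) : euler Q y x = y v := by
  induction h with
  | base => exact euler_simpleRoot_source hC hQ hj y
  | step _ hne h _ ih =>
    rw [euler_add_right, ih, euler_simpleRoot_of_unique hne h]
    ring

lemma InjPath.apply_self {j v : I} {x : I → ℤ} (h : InjPath Q j v x) : x v = 1 := by
  cases h with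
  | base => simp [simpleRoot]
  | step _ _ _ hv => simp [simpleRoot, hv]

lemma InjPath.form_self (hC : IsSimplyLaced C) (hQ : IsDynkinQuiver C Q) {j v : I}
    (hj : IsSource Q j) {x : I → ℤ} (h : InjPath Q j v x) : form C x x = 2 := by
  rw [← euler_add_euler hC hQ, h.euler_eq hC hQ hj, h.apply_self]
  norm_num

/-- A predecessor of an injective is injective. If y differs from the path vector, Cauchy's
inequality gives y v = 0; then the end vertex contributes at most 0 to the form, so the shorter path
already has positive form with y. -/
lemma InjPath.of_euler_pos (hC : IsSimplyLaced C) (hQ : IsDynkinQuiver C Q) {j v : I}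
    (hj : IsSource Q j) {x : I → ℤ} (h : InjPath Q j v x) {y : I → ℤ} (hy : PosRoot C y)
    (hE : 0 < euler Q x y) : ∃ v', InjPath Q j v' y ∧ y ≤ x := by
  induction h with
  | base =>
    have : y = simpleRoot j := by
      by_contra hne
      have := euler_source_nonpos hC hQ hj hy hne
      omega
    exact ⟨j, this ▸ .base, this.le⟩
  | @step u v x hx hne h hv ih =>
    have hstep : InjPath Q j v (x + simpleRoot v) := .step hx hne h hv
    by_cases hyx : y = x + simpleRoot v
    · exact ⟨v, hyx ▸ hstep, hyx.le⟩
    have h1 := hC.form_le_one hy.2 (hstep.form_self hC hQ hj) hyx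
    have h2 := euler_add_euler hC hQ y (x + simpleRoot v)
    rw [hstep.euler_eq hC hQ hj] at h2
    have hyv := hy.1 v
    have hyv0 : y v = 0 := by omega
    have h3 := euler_add_euler hC hQ y (simpleRoot v)
    rw [euler_simpleRoot_of_unique hne h] at h3
    have hquv : Q u v := (h u hne).2 rfl
    have h4 : form C y (simpleRoot v) ≤ -y u := by
      rw [hC.form_comm, form_simpleRoot_left, Matrix.mulVec, dotProduct,
        ← Finset.add_sum_erase _ _ (Finset.mem_univ v),
        ← Finset.add_sum_erase _ _ (Finset.mem_erase.2 ⟨hne, Finset.mem_univ u⟩), hyv0,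
        hC.symm v u, hQ.1 u v hquv]
      have : ∑ k ∈ (Finset.univ.erase v).erase u, C v k * y k ≤ 0 := by
        refine Finset.sum_nonpos fun k hk => ?_
        have hkv := Finset.ne_of_mem_erase (Finset.mem_of_mem_erase hk)
        have hk0 := hy.1 k
        rcases hC.offDiag v k hkv.symm with h | h <;> rw [h] <;> linarith
      linarith
    rw [euler_add_left] at hE
    obtain ⟨v', hv', hle⟩ := ih (by omega)
    refine ⟨v', hv', hle.trans fun k => ?_⟩
    have := (hC.posRoot_simpleRoot v).1 k
    simpa using this

/-- Down the chain, every root is again a path vector from j contained in x. The Euler form with y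
is then the coefficient of x at the end of y. So for path vectors the transitive closure adds
nothing. -/
lemma InjPath.euler_pos_of_prec (hC : IsSimplyLaced C) (hQ : IsDynkinQuiver C Q) {j v : I}
    (hj : IsSource Q j) {x : I → ℤ} (h : InjPath Q j v x) {y : I → ℤ} (hp : Prec C Q y x) :
    0 < euler Q x y := by
  suffices ∃ v', InjPath Q j v' y ∧ y ≤ x by
    obtain ⟨v', hv', hle⟩ := this
    rw [hv'.euler_eq hC hQ hj]
    have h1 : y v' ≤ x v' := hle v'
    rw [hv'.apply_self] at h1
    omega
  unfold Prec at hp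
  induction hp using Relation.TransGen.head_induction_on with
  | single hp => exact h.of_euler_pos hC hQ hj hp.1 hp.2.2.2
  | head hp _ ih =>
    obtain ⟨v', hv', hle⟩ := ih
    obtain ⟨v'', hv'', hle'⟩ := hv'.of_euler_pos hC hQ hj hp.1 hp.2.2.2
    exact ⟨v'', hv'', hle'.trans hle⟩

/-- A quiver with a unique source `j` is oriented away from `j`, in terms of a parent relation. -/
lemma arrow_iff_parent (hC : IsSimplyLaced C) (hQ : IsDynkinQuiver C Q) {j : I}
    (huniq : ∀ i, IsSource Q i → i = j) (P : I → I → Prop) (rank : I → ℕ)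
    (hP : ∀ v, v ≠ j → ∀ u, C u v = -1 → P u v ∨ (u ≠ j ∧ P v u ∧ rank u < rank v))
    (hPu : ∀ u u' v, P u v → P u' v → u = u') (v : I) (hv : v ≠ j) (u : I) : Q u v ↔ P u v := by
  induction hr : rank v using Nat.strong_induction_on generalizing u v with
  | _ n ih =>
  -- A neighbour of v that is not its parent is a child of smaller rank, and by induction its arrow
  -- comes from v. As v is not a source, some arrow enters it, and that can only be the arrow from
  -- the parent.
  have key : ∀ k, Q k v → P k v := by
    intro k hk
    rcases hP v hv k (hQ.1 k v hk) with h | ⟨h1, h2, h3⟩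
    · exact h
    · exact absurd ((ih _ (hr ▸ h3) k h1 v rfl).2 h2) (hQ.asymm hC hk)
  have hns : ¬ IsSource Q v := fun h => hv (huniq v h)
  simp only [IsSource, not_forall, not_not] at hns
  obtain ⟨k, hk⟩ := hns
  exact ⟨key u, fun h => hPu k u v (key k hk) h ▸ hk⟩

/-- An up-closed set of positive roots is preserved along `Prec`. -/
lemma Prec.mem_of_closed {S : (I → ℤ) → Prop} {x y : I → ℤ} (h : Prec C Q x y)
    (hS : ∀ a b, PosRoot C a → PosRoot C b → S a → 0 < euler Q b a → S b) (hx : S x) : S y := by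
  induction h with
  | single h => exact hS _ _ h.1 h.2.1 hx h.2.2.2
  | tail _ h ih => exact hS _ _ h.1 h.2.1 ih h.2.2.2

/-- A down-closed set of positive roots is preserved along `Prec`. -/
lemma Prec.mem_of_closed' {S : (I → ℤ) → Prop} {x y : I → ℤ} (h : Prec C Q x y)
    (hS : ∀ a b, PosRoot C a → PosRoot C b → S b → 0 < euler Q b a → S a) (hy : S y) : S x := by
  by_contra hx
  exact h.mem_of_closed (S := fun z => ¬ S z)
    (fun a b ha hb hna hE hb' => hna (hS a b ha hb hb' hE)) hx hy

end Tools

/-! ### Invariance under relabelling of the vertices -/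

section Relabel

variable {I J : Type*} [Fintype I] [DecidableEq I] [Fintype J] [DecidableEq J]
  {C : Matrix J J ℤ} (e : I ≃ J)

lemma form_submatrix (x y : I → ℤ) :
    form (C.submatrix e e) x y = form C (x ∘ e.symm) (y ∘ e.symm) := by
  rw [form_eq_sum, form_eq_sum, ← e.sum_comp]
  refine Finset.sum_congr rfl fun i _ => ?_
  rw [← e.sum_comp]
  simp

lemma euler_relabel (Q : I → I → Prop) (x y : I → ℤ) :
    euler Q x y = euler (fun a b => Q (e.symm a) (e.symm b)) (x ∘ e.symm) (y ∘ e.symm) := by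
  rw [euler_eq_sum, euler_eq_sum, ← e.sum_comp]
  refine Finset.sum_congr rfl fun i _ => ?_
  rw [← e.sum_comp]
  refine Finset.sum_congr rfl fun j _ => ?_
  by_cases hq : Q i j <;> simp [eulerMatrix, hq]

lemma posRoot_submatrix {x : I → ℤ} :
    PosRoot (C.submatrix e e) x ↔ PosRoot C (x ∘ e.symm) := by
  unfold PosRoot
  rw [form_submatrix, e.symm.forall_congr_left]
  simp

lemma simpleRoot_comp_symm (i : I) : simpleRoot i ∘ e.symm = simpleRoot (e i) := by
  ext k
  simp [simpleRoot, Pi.single_apply, e.symm_apply_eq]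

lemma comp_symm_injective {x y : I → ℤ} (h : x ∘ e.symm = y ∘ e.symm) : x = y :=
  e.symm.surjective.injective_comp_right h

lemma isDynkinQuiver_relabel {Q : I → I → Prop} (hQ : IsDynkinQuiver (C.submatrix e e) Q) :
    IsDynkinQuiver C fun a b => Q (e.symm a) (e.symm b) := by
  refine ⟨fun a b h => by simpa using hQ.1 _ _ h, fun a b h => hQ.2 _ _ (by simpa using h)⟩

lemma isSource_relabel {Q : I → I → Prop} {i : I} :
    IsSource (fun a b => Q (e.symm a) (e.symm b)) (e i) ↔ IsSource Q i := by
  unfold IsSource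
  rw [e.symm.forall_congr_left]
  simp

lemma Prec.relabel {Q : I → I → Prop} {x y : I → ℤ} (h : Prec (C.submatrix e e) Q x y) :
    Prec C (fun a b => Q (e.symm a) (e.symm b)) (x ∘ e.symm) (y ∘ e.symm) := by
  refine Relation.TransGen.lift (fun z : I → ℤ => z ∘ e.symm) ?_ _ _ h
  rintro a b ⟨h1, h2, h3, h4⟩
  exact ⟨(posRoot_submatrix e).1 h1, (posRoot_submatrix e).1 h2,
    fun h => h3 (comp_symm_injective e h), by rwa [← euler_relabel]⟩

lemma mul_comp_symm (x : I → ℤ) : mul (x ∘ e.symm) = mul x := by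
  unfold mul
  rw [← Finset.univ_map_equiv_to_embedding e, Finset.sup_map]
  simp [Function.comp_def]

lemma IsSimplyLaced.submatrix (h : IsSimplyLaced C) : IsSimplyLaced (C.submatrix e e) where
  symm i j := h.symm _ _
  diag i := h.diag _
  offDiag i j hij := h.offDiag _ _ (e.injective.ne hij)
  pos v hv := by
    rw [form_submatrix]
    refine h.pos _ fun h0 => hv (comp_symm_injective e ?_)
    rw [h0]
    rfl
  bdd := by
    obtain ⟨B, hB⟩ := h.bdd
    refine ⟨B, fun v hv h2 i => ?_⟩
    have := hB (v ∘ e.symm) (fun k => hv _) (by rw [← form_submatrix]; exact h2) (e i)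
    simpa using this
  conn i j := by
    have := Relation.ReflTransGen.lift (p := fun a b => C.submatrix e e a b = -1) e.symm
      (fun a b hab => by simpa [Function.onFun] using hab) _ _ (h.conn (e i) (e j))
    simpa [Function.onFun] using this

/-- `NoCrossing` at a given source. -/
def NoCrossingAt (C : Matrix J J ℤ) (j : J) : Prop :=
  ∀ (Q : J → J → Prop) (β β' : J → ℤ), IsDynkinQuiver C Q → IsSource Q j →
    (∀ i, IsSource Q i → i = j) → PosRoot C β → PosRoot C β' →
    form C β (simpleRoot j) = -1 → form C β' (simpleRoot j) = -1 →
    euler Q β β' = 0 → euler Q β' β = 0 → β j = β' j →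
    Prec C Q β β' → Prec C Q (β + simpleRoot j) (β' + simpleRoot j) → False

lemma noCrossing_iff : NoCrossing C ↔ ∀ j, NoCrossingAt C j :=
  ⟨fun h j Q β β' => h Q j β β', fun h Q j β β' => h j Q β β'⟩

lemma NoCrossingAt.submatrix {i : I} (h : NoCrossingAt C (e i)) :
    NoCrossingAt (C.submatrix e e) i := by
  intro Q β β' hQ hi hu hβ hβ' h1 h2 h3 h4 h5 h6 h7
  have hadd : ∀ x : I → ℤ, (x + simpleRoot i) ∘ e.symm = x ∘ e.symm + simpleRoot (e i) := by
    intro x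
    rw [← simpleRoot_comp_symm]
    rfl
  refine h _ (β ∘ e.symm) (β' ∘ e.symm) (isDynkinQuiver_relabel e hQ)
    ((isSource_relabel e).2 hi) (fun k hk => ?_) ((posRoot_submatrix e).1 hβ)
    ((posRoot_submatrix e).1 hβ') ?_ ?_ ?_ ?_ (by simpa using h5) (h6.relabel e) ?_
  · have := hu (e.symm k) ((isSource_relabel e).1 (by simpa using hk))
    rw [← this, e.apply_symm_apply]
  · rw [← h1, form_submatrix, simpleRoot_comp_symm]
  · rw [← h2, form_submatrix, simpleRoot_comp_symm]
  · rw [← h3, euler_relabel e]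
  · rw [← h4, euler_relabel e]
  · rw [← hadd, ← hadd]
    exact h7.relabel e

lemma NoCrossing.submatrix (h : NoCrossing C) : NoCrossing (C.submatrix e e) := by
  rw [noCrossing_iff] at *
  exact fun i => (h (e i)).submatrix e

lemma EulerBound.submatrix (h : EulerBound C) : EulerBound (C.submatrix e e) := by
  intro Q α β hQ hα hβ hab
  have := h _ (α ∘ e.symm) (β ∘ e.symm) (isDynkinQuiver_relabel e hQ)
    ((posRoot_submatrix e).1 hα) ((posRoot_submatrix e).1 hβ) ((posRoot_submatrix e).1 hab)
  rw [← euler_relabel] at this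
  rw [← mul_comp_symm e]
  exact this

lemma HasNestedPairs.submatrix (h : HasNestedPairs C) : HasNestedPairs (C.submatrix e e) := by
  intro Q γ hQ hγ hne
  have hback : ∀ x : J → ℤ, (x ∘ e) ∘ e.symm = x := fun x => by ext; simp
  obtain ⟨L, h1, h2, h3, h4⟩ := h _ (γ ∘ e.symm) (isDynkinQuiver_relabel e hQ)
    ((posRoot_submatrix e).1 hγ) (fun k hk => hne (e.symm k) (comp_symm_injective e (by
      rw [hk, simpleRoot_comp_symm, e.apply_symm_apply])))
  refine ⟨L.map fun p => (p.1 ∘ e, p.2 ∘ e), by simpa using h1, ?_, ?_, ?_⟩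
  · rw [List.length_map, h2, mul_comp_symm]
  · intro p hp
    rw [List.mem_map] at hp
    obtain ⟨q, hq, rfl⟩ := hp
    obtain ⟨g1, g2, g3, g4⟩ := h3 q hq
    refine ⟨(posRoot_submatrix e).2 (by rwa [hback]), (posRoot_submatrix e).2 (by rwa [hback]),
      comp_symm_injective e ?_, ?_⟩
    · rw [← g3]
      ext k
      simp
    · rw [euler_relabel e, hback, hback]
      exact g4
  · rw [List.isChain_map]
    refine h4.imp ?_
    rintro p q ⟨g1, g2, g3⟩
    refine ⟨fun h => g1 ?_, ?_, ?_⟩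
    · rw [Prod.ext_iff] at h ⊢
      exact ⟨e.surjective.injective_comp_right h.1, e.surjective.injective_comp_right h.2⟩
    · rw [euler_relabel e, hback, hback]
      exact g2
    · rw [euler_relabel e, hback, hback]
      exact g3

end Relabel

/-! ### Common consequences of a crossing configuration -/

section Crossing

variable {I : Type*} [Fintype I] [DecidableEq I] {C : Matrix I I ℤ} {Q : I → I → Prop}

/-- Crossing is impossible if `β' + α_j` is supported on a directed path from `j`. -/
lemma false_of_injPath (hC : IsSimplyLaced C) (hQ : IsDynkinQuiver C Q) {j v : I}
    (hj : IsSource Q j) {β β' : I → ℤ} (h1 : form C β (simpleRoot j) = -1)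
    (h4 : euler Q β' β = 0) (h5 : β j = β' j)
    (h7 : Prec C Q (β + simpleRoot j) (β' + simpleRoot j))
    (hp : InjPath Q j v (β' + simpleRoot j)) : False := by
  -- This positive number equals ⟨β', β⟩ + β'_j + (-1 - β_j) + 1 = 0.
  have := hp.euler_pos_of_prec hC hQ hj h7
  have e1 := euler_add_euler hC hQ β (simpleRoot j)
  have e2 := euler_simpleRoot_source hC hQ hj β
  have e3 := euler_simpleRoot_source hC hQ hj β'
  have e4 := euler_self hC hQ (hC.posRoot_simpleRoot j).2
  simp only [euler_add_left, euler_add_right] at this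
  omega

/-- The norm is 2 + 2 + 2 - 2 - 2. When β and β' have equal coefficients at j, this root has
coefficient 2 β_j + 1 there, which forces β_j = 0 in types A and D. -/
lemma posRoot_crossing (hC : IsSimplyLaced C) (hQ : IsDynkinQuiver C Q) {j : I} {β β' : I → ℤ}
    (hβ : PosRoot C β) (hβ' : PosRoot C β') (h1 : form C β (simpleRoot j) = -1)
    (h2 : form C β' (simpleRoot j) = -1) (h3 : euler Q β β' = 0) (h4 : euler Q β' β = 0) :
    PosRoot C (β + β' + simpleRoot j) := by
  have hj := hC.posRoot_simpleRoot j
  refine ⟨fun i => add_nonneg (add_nonneg (hβ.1 i) (hβ'.1 i)) (hj.1 i), ?_⟩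
  have e1 := euler_add_euler hC hQ β β'
  have e2 := hC.form_comm β β'
  have e3 := hC.form_comm β (simpleRoot j)
  have e4 := hC.form_comm β' (simpleRoot j)
  have e5 := hβ.2
  have e6 := hβ'.2
  have e7 := hj.2
  simp only [form_add_left, form_add_right]
  omega

end Crossing

/-! ### Orthonormal coordinates and interval vectors -/

section Coordinates

/-- An integral vector of norm two has two nonzero entries, both equal to one up to sign. -/
lemma exists_entries_of_dotProduct_eq_two {m : ℕ} {x : Fin m → ℤ} (h : x ⬝ᵥ x = 2) :
    ∃ a b, a < b ∧ (x a = 1 ∨ x a = -1) ∧ (x b = 1 ∨ x b = -1) ∧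
      ∀ k, k ≠ a → k ≠ b → x k = 0 := by
  have hle : ∀ k, x k * x k ≤ 2 := fun k => by
    rw [← h]
    exact Finset.single_le_sum (f := fun k => x k * x k) (fun i _ => mul_self_nonneg _)
      (Finset.mem_univ k)
  have hval : ∀ k, x k = 0 ∨ x k = 1 ∨ x k = -1 := by
    intro k
    have h1 := hle k
    have h2 : x k < 2 := by nlinarith
    have h3 : -2 < x k := by nlinarith
    omega
  have hsq : ∀ k, x k * x k = if x k ≠ 0 then 1 else 0 := by
    intro k
    rcases hval k with h | h | h <;> simp [h]
  have hcard : (Finset.univ.filter fun k => x k ≠ 0).card = 2 := by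
    have : (((Finset.univ.filter fun k => x k ≠ 0).card : ℕ) : ℤ) = 2 := by
      rw [← h, dotProduct, Finset.sum_congr rfl fun k _ => hsq k, Finset.card_filter]
      push_cast
      rfl
    exact_mod_cast this
  obtain ⟨a, b, hab, hS⟩ := Finset.card_eq_two.1 hcard
  have hmem : ∀ k, x k ≠ 0 ↔ k = a ∨ k = b := by
    intro k
    have := Finset.ext_iff.1 hS k
    simpa using this
  have ha := (hval a).resolve_left ((hmem a).2 (.inl rfl))
  have hb := (hval b).resolve_left ((hmem b).2 (.inr rfl))
  have h0 : ∀ k, k ≠ a → k ≠ b → x k = 0 := by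
    intro k hka hkb
    by_contra h
    rcases (hmem k).1 h with h | h
    exacts [hka h, hkb h]
  rcases lt_or_gt_of_ne hab with h | h
  · exact ⟨a, b, h, ha, hb, h0⟩
  · exact ⟨b, a, h, hb, ha, fun k hk hk' => h0 k hk' hk⟩

lemma form_eq_dotProduct {I : Type*} [Fintype I] [DecidableEq I] {C : Matrix I I ℤ} {m : ℕ}
    (X : (I → ℤ) →ₗ[ℤ] (Fin m → ℤ))
    (hX : ∀ i j, X (simpleRoot i) ⬝ᵥ X (simpleRoot j) = C i j) (x y : I → ℤ) :
    form C x y = X x ⬝ᵥ X y := by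
  have h : ∀ z, X z = ∑ i, z i • X (simpleRoot i) := by
    intro z
    conv_lhs => rw [eq_sum_simpleRoot z]
    rw [map_sum]
    exact Finset.sum_congr rfl fun i _ => map_smul _ _ _
  rw [h x, h y, form_eq_sum, sum_dotProduct]
  refine Finset.sum_congr rfl fun i _ => ?_
  rw [dotProduct_sum]
  refine Finset.sum_congr rfl fun j _ => ?_
  rw [smul_dotProduct, dotProduct_smul, hX, smul_eq_mul, smul_eq_mul]
  ring

/-- Extension of a vector by zero. -/
def extend {n : ℕ} (y : Fin n → ℤ) (k : ℕ) : ℤ := if h : k < n then y ⟨k, h⟩ else 0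

lemma extend_val {n : ℕ} (y : Fin n → ℤ) (k : Fin n) : extend y k = y k := by simp [extend]

lemma extend_of_lt {n : ℕ} (y : Fin n → ℤ) {k : ℕ} (h : k < n) : extend y k = y ⟨k, h⟩ := by
  simp [extend, h]

lemma extend_of_le {n : ℕ} (y : Fin n → ℤ) {k : ℕ} (h : n ≤ k) : extend y k = 0 := by
  simp [extend, not_lt.2 h]

lemma extend_add {n : ℕ} (x y : Fin n → ℤ) (k : ℕ) :
    extend (x + y) k = extend x k + extend y k := by
  unfold extend
  split_ifs <;> simp

lemma extend_smul {n : ℕ} (c : ℤ) (y : Fin n → ℤ) (k : ℕ) :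
    extend (c • y) k = c * extend y k := by
  unfold extend
  split_ifs <;> simp

lemma extend_simpleRoot {n : ℕ} (i : Fin n) (k : ℕ) :
    extend (simpleRoot i) k = if k = i then 1 else 0 := by
  unfold extend simpleRoot
  split_ifs with h1 h2 h2
  · subst h2
    simp
  · rw [Pi.single_eq_of_ne]
    rintro rfl
    exact h2 rfl
  · omega
  · rfl

/-- The indicator vector of the interval `[a, b)`. -/
def seg (n a b : ℕ) : Fin n → ℤ := fun k => if a ≤ k ∧ (k : ℕ) < b then 1 else 0

lemma extend_seg {n a b : ℕ} (hb : b ≤ n) (k : ℕ) :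
    extend (seg n a b) k = if a ≤ k ∧ k < b then 1 else 0 := by
  unfold extend seg
  split_ifs <;> first | rfl | omega

lemma seg_nonneg {n a b : ℕ} (k : Fin n) : 0 ≤ seg n a b k := by
  unfold seg
  split_ifs <;> norm_num

lemma seg_self {n a : ℕ} : seg n a a = 0 := by
  ext k
  simp only [seg, Pi.zero_apply]
  split_ifs <;> omega

lemma seg_succ_right {n a b : ℕ} (hab : a ≤ b) (hb : b < n) :
    seg n a (b + 1) = seg n a b + simpleRoot ⟨b, hb⟩ := by
  ext k
  simp only [seg, simpleRoot, Pi.add_apply, Pi.single_apply, Fin.ext_iff]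
  split_ifs <;> omega

lemma seg_succ_left {n a b : ℕ} (hab : a < b) (hb : b ≤ n) :
    seg n a b = seg n (a + 1) b + simpleRoot ⟨a, by omega⟩ := by
  ext k
  simp only [seg, simpleRoot, Pi.add_apply, Pi.single_apply, Fin.ext_iff]
  split_ifs <;> omega

section

variable {n : ℕ} {Q : Fin n → Fin n → Prop}

lemma euler_seg_of_ascending {y : Fin n → ℤ} {a b : ℕ} (hab : a ≤ b) (hb : b ≤ n)
    (h : ∀ v (hv : v < n), a ≤ v → v < b →
      euler Q y (simpleRoot ⟨v, hv⟩) = extend y v - extend y (v + 1)) :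
    euler Q y (seg n a b) = extend y a - extend y b := by
  induction b, hab using Nat.le_induction with
  | base => rw [seg_self]; simp [euler]
  | succ b hab ih =>
    rw [seg_succ_right hab hb, euler_add_right, ih (by omega) fun v hv h1 h2 => h v hv h1 (by omega),
      h b hb hab (by omega)]
    ring

lemma euler_seg_of_descending {y : Fin n → ℤ} {a b : ℕ} (hab : a ≤ b) (hb : b < n)
    (h : ∀ v (hv : v < n), a < v → v ≤ b →
      euler Q y (simpleRoot ⟨v, hv⟩) = extend y v - extend y (v - 1)) :
    euler Q y (seg n (a + 1) (b + 1)) = extend y b - extend y a := by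
  induction b, hab using Nat.le_induction with
  | base => rw [seg_self]; simp [euler]
  | succ b hab ih =>
    rw [seg_succ_right (by omega) hb, euler_add_right,
      ih (by omega) fun v hv h1 h2 => h v hv h1 (by omega),
      h (b + 1) hb (by omega) (by omega), Nat.add_sub_cancel]
    ring

lemma InjPath.extend_right {j : Fin n} {u : ℕ} (hu : u < n) {x : Fin n → ℤ}
    (hx : InjPath Q j ⟨u, hu⟩ x) {b : ℕ} (hub : u < b) (hb : b ≤ n)
    (h0 : ∀ v : Fin n, u < v → (v : ℕ) < b → x v = 0)
    (h : ∀ v : Fin n, u < v → (v : ℕ) < b → ∀ k, k ≠ v → (Q k v ↔ (k : ℕ) + 1 = v)) :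
    InjPath Q j ⟨b - 1, by omega⟩ (seg n (u + 1) b + x) := by
  induction b, hub using Nat.le_induction with
  | base => simpa [seg_self] using hx
  | succ b hub ih =>
    have := ih (by omega) (fun v h1 h2 => h0 v h1 (by omega)) fun v h1 h2 => h v h1 (by omega)
    rw [seg_succ_right (by omega) hb, add_right_comm]
    refine .step (v := ⟨b, hb⟩) this (by simp only [ne_eq, Fin.ext_iff]; omega) (fun k hk => ?_) ?_
    · rw [h ⟨b, hb⟩ (by simpa using hub) (by simp) k hk, Fin.ext_iff]
      simp only
      omega
    · rw [Pi.add_apply, h0 ⟨b, hb⟩ (by simpa using hub) (by simp)]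
      simp [seg]

lemma InjPath.extend_left {j : Fin n} {u : ℕ} (hu : u < n) {x : Fin n → ℤ}
    (hx : InjPath Q j ⟨u, hu⟩ x) {a : ℕ} (hau : a ≤ u)
    (h0 : ∀ v : Fin n, a ≤ v → (v : ℕ) < u → x v = 0)
    (h : ∀ v : Fin n, a ≤ v → (v : ℕ) < u → ∀ k, k ≠ v → (Q k v ↔ (k : ℕ) = v + 1)) :
    InjPath Q j ⟨a, by omega⟩ (seg n a u + x) := by
  obtain ⟨d, rfl⟩ := Nat.exists_eq_add_of_le hau
  induction d generalizing a with
  | zero => simpa [seg_self] using hx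
  | succ d ih =>
    have e : a + 1 + d = a + (d + 1) := by omega
    have := ih (a := a + 1) (by simpa only [e] using hu) (by simpa only [e] using hx) (by omega)
      (fun v h1 h2 => h0 v (by omega) (by omega)) fun v h1 h2 => h v (by omega) (by omega)
    rw [seg_succ_left (by omega) (by omega), add_right_comm]
    simp only [e] at this
    refine .step (v := ⟨a, by omega⟩) this (by simp [Fin.ext_iff]) (fun k hk => ?_) ?_
    · rw [h ⟨a, by omega⟩ (by simp) (by simp) k hk, Fin.ext_iff]
    · rw [Pi.add_apply, h0 ⟨a, by omega⟩ (by simp) (by simp)]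
      simp [seg]

end

/-- Recovers simple-root coefficients from orthonormal coordinates, which are their successive
differences: Y jumps by s at a and by t at b. -/
lemma sum_steps {Y : ℕ → ℤ} {m a b : ℕ} {s t : ℤ} (hab : a < b)
    (hstep : ∀ k ≤ m, Y k - (if k = 0 then 0 else Y (k - 1))
      = if k = a then s else if k = b then t else 0) :
    ∀ k ≤ m, Y k = (if a ≤ k then s else 0) + (if b ≤ k then t else 0) := by
  intro k
  induction k with
  | zero =>
    intro hk
    have := hstep 0 hk
    simp only [if_true] at this
    split_ifs at * <;> omega
  | succ k ih =>
    intro hk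
    have h1 := ih (by omega)
    have := hstep (k + 1) hk
    simp only [Nat.add_sub_cancel, Nat.succ_ne_zero, if_false] at this
    split_ifs at * <;> omega

end Coordinates

/-! ### Type A -/

section TypeA

variable {n : ℕ}

/-- The standard coordinates on the root lattice of type `A_n`. -/
def coordA (n : ℕ) : (Fin n → ℤ) →ₗ[ℤ] (Fin (n + 1) → ℤ) where
  toFun y k := extend y k - if (k : ℕ) = 0 then 0 else extend y (k - 1)
  map_add' x y := by
    ext k
    simp only [extend_add, Pi.add_apply]
    split_ifs <;> ring
  map_smul' c y := by
    ext k
    simp only [extend_smul, Pi.smul_apply, smul_eq_mul, RingHom.id_apply]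
    split_ifs <;> ring

lemma coordA_simpleRoot (i : Fin n) :
    coordA n (simpleRoot i) = Pi.single i.castSucc 1 - Pi.single i.succ 1 := by
  ext k
  simp only [coordA, LinearMap.coe_mk, AddHom.coe_mk, extend_simpleRoot, Pi.sub_apply,
    Pi.single_apply, Fin.ext_iff, Fin.val_castSucc, Fin.val_succ]
  split_ifs <;> omega

lemma form_A (x y : Fin n → ℤ) : form (CartanMatrix.A n) x y = coordA n x ⬝ᵥ coordA n y := by
  refine form_eq_dotProduct _ (fun i j => ?_) x y
  simp only [coordA_simpleRoot, sub_dotProduct, dotProduct_sub, single_dotProduct,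
    Pi.single_apply, Fin.ext_iff, Fin.val_castSucc, Fin.val_succ, CartanMatrix.A, Matrix.of_apply]
  split_ifs <;> omega

lemma form_A_simpleRoot (x : Fin n → ℤ) (j : Fin n) :
    form (CartanMatrix.A n) x (simpleRoot j) = 2 * extend x j
      - (if (j : ℕ) = 0 then 0 else extend x (j - 1)) - extend x (j + 1) := by
  rw [form_A, coordA_simpleRoot, dotProduct_sub, dotProduct_single_one, dotProduct_single_one]
  simp only [coordA, LinearMap.coe_mk, AddHom.coe_mk, Fin.val_castSucc, Fin.val_succ,
    Nat.succ_ne_zero, if_false, Nat.add_sub_cancel]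
  ring

lemma posRoot_A {y : Fin n → ℤ} (hy : PosRoot (CartanMatrix.A n) y) :
    ∃ a b : ℕ, a < b ∧ b ≤ n ∧ ∀ k : Fin n, y k = if a ≤ k ∧ (k : ℕ) < b then 1 else 0 := by
  have h2 := hy.2
  rw [form_A] at h2
  obtain ⟨a, b, hab, ha, hb, h0⟩ := exists_entries_of_dotProduct_eq_two h2
  have hab' : (a : ℕ) < b := hab
  have hsum := sum_steps (Y := extend y) (m := n) hab' (s := coordA n y a) (t := coordA n y b) (by
    intro k hk
    have hk' : coordA n y ⟨k, by omega⟩ = extend y k - if k = 0 then 0 else extend y (k - 1) := rfl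
    rw [← hk']
    split_ifs with h1 h2
    · exact congrArg (coordA n y) (Fin.ext h1)
    · exact congrArg (coordA n y) (Fin.ext h2)
    · exact h0 _ (fun h => h1 (congrArg Fin.val h)) fun h => h2 (congrArg Fin.val h))
  -- The coefficient one past the end is 0 by `extend`, so the two jumps cancel; positivity makes
  -- the first one +1.
  have hn := hsum n le_rfl
  have hbn := b.is_lt
  rw [extend_of_le y le_rfl, if_pos (by omega), if_pos (by omega)] at hn
  have hapos := hsum a (by omega)
  have := hy.1 ⟨a, by omega⟩
  rw [if_pos le_rfl, if_neg (by omega), extend_of_lt y (by omega)] at hapos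
  refine ⟨a, b, hab', by omega, fun k => ?_⟩
  have hk := hsum k (by omega)
  rw [extend_val] at hk
  split_ifs at * <;> omega

lemma isSimplyLaced_A (n : ℕ) : IsSimplyLaced (CartanMatrix.A n) where
  symm i j := by
    simp only [CartanMatrix.A, Matrix.of_apply, Fin.ext_iff]
    split_ifs <;> omega
  diag i := by simp [CartanMatrix.A]
  offDiag i j hij := by
    simp only [CartanMatrix.A, Matrix.of_apply, hij, if_false]
    split_ifs <;> simp
  pos v hv := by
    rw [form_A]
    refine lt_of_le_of_ne (Finset.sum_nonneg fun k _ => mul_self_nonneg _) fun h => hv ?_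
    have h0 := dotProduct_self_eq_zero.1 h.symm
    have hsum := sum_steps (Y := extend v) (m := n) (Nat.lt_succ_self 0) (s := 0) (t := 0) (by
      intro k hk
      have : coordA n v ⟨k, by omega⟩ = extend v k - if k = 0 then 0 else extend v (k - 1) := rfl
      rw [← this, h0]
      simp)
    ext k
    have := hsum k (by omega)
    rw [extend_val] at this
    simpa using this
  bdd := by
    refine ⟨1, fun v hv h2 i => ?_⟩
    obtain ⟨a, b, -, -, h⟩ := posRoot_A ⟨hv, h2⟩
    rw [h]
    split_ifs <;> norm_num
  conn := by
    have hsymm : Std.Symm fun a b : Fin n => CartanMatrix.A n a b = -1 := ⟨fun a b h => by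
      rw [← h]
      simp only [CartanMatrix.A, Matrix.of_apply, Fin.ext_iff]
      split_ifs <;> omega⟩
    have h0 : ∀ k (hk : k < n), Relation.ReflTransGen (fun a b => CartanMatrix.A n a b = -1)
        ⟨0, by omega⟩ ⟨k, hk⟩ := by
      intro k
      induction k with
      | zero => exact fun _ => .refl
      | succ k ih =>
        intro hk
        exact (ih (by omega)).tail (by simp [CartanMatrix.A])
    intro i j
    exact (Relation.ReflTransGen.stdSymm.symm _ _ (h0 i i.2)).trans (h0 j j.2)

/-- The parent relation of the path oriented away from `j`. -/
lemma arrow_iff_A {Q : Fin n → Fin n → Prop} (hQ : IsDynkinQuiver (CartanMatrix.A n) Q) {j : Fin n}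
    (huniq : ∀ i, IsSource Q i → i = j) (v : Fin n) (hv : v ≠ j) (u : Fin n) :
    Q u v ↔ ((v < j ∧ (u : ℕ) = v + 1) ∨ (j < v ∧ (u : ℕ) + 1 = v)) := by
  refine arrow_iff_parent (isSimplyLaced_A n) hQ huniq
    (fun u v => (v < j ∧ (u : ℕ) = v + 1) ∨ (j < v ∧ (u : ℕ) + 1 = v))
    (fun v => if v < j then (v : ℕ) else n - v) ?_ ?_ v hv u
  · intro v hv u huv
    simp only [CartanMatrix.A, Matrix.of_apply, Fin.ext_iff, Fin.lt_def, ne_eq] at *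
    split_ifs at * <;> omega
  · intro u u' v h h'
    simp only [Fin.ext_iff, Fin.lt_def] at *
    omega

/-- Since coefficients are at most one, β' vanishes at j and is an interval adjacent to j on one
side. With j the only source, β' + α_j is a path vector leaving j. -/
lemma noCrossing_A (n : ℕ) : NoCrossing (CartanMatrix.A n) := by
  intro Q j β β' hQ hj huniq hβ hβ' h1 h2 h3 h4 h5 h6 h7
  have hC := isSimplyLaced_A n
  have harr := arrow_iff_A hQ huniq
  obtain ⟨c, d, -, -, hγ⟩ := posRoot_A (posRoot_crossing hC hQ hβ hβ' h1 h2 h3 h4)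
  have hj0 : β' j = 0 := by
    have e1 := hγ j
    have e2 := hβ'.1 j
    have e3 : simpleRoot j j = 1 := by simp [simpleRoot]
    simp only [Pi.add_apply, e3] at e1
    split_ifs at e1 <;> omega
  obtain ⟨a, b, hab, hbn, hβeq⟩ := posRoot_A hβ'
  have hj1 := hβeq j
  rw [form_A_simpleRoot, extend_val, hj0] at h2
  have hside : a = j + 1 ∨ b = j := by
    have e1 : ∀ k (hk : k < n), extend β' k = if a ≤ k ∧ k < b then 1 else 0 := fun k hk => by
      rw [extend_of_lt _ hk, hβeq]
    have e2 : ∀ k, n ≤ k → extend β' k = 0 := fun k hk => extend_of_le _ hk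
    rw [hj0] at hj1
    have e3 : extend β' (j + 1) = if a ≤ j + 1 ∧ j + 1 < b then 1 else 0 := by
      rcases lt_or_ge ((j : ℕ) + 1) n with h | h
      · exact e1 _ h
      · rw [e2 _ h, if_neg (by omega)]
    rw [e3, e1 _ (by omega)] at h2
    split_ifs at h2 hj1 <;> omega
  have hpath : ∃ v, InjPath Q j v (β' + simpleRoot j) := by
    have hbase : InjPath Q j ⟨j, j.2⟩ (simpleRoot j) := .base
    have hz : ∀ v : Fin n, v ≠ j → simpleRoot j v = 0 := fun v hv => Pi.single_eq_of_ne hv _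
    rw [show β' = seg n a b from funext hβeq]
    rcases hside with h | h
    · subst h
      refine ⟨_, hbase.extend_right j.2 (by omega) hbn (fun v h1 _ => hz v (Fin.ne_of_gt h1))
        fun v h1 _ k _ => ?_⟩
      rw [harr v (Fin.ne_of_gt h1) k]
      simp only [Fin.lt_def]
      omega
    · subst h
      refine ⟨_, hbase.extend_left j.2 (by omega) (fun v _ h1 => hz v (Fin.ne_of_lt h1))
        fun v _ h1 k _ => ?_⟩
      rw [harr v (Fin.ne_of_lt h1) k]
      simp only [Fin.lt_def]
      omega
  obtain ⟨v, hv⟩ := hpath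
  exact false_of_injPath hC hQ hj h1 h4 h5 h7 hv

lemma coeff_A {x : Fin n → ℤ} (hx : PosRoot (CartanMatrix.A n) x) (i : Fin n) : x i ≤ 1 := by
  obtain ⟨a, b, -, -, h⟩ := posRoot_A hx
  rw [h]
  split_ifs <;> norm_num

lemma eulerBound_A (n : ℕ) : EulerBound (CartanMatrix.A n) :=
  .of_coeff_le_two (isSimplyLaced_A n) fun x hx i => (coeff_A hx i).trans (by norm_num)

lemma hasNestedPairs_A (n : ℕ) : HasNestedPairs (CartanMatrix.A n) := by
  intro Q γ hQ hγ hne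
  refine exists_nestedPairs_of_mul_eq_one (isSimplyLaced_A n) hQ hγ hne ?_
  have := hγ.mul_pos
  have : mul γ ≤ 1 := mul_le fun i => by exact_mod_cast coeff_A hγ i
  omega

end TypeA

/-! ### Type D: coordinates and shapes of the positive roots -/

section TypeD

variable {m : ℕ}

/-- The diagram is the path 0, …, m + 1 with the vertex m + 2 attached to the branch vertex m; the
spin ends are m + 1 and m + 2. -/
lemma cartanMatrix_D_apply (i j : Fin (m + 3)) : CartanMatrix.D (m + 3) i j =
    if i = j then 2
    else if ((i : ℕ) + 1 = j ∧ (j : ℕ) ≤ m + 1) ∨ ((j : ℕ) + 1 = i ∧ (i : ℕ) ≤ m + 1)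
      ∨ ((i : ℕ) = m ∧ (j : ℕ) = m + 2) ∨ ((j : ℕ) = m ∧ (i : ℕ) = m + 2) then -1
    else 0 := by
  simp only [CartanMatrix.D, Matrix.of_apply]
  have hi := i.2
  have hj := j.2
  split_ifs <;> omega

/-- The standard coordinates on the root lattice of type `D_{m+3}`. -/
def coordD (m : ℕ) : (Fin (m + 3) → ℤ) →ₗ[ℤ] (Fin (m + 3) → ℤ) where
  toFun y k :=
    if (k : ℕ) ≤ m then extend y k - if (k : ℕ) = 0 then 0 else extend y (k - 1)
    else if (k : ℕ) = m + 1 then extend y (m + 1) + extend y (m + 2) - extend y m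
    else extend y (m + 2) - extend y (m + 1)
  map_add' x y := by
    ext k
    simp only [extend_add, Pi.add_apply]
    split_ifs <;> ring
  map_smul' c y := by
    ext k
    simp only [extend_smul, Pi.smul_apply, smul_eq_mul, RingHom.id_apply]
    split_ifs <;> ring

lemma coordD_apply (y : Fin (m + 3) → ℤ) (k : Fin (m + 3)) : coordD m y k =
    if (k : ℕ) ≤ m then extend y k - if (k : ℕ) = 0 then 0 else extend y (k - 1)
    else if (k : ℕ) = m + 1 then extend y (m + 1) + extend y (m + 2) - extend y m
    else extend y (m + 2) - extend y (m + 1) := rfl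

lemma coordD_simpleRoot {i : Fin (m + 3)} (hi : (i : ℕ) < m + 2) :
    coordD m (simpleRoot i) = Pi.single i 1 - Pi.single ⟨i + 1, by omega⟩ 1 := by
  ext k
  have hk := k.2
  simp only [coordD_apply, extend_simpleRoot, Pi.sub_apply, Pi.single_apply, Fin.ext_iff]
  split_ifs <;> omega

lemma coordD_simpleRoot_last : coordD m (simpleRoot (Fin.last (m + 2)))
    = Pi.single ⟨m + 1, by omega⟩ 1 + Pi.single (Fin.last (m + 2)) 1 := by
  ext k
  have hk := k.2
  simp only [coordD_apply, extend_simpleRoot, Pi.add_apply, Pi.single_apply, Fin.ext_iff,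
    Fin.val_last]
  split_ifs <;> omega

lemma coordD_seg {a b : ℕ} (hab : a < b) (hb : b ≤ m + 2) :
    coordD m (seg (m + 3) a b) = Pi.single ⟨a, by omega⟩ 1 - Pi.single ⟨b, by omega⟩ 1 := by
  ext k
  have hk := k.2
  simp only [coordD_apply, extend_seg (show b ≤ m + 3 by omega), Pi.sub_apply,
    Pi.single_apply, Fin.ext_iff]
  split_ifs <;> omega

lemma form_D (x y : Fin (m + 3) → ℤ) :
    form (CartanMatrix.D (m + 3)) x y = coordD m x ⬝ᵥ coordD m y := by
  refine form_eq_dotProduct _ (fun i j => ?_) x y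
  have hlast : ∀ k : Fin (m + 3), (k : ℕ) < m + 2 ∨ k = Fin.last (m + 2) := fun k => by
    rw [Fin.ext_iff, Fin.val_last]
    omega
  rw [cartanMatrix_D_apply]
  rcases hlast i with hi | rfl <;> rcases hlast j with hj | rfl
  · simp only [coordD_simpleRoot hi, coordD_simpleRoot hj, sub_dotProduct, dotProduct_sub,
      single_dotProduct, Pi.single_apply, Fin.ext_iff, one_mul]
    split_ifs <;> omega
  · simp only [coordD_simpleRoot hi, coordD_simpleRoot_last, sub_dotProduct, dotProduct_add,
      single_dotProduct, Pi.single_apply, Fin.ext_iff, one_mul, Fin.val_last, and_true]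
    split_ifs <;> omega
  · simp only [coordD_simpleRoot hj, coordD_simpleRoot_last, add_dotProduct, dotProduct_sub,
      single_dotProduct, Pi.single_apply, Fin.ext_iff, one_mul, Fin.val_last, and_true]
    split_ifs <;> omega
  · simp only [coordD_simpleRoot_last, add_dotProduct, dotProduct_add,
      single_dotProduct, Pi.single_apply, Fin.ext_iff, one_mul, Fin.val_last, and_true]
    split_ifs <;> omega

lemma form_D_simpleRoot (x : Fin (m + 3) → ℤ) {j : Fin (m + 3)} (hj : (j : ℕ) ≤ m) :
    form (CartanMatrix.D (m + 3)) x (simpleRoot j) = 2 * extend x j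
      - ((if (j : ℕ) = 0 then 0 else extend x (j - 1)) + extend x (j + 1)
        + if (j : ℕ) = m then extend x (m + 2) else 0) := by
  rw [form_D, coordD_simpleRoot (by omega), dotProduct_sub, dotProduct_single_one,
    dotProduct_single_one, coordD_apply, coordD_apply, if_pos hj]
  simp only [Nat.add_sub_cancel, Nat.succ_ne_zero, if_false, Nat.add_right_cancel_iff,
    Nat.succ_le_iff]
  rcases eq_or_lt_of_le hj with h | h
  · simp only [h]
    split_ifs <;> omega
  · split_ifs <;> omega

lemma form_D_simpleRoot_last (x : Fin (m + 3) → ℤ) :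
    form (CartanMatrix.D (m + 3)) x (simpleRoot (Fin.last (m + 2)))
      = 2 * extend x (m + 2) - extend x m := by
  rw [form_D, coordD_simpleRoot_last, dotProduct_add, dotProduct_single_one,
    dotProduct_single_one, coordD_apply, coordD_apply]
  simp only [Fin.val_last]
  rw [if_neg (by simp), if_pos trivial, if_neg (by simp), if_neg (by simp)]
  ring

/-- The shapes of the positive roots of type `D_{m+3}`. -/
inductive ShapeD (m : ℕ) : (Fin (m + 3) → ℤ) → Prop
  | minus (a b : ℕ) (hab : a < b) (hb : b ≤ m + 2) : ShapeD m (seg (m + 3) a b)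
  | plus (a b : ℕ) (hab : a < b) (hb : b ≤ m + 1) :
      ShapeD m (seg (m + 3) a (m + 2) + seg (m + 3) b (m + 1) + simpleRoot (Fin.last (m + 2)))
  | last (a : ℕ) (ha : a ≤ m + 1) :
      ShapeD m (seg (m + 3) a (m + 1) + simpleRoot (Fin.last (m + 2)))

lemma extend_injective {n : ℕ} {x y : Fin n → ℤ} (h : ∀ k, k < n → extend x k = extend y k) :
    x = y := by
  ext k
  rw [← extend_val x k, ← extend_val y k, h k k.2]

lemma extend_plus {a b : ℕ} (k : ℕ) : extend (seg (m + 3) a (m + 2) + seg (m + 3) b (m + 1)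
      + simpleRoot (Fin.last (m + 2))) k = (if a ≤ k ∧ k < m + 2 then 1 else 0)
      + (if b ≤ k ∧ k < m + 1 then 1 else 0) + if k = m + 2 then 1 else 0 := by
  rw [extend_add, extend_add, extend_seg (by omega), extend_seg (by omega), extend_simpleRoot,
    Fin.val_last]

lemma extend_last {a : ℕ} (k : ℕ) : extend (seg (m + 3) a (m + 1)
      + simpleRoot (Fin.last (m + 2))) k = (if a ≤ k ∧ k < m + 1 then 1 else 0)
      + if k = m + 2 then 1 else 0 := by
  rw [extend_add, extend_seg (by omega), extend_simpleRoot, Fin.val_last]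

/-- The coordinates are ±1 at two places a < b, and positivity makes the first sign +. A negative
second sign gives the shape `minus`; a positive one gives `plus`, or `last` when b is the final
coordinate. -/
lemma shapeD {y : Fin (m + 3) → ℤ} (hy : PosRoot (CartanMatrix.D (m + 3)) y) : ShapeD m y := by
  have h2 := hy.2
  rw [form_D] at h2
  obtain ⟨a, b, hab, ha, hb, h0⟩ := exists_entries_of_dotProduct_eq_two h2
  have hab' : (a : ℕ) < b := hab
  have hbm := b.2
  have hX : ∀ k (hk : k < m + 3), coordD m y ⟨k, hk⟩
      = if k = a then coordD m y a else if k = b then coordD m y b else 0 := by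
    intro k hk
    split_ifs with h1 h2
    · exact congrArg (coordD m y) (Fin.ext h1)
    · exact congrArg (coordD m y) (Fin.ext h2)
    · exact h0 _ (fun h => h1 (congrArg Fin.val h)) fun h => h2 (congrArg Fin.val h)
  have hsum := sum_steps (Y := extend y) (m := m) hab' (s := coordD m y a) (t := coordD m y b) (by
    intro k hk
    rw [← hX k (by omega), coordD_apply, if_pos hk])
  have h1 := hX (m + 1) (by omega)
  have h2 := hX (m + 2) (by omega)
  rw [coordD_apply, if_neg (by simp), if_pos rfl] at h1
  rw [coordD_apply, if_neg (by simp), if_neg (by simp)] at h2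
  have hm := hsum m le_rfl
  have hpos : ∀ k, 0 ≤ extend y k := by
    intro k
    unfold extend
    split_ifs
    exacts [hy.1 _, le_rfl]
  have hp1 := hpos (m + 1)
  have hp2 := hpos (m + 2)
  have hpa := hpos a
  have hsa := hsum a
  generalize coordD m y a = s at *
  generalize coordD m y b = t at *
  have hs : s = 1 := by
    rcases le_or_gt (a : ℕ) m with h | h
    · have := hsa h
      split_ifs at this <;> omega
    · split_ifs at h1 h2 hm <;> omega
  have key : ∀ z, (∀ k ≤ m, extend z k = extend y k) → extend z (m + 1) = extend y (m + 1) →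
      extend z (m + 2) = extend y (m + 2) → z = y := by
    intro z g1 g2 g3
    refine extend_injective fun k hk => ?_
    rcases le_or_gt k m with h | h
    · exact g1 k h
    · obtain rfl | rfl : k = m + 1 ∨ k = m + 2 := by omega
      exacts [g2, g3]
  rcases hb with hb | hb
  · have v2 : extend y (m + 2) = 1 := by
      split_ifs at h1 h2 hm <;> omega
    have v1 : extend y (m + 1) = if (b : ℕ) ≤ m + 1 then 1 else 0 := by
      split_ifs at h1 h2 hm ⊢ <;> omega
    clear h1 h2 hm
    rcases Nat.lt_or_ge b (m + 2) with hb2 | hb2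
    · rw [if_pos (by omega)] at v1
      rw [← key _ ?_ ?_ ?_]
      · exact .plus a b hab' (by omega)
      · intro k hk
        rw [hsum k hk, extend_plus]
        split_ifs <;> omega
      all_goals
        rw [extend_plus]
        split_ifs <;> omega
    · rw [if_neg (by omega)] at v1
      rw [← key _ ?_ ?_ ?_]
      · exact .last a (by omega)
      · intro k hk
        rw [hsum k hk, extend_last]
        split_ifs <;> omega
      all_goals
        rw [extend_last]
        split_ifs <;> omega
  · have v2 : extend y (m + 2) = 0 := by
      split_ifs at h1 h2 hm <;> omega
    have v1 : extend y (m + 1) = if (b : ℕ) ≤ m + 1 then 0 else 1 := by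
      split_ifs at h1 h2 hm ⊢ <;> omega
    clear h1 h2 hm
    rw [← key _ ?_ ?_ ?_]
    · exact .minus a b hab' (by omega)
    · intro k hk
      rw [hsum k hk, extend_seg (by omega)]
      split_ifs <;> omega
    · rw [extend_seg (by omega)]
      split_ifs at v1 ⊢ <;> omega
    · rw [extend_seg (by omega)]
      split_ifs at v1 ⊢ <;> omega

lemma coeff_D {x : Fin (m + 3) → ℤ} (hx : PosRoot (CartanMatrix.D (m + 3)) x) (i : Fin (m + 3)) :
    x i ≤ 2 := by
  rw [← extend_val x i]
  cases shapeD hx with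
  | minus a b hab hb =>
    rw [extend_seg (by omega)]
    split_ifs <;> omega
  | plus a b hab hb =>
    rw [extend_plus]
    split_ifs <;> omega
  | last a ha =>
    rw [extend_last]
    split_ifs <;> omega

lemma isSimplyLaced_D (m : ℕ) : IsSimplyLaced (CartanMatrix.D (m + 3)) where
  symm i j := by
    simp only [cartanMatrix_D_apply, Fin.ext_iff]
    split_ifs <;> omega
  diag i := by rw [cartanMatrix_D_apply, if_pos rfl]
  offDiag i j hij := by
    simp only [cartanMatrix_D_apply, hij, if_false]
    split_ifs <;> simp
  pos v hv := by
    rw [form_D]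
    refine lt_of_le_of_ne (Finset.sum_nonneg fun k _ => mul_self_nonneg _) fun h => hv ?_
    have h0 := fun k => congrFun (dotProduct_self_eq_zero.1 h.symm) k
    simp only [coordD_apply, Pi.zero_apply] at h0
    have hsum := sum_steps (Y := extend v) (m := m) (Nat.lt_succ_self 0) (s := 0) (t := 0) (by
      intro k hk
      have := h0 ⟨k, by omega⟩
      rw [if_pos hk] at this
      rw [this]
      simp)
    have h1 := h0 ⟨m + 1, by omega⟩
    have h2 := h0 ⟨m + 2, by omega⟩
    rw [if_neg (by simp), if_pos rfl] at h1
    rw [if_neg (by simp), if_neg (by simp)] at h2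
    have hm := hsum m le_rfl
    refine extend_injective fun k hk => ?_
    have hz : extend (0 : Fin (m + 3) → ℤ) k = 0 := by simp [extend]
    rw [hz]
    rcases le_or_gt k m with h | h
    · have := hsum k h
      simpa using this
    · obtain rfl | rfl : k = m + 1 ∨ k = m + 2 := by omega
      all_goals
        simp only [ite_self, add_zero] at hm
        omega
  bdd := ⟨2, fun v hv h2 i => coeff_D ⟨hv, h2⟩ i⟩
  conn := by
    have hsymm : Std.Symm fun a b : Fin (m + 3) => CartanMatrix.D (m + 3) a b = -1 :=
      ⟨fun a b h => by
        rw [← h]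
        simp only [cartanMatrix_D_apply, Fin.ext_iff]
        split_ifs <;> omega⟩
    have h0 : ∀ k (hk : k ≤ m + 1),
        Relation.ReflTransGen (fun a b => CartanMatrix.D (m + 3) a b = -1)
          ⟨0, by omega⟩ ⟨k, by omega⟩ := by
      intro k
      induction k with
      | zero => exact fun _ => .refl
      | succ k ih =>
        intro hk
        refine (ih (by omega)).tail ?_
        rw [cartanMatrix_D_apply, if_neg (by simp), if_pos (by simp; omega)]
    have h1 : ∀ k : Fin (m + 3),
        Relation.ReflTransGen (fun a b => CartanMatrix.D (m + 3) a b = -1) ⟨0, by omega⟩ k := by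
      intro k
      rcases Nat.lt_or_ge k (m + 2) with h | h
      · exact h0 k (by omega)
      · refine (h0 m (by omega)).tail ?_
        have := k.2
        rw [cartanMatrix_D_apply, if_neg (by simp only [Fin.ext_iff]; omega),
          if_pos (by simp; omega)]
    intro i j
    exact (Relation.ReflTransGen.stdSymm.symm _ _ (h1 i)).trans (h1 j)

lemma eulerBound_D (m : ℕ) : EulerBound (CartanMatrix.D (m + 3)) :=
  .of_coeff_le_two (isSimplyLaced_D m) fun x hx i => coeff_D hx i

end TypeD

/-! ### Type D: unique source on the arm or at the branch vertex -/

section TypeD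

variable {m : ℕ}

/-- The coefficients at the neighbours of j add up to one, so the support lies in one component of
the complement of j and begins next to j. -/
lemma shapeD_arm {y : Fin (m + 3) → ℤ} (hy : PosRoot (CartanMatrix.D (m + 3)) y)
    {j : Fin (m + 3)} (hj : (j : ℕ) ≤ m) (h0 : extend y j = 0)
    (h1 : form (CartanMatrix.D (m + 3)) y (simpleRoot j) = -1) :
    (∃ a, a < (j : ℕ) ∧ y = seg (m + 3) a j) ∨
    (∃ b, (j : ℕ) + 1 < b ∧ b ≤ m + 2 ∧ y = seg (m + 3) (j + 1) b) ∨
    (y = seg (m + 3) (j + 1) (m + 1) + simpleRoot (Fin.last (m + 2))) ∨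
    (∃ b, (j : ℕ) + 1 < b ∧ b ≤ m + 1 ∧ y = seg (m + 3) (j + 1) (m + 2) + seg (m + 3) b (m + 1)
      + simpleRoot (Fin.last (m + 2))) := by
  rw [form_D_simpleRoot y hj, h0] at h1
  cases shapeD hy with
  | minus a b hab hb =>
    rw [extend_seg (by omega)] at h0
    rw [extend_seg (by omega), extend_seg (by omega), extend_seg (by omega)] at h1
    have : b = j ∨ a = j + 1 := by
      split_ifs at h0 h1 <;> omega
    rcases this with rfl | rfl
    · exact .inl ⟨a, hab, rfl⟩
    · exact .inr (.inl ⟨b, hab, hb, rfl⟩)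
  | plus a b hab hb =>
    have ha : (j : ℕ) < a := by
      rw [extend_plus] at h0
      split_ifs at h0 <;> omega
    obtain rfl | ha' : a = j + 1 ∨ (j : ℕ) + 1 < a := by omega
    · exact .inr (.inr (.inr ⟨b, hab, hb, rfl⟩))
    · have t1 : extend (seg (m + 3) a (m + 2) + seg (m + 3) b (m + 1)
          + simpleRoot (Fin.last (m + 2))) (j - 1) = 0 := by
        rw [extend_plus]
        split_ifs <;> omega
      have t2 : extend (seg (m + 3) a (m + 2) + seg (m + 3) b (m + 1)
          + simpleRoot (Fin.last (m + 2))) (j + 1) = 0 := by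
        rw [extend_plus]
        split_ifs <;> omega
      rw [t1, t2, if_neg (show (j : ℕ) ≠ m by omega)] at h1
      simp at h1
  | last a ha =>
    have ha : (j : ℕ) < a := by
      rw [extend_last] at h0
      split_ifs at h0 <;> omega
    obtain rfl | ha' : a = j + 1 ∨ (j : ℕ) + 1 < a := by omega
    · exact .inr (.inr (.inl rfl))
    · have t1 : extend (seg (m + 3) a (m + 1) + simpleRoot (Fin.last (m + 2))) (j - 1) = 0 := by
        rw [extend_last]
        split_ifs <;> omega
      have t2 : extend (seg (m + 3) a (m + 1) + simpleRoot (Fin.last (m + 2))) (j + 1) = 0 := by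
        rw [extend_last]
        split_ifs <;> omega
      rw [t1, t2, if_neg (show (j : ℕ) ≠ m by omega)] at h1
      simp at h1

lemma eq_zero_of_crossing_D {j : Fin (m + 3)} {β β' : Fin (m + 3) → ℤ}
    (hβ' : PosRoot (CartanMatrix.D (m + 3)) β')
    (hγ : PosRoot (CartanMatrix.D (m + 3)) (β + β' + simpleRoot j)) (h5 : β j = β' j) :
    β j = 0 ∧ β' j = 0 := by
  have e1 := coeff_D hγ j
  have e2 := hβ'.1 j
  have e3 : simpleRoot j j = 1 := by simp [simpleRoot]
  simp only [Pi.add_apply, e3] at e1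
  omega

lemma euler_simpleRoot_extend {n : ℕ} {Q : Fin n → Fin n → Prop} {u v : ℕ} (hu : u < n) (hv : v < n)
    (hne : u ≠ v) (h : ∀ k, k ≠ ⟨v, hv⟩ → (Q k ⟨v, hv⟩ ↔ (k : ℕ) = u)) (y : Fin n → ℤ) :
    euler Q y (simpleRoot ⟨v, hv⟩) = extend y v - extend y u := by
  rw [euler_simpleRoot_of_unique (u := ⟨u, hu⟩) (by simpa [Fin.ext_iff] using hne)
    (fun k hk => by rw [h k hk, Fin.ext_iff]), extend_of_lt y hu, extend_of_lt y hv]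

/-- Both spin coefficients are 1, so the coefficient at c - 1 must be 2, and the coefficients 2
begin at b. -/
lemma lt_of_extend_plus {a b c : ℕ} (hb : b ≤ m + 1) (hac : a < c) (hc : c ≤ m + 1)
    (h : extend (seg (m + 3) a (m + 2) + seg (m + 3) b (m + 1)
        + simpleRoot (Fin.last (m + 2))) (m + 1)
      + extend (seg (m + 3) a (m + 2) + seg (m + 3) b (m + 1)
        + simpleRoot (Fin.last (m + 2))) (m + 2)
      - extend (seg (m + 3) a (m + 2) + seg (m + 3) b (m + 1)
        + simpleRoot (Fin.last (m + 2))) (c - 1) = 0) : b < c := by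
  rw [extend_plus, extend_plus, extend_plus] at h
  split_ifs at h <;> omega

/-- If β' avoids a spin end or lies to the left of j, then β' + α_j is a path vector. What remains
is β' reaching both spin ends, and each shape of β is excluded separately. -/
lemma noCrossingAt_D_arm {j : Fin (m + 3)} (hjm : (j : ℕ) ≤ m) :
    NoCrossingAt (CartanMatrix.D (m + 3)) j := by
  intro Q β β' hQ hj huniq hβ hβ' h1 h2 h3 h4 h5 h6 h7
  have hC := isSimplyLaced_D m
  have harr : ∀ v, v ≠ j → ∀ u, Q u v ↔ ((v < j ∧ (u : ℕ) = v + 1) ∨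
      (j < v ∧ (v : ℕ) ≤ m + 1 ∧ (u : ℕ) + 1 = v) ∨ ((v : ℕ) = m + 2 ∧ (u : ℕ) = m)) := by
    refine arrow_iff_parent hC hQ huniq (fun u v => (v < j ∧ (u : ℕ) = v + 1) ∨
      (j < v ∧ (v : ℕ) ≤ m + 1 ∧ (u : ℕ) + 1 = v) ∨ ((v : ℕ) = m + 2 ∧ (u : ℕ) = m))
      (fun v => if v < j then (v : ℕ) else m + 3 - v) ?_ ?_
    · intro v hv u huv
      rw [cartanMatrix_D_apply] at huv
      simp only [Fin.ext_iff, Fin.lt_def, ne_eq] at *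
      have := u.2
      split_ifs at * <;> omega
    · intro u u' v h h'
      simp only [Fin.ext_iff, Fin.lt_def] at *
      omega
  have hEL : ∀ y v (hv : v < m + 3), v < j →
      euler Q y (simpleRoot ⟨v, hv⟩) = extend y v - extend y (v + 1) := fun y v hv hvj =>
    euler_simpleRoot_extend (by omega) hv (by omega) (fun k _ => by
      rw [harr _ (by simp only [ne_eq, Fin.ext_iff]; omega)]
      simp only [Fin.lt_def]
      omega) y
  have hER : ∀ y v (hv : v < m + 3), j < v → v ≤ m + 1 →
      euler Q y (simpleRoot ⟨v, hv⟩) = extend y v - extend y (v - 1) := fun y v hv hvj hvm =>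
    euler_simpleRoot_extend (by omega) hv (by omega) (fun k _ => by
      rw [harr _ (by simp only [ne_eq, Fin.ext_iff]; omega)]
      simp only [Fin.lt_def]
      omega) y
  have hET : ∀ y, euler Q y (simpleRoot (Fin.last (m + 2))) = extend y (m + 2) - extend y m :=
    fun y => euler_simpleRoot_extend (by omega) (by omega) (by omega) (fun k _ => by
      rw [harr _ (by simp only [ne_eq, Fin.ext_iff]; omega)]
      simp only [Fin.lt_def, true_and]
      omega) y
  have hSL : ∀ y a b, a ≤ b → b ≤ (j : ℕ) →
      euler Q y (seg (m + 3) a b) = extend y a - extend y b := fun y a b hab hb =>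
    euler_seg_of_ascending hab (by omega) fun v hv _ hvb => hEL y v hv (by omega)
  have hSR : ∀ y b, (j : ℕ) ≤ b → b ≤ m + 1 →
      euler Q y (seg (m + 3) (j + 1) (b + 1)) = extend y b - extend y j := fun y b hab hb =>
    euler_seg_of_descending hab (by omega) fun v hv h1 h2 => hER y v hv h1 (by omega)
  obtain ⟨hβj, hβj'⟩ := eq_zero_of_crossing_D hβ' (posRoot_crossing hC hQ hβ hβ' h1 h2 h3 h4) h5
  rw [← extend_val β j] at hβj
  rw [← extend_val β' j] at hβj'
  have hbase : InjPath Q j ⟨j, j.2⟩ (simpleRoot j) := .base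
  have hz : ∀ v : Fin (m + 3), v ≠ j → simpleRoot j v = 0 := fun v hv => Pi.single_eq_of_ne hv _
  have hright : ∀ b, (j : ℕ) < b → (hb : b ≤ m + 2) →
      InjPath Q j ⟨b - 1, by omega⟩ (seg (m + 3) (j + 1) b + simpleRoot j) := by
    intro b hjb hb
    refine hbase.extend_right j.2 hjb (by omega) (fun v h1 _ => hz v (Fin.ne_of_gt h1))
      fun v h1 h2 k _ => ?_
    rw [harr v (Fin.ne_of_gt h1) k]
    simp only [Fin.lt_def]
    omega
  have hpath : ∀ v, ¬ InjPath Q j v (β' + simpleRoot j) :=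
    fun v hv => false_of_injPath hC hQ hj h1 h4 h5 h7 hv
  obtain ⟨a, ha, rfl⟩ | ⟨b, hjb, hb, rfl⟩ | rfl | ⟨b, hjb, hb, hb'⟩ :=
    shapeD_arm hβ' hjm hβj' h2
  · refine hpath _ (hbase.extend_left j.2 ha.le (fun v _ h1 => hz v (Fin.ne_of_lt h1))
      fun v _ h1 k _ => ?_)
    rw [harr v (Fin.ne_of_lt h1) k]
    simp only [Fin.lt_def]
    omega
  · exact hpath _ (hright b (by omega) hb)
  · have := hright (m + 1) (by omega) (by omega)
    refine hpath (Fin.last (m + 2)) ?_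
    rw [add_right_comm]
    refine this.step (by simp [Fin.ext_iff]) (fun k hk => ?_) ?_
    · rw [harr _ (by simp only [ne_eq, Fin.ext_iff, Fin.val_last]; omega)]
      simp only [Fin.lt_def, Fin.ext_iff, Fin.val_last, true_and]
      omega
    · rw [Pi.add_apply, hz _ (by simp only [ne_eq, Fin.ext_iff, Fin.val_last]; omega)]
      simp [seg]
  · have hb'v : ∀ k, extend β' k = _ := fun k => by rw [hb', extend_plus]
    obtain ⟨a, ha, rfl⟩ | ⟨c, hjc, hc, rfl⟩ | rfl | ⟨c, hjc, hc, hc'⟩ :=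
      shapeD_arm hβ hjm hβj h1
    -- For β to the left of j: the roots supported strictly to the left of j form an up-closed set,
    -- which contains β but not β'.
    · have hS := h6.mem_of_closed (S := fun x => ∀ k, (j : ℕ) ≤ k → extend x k = 0) ?_ ?_
      · have := hS (j + 1) (by omega)
        rw [hb'v] at this
        split_ifs at this <;> omega
      · intro x z hx hz hSx hE k hk
        cases shapeD hx with
        | minus e f hef hf =>
          have hfj : f ≤ j := by
            by_contra! h
            have := hSx (f - 1) (by omega)
            rw [extend_seg (by omega)] at this
            split_ifs at this <;> omega
          rw [hSL z e f hef.le hfj] at hE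
          cases shapeD hz with
          | minus g h hgh hh =>
            rw [extend_seg (by omega), extend_seg (by omega)] at hE
            rw [extend_seg (by omega)]
            split_ifs at hE ⊢ <;> omega
          | plus g h hgh hh =>
            rw [extend_plus, extend_plus] at hE
            split_ifs at hE <;> omega
          | last g hg =>
            rw [extend_last, extend_last] at hE
            split_ifs at hE <;> omega
        | plus e f hef hf =>
          have := hSx (m + 2) (by omega)
          rw [extend_plus] at this
          split_ifs at this <;> omega
        | last e he =>
          have := hSx (m + 2) (by omega)
          rw [extend_last] at this
          split_ifs at this <;> omega
      · intro k hk
        rw [extend_seg (by omega)]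
        split_ifs <;> omega
    -- Here ⟨β', β⟩ is the coefficient of β' at the end of the interval β, hence positive.
    · obtain ⟨c, rfl⟩ : ∃ d, c = d + 1 := ⟨c - 1, by omega⟩
      rw [hSR _ _ (by omega) (by omega), hβj', hb'v] at h4
      split_ifs at h4 <;> omega
    · rw [euler_add_right, hSR _ _ hjm (by omega), hET, hβj', hb'v (m + 2)] at h4
      split_ifs at h4 <;> omega
    -- When both roots reach both spin ends, the vanishing of the two Euler forms gives b < c and c
    -- < b.
    · have key : ∀ c y, (j : ℕ) + 1 < c → c ≤ m + 1 → extend y j = 0 →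
          euler Q y (seg (m + 3) (j + 1) (m + 2) + seg (m + 3) c (m + 1)
            + simpleRoot (Fin.last (m + 2)))
          = extend y (m + 1) + extend y (m + 2) - extend y (c - 1) := by
        intro c y hjc hc hy
        have e : seg (m + 3) (j + 1) (m + 1)
            = seg (m + 3) (j + 1) (c - 1 + 1) + seg (m + 3) c (m + 1) := by
          refine extend_injective fun k hk => ?_
          rw [extend_add, extend_seg (by omega), extend_seg (by omega), extend_seg (by omega)]
          split_ifs <;> omega
        have e1 := hSR y m hjm (by omega)
        rw [e, euler_add_right, hSR y (c - 1) (by omega) (by omega), hy] at e1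
        rw [euler_add_right, euler_add_right, hSR y (m + 1) (by omega) (by omega), hET, hy]
        omega
      rw [hc', key c _ hjc hc hβj', hb'] at h4
      rw [hb', key b _ hjb hb hβj, hc'] at h3
      have := lt_of_extend_plus hb hjc hc h4
      have := lt_of_extend_plus hc hjb hb h3
      omega

end TypeD

/-! ### Type D: unique source at a spin end -/

section TypeD

variable {m : ℕ}

lemma shapeD_spin {y : Fin (m + 3) → ℤ} (hy : PosRoot (CartanMatrix.D (m + 3)) y)
    (h0 : extend y (m + 2) = 0)
    (h1 : form (CartanMatrix.D (m + 3)) y (simpleRoot (Fin.last (m + 2))) = -1) :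
    ∃ a ≤ m, y = seg (m + 3) a (m + 1) ∨ y = seg (m + 3) a (m + 2) := by
  rw [form_D_simpleRoot_last y, h0] at h1
  cases shapeD hy with
  | minus a b hab hb =>
    rw [extend_seg (by omega)] at h0 h1
    obtain ⟨ha, rfl | rfl⟩ : a ≤ m ∧ (b = m + 1 ∨ b = m + 2) := by
      split_ifs at h0 h1 <;> omega
    · exact ⟨a, ha, .inl rfl⟩
    · exact ⟨a, ha, .inr rfl⟩
  | plus a b hab hb =>
    rw [extend_plus] at h0
    split_ifs at h0 <;> omega
  | last a ha =>
    rw [extend_last] at h0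
    split_ifs at h0 <;> omega

/-- The inequalities leave only the intervals ending at the branch vertex and the roots involving m
+ 2; all of these have increasing coefficients along the arm. This controls the down-closed set used
for the spin source. -/
lemma monotone_of_spin {x : Fin (m + 3) → ℤ} (hx : PosRoot (CartanMatrix.D (m + 3)) x)
    (h1 : extend x (m + 1) ≤ extend x (m + 2)) (h2 : 1 ≤ extend x (m + 2) + extend x m) :
    (∀ u v, u ≤ v → v ≤ m → extend x u ≤ extend x v) ∧ extend x (m + 1) ≤ extend x m := by
  cases shapeD hx with
  | minus a b hab hb =>
    rw [extend_seg (by omega), extend_seg (by omega)] at h1 h2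
    have hbm : b = m + 1 := by
      split_ifs at h1 h2 <;> omega
    subst hbm
    refine ⟨fun u v huv hv => ?_, ?_⟩ <;> rw [extend_seg (by omega), extend_seg (by omega)] <;>
      split_ifs <;> omega
  | plus a b hab hb =>
    refine ⟨fun u v huv hv => ?_, ?_⟩ <;> rw [extend_plus, extend_plus] <;> split_ifs <;> omega
  | last a ha =>
    refine ⟨fun u v huv hv => ?_, ?_⟩ <;> rw [extend_last, extend_last] <;> split_ifs <;> omega

lemma noCrossingAt_D_last : NoCrossingAt (CartanMatrix.D (m + 3)) (Fin.last (m + 2)) := by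
  intro Q β β' hQ hj huniq hβ hβ' h1 h2 h3 h4 h5 h6 h7
  have hC := isSimplyLaced_D m
  have harr : ∀ v, v ≠ Fin.last (m + 2) → ∀ u, Q u v ↔ (((v : ℕ) < m ∧ (u : ℕ) = v + 1) ∨
      ((v : ℕ) = m ∧ (u : ℕ) = m + 2) ∨ ((v : ℕ) = m + 1 ∧ (u : ℕ) = m)) := by
    refine arrow_iff_parent hC hQ huniq (fun u v => ((v : ℕ) < m ∧ (u : ℕ) = v + 1) ∨
      ((v : ℕ) = m ∧ (u : ℕ) = m + 2) ∨ ((v : ℕ) = m + 1 ∧ (u : ℕ) = m))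
      (fun v => if (v : ℕ) = m + 1 then 0 else v + 1) ?_ ?_
    · intro v hv u huv
      rw [cartanMatrix_D_apply] at huv
      simp only [Fin.ext_iff, ne_eq, Fin.val_last] at *
      have := u.2
      have := v.2
      split_ifs at * <;> omega
    · intro u u' v h h'
      simp only [Fin.ext_iff] at *
      omega
  have hne : ∀ v (hv : v < m + 2), (⟨v, by omega⟩ : Fin (m + 3)) ≠ Fin.last (m + 2) := by
    intro v hv
    simp only [ne_eq, Fin.ext_iff, Fin.val_last]
    omega
  have hEL : ∀ y v (hv : v < m + 3), v < m →
      euler Q y (simpleRoot ⟨v, hv⟩) = extend y v - extend y (v + 1) := fun y v hv hvj =>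
    euler_simpleRoot_extend (by omega) hv (by omega) (fun k _ => by
      rw [harr _ (hne v (by omega))]
      simp only
      omega) y
  have hEm : ∀ y, euler Q y (simpleRoot ⟨m, by omega⟩) = extend y m - extend y (m + 2) :=
    fun y => euler_simpleRoot_extend (by omega) (by omega) (by omega) (fun k _ => by
      rw [harr _ (hne m (by omega))]
      simp only [true_and]
      omega) y
  have hES : ∀ y, euler Q y (simpleRoot ⟨m + 1, by omega⟩) = extend y (m + 1) - extend y m :=
    fun y => euler_simpleRoot_extend (by omega) (by omega) (by omega) (fun k _ => by
      rw [harr _ (hne (m + 1) (by omega))]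
      simp only [true_and]
      omega) y
  have hEj : ∀ y, euler Q y (simpleRoot (Fin.last (m + 2))) = extend y (m + 2) := fun y => by
    rw [euler_simpleRoot_source hC hQ hj, ← extend_val y, Fin.val_last]
  have hS0 : ∀ y a b, a ≤ b → b ≤ m → euler Q y (seg (m + 3) a b) = extend y a - extend y b :=
    fun y a b hab hb => euler_seg_of_ascending hab (by omega) fun v hv _ hvb => hEL y v hv (by omega)
  have hS1 : ∀ y a, a ≤ m →
      euler Q y (seg (m + 3) a (m + 1)) = extend y a - extend y (m + 2) := fun y a ha => by
    rw [seg_succ_right ha (by omega), euler_add_right, hS0 y a m ha le_rfl, hEm]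
    ring
  have hS2 : ∀ y a, a ≤ m → euler Q y (seg (m + 3) a (m + 2))
      = extend y a - extend y (m + 2) + extend y (m + 1) - extend y m := fun y a ha => by
    rw [seg_succ_right (by omega) (by omega), euler_add_right, hS1 y a ha, hES]
    ring
  obtain ⟨hβj, hβj'⟩ := eq_zero_of_crossing_D hβ' (posRoot_crossing hC hQ hβ hβ' h1 h2 h3 h4) h5
  rw [← extend_val β, Fin.val_last] at hβj
  rw [← extend_val β', Fin.val_last] at hβj'
  have hz : ∀ v (hv : v < m + 2), simpleRoot (Fin.last (m + 2)) ⟨v, by omega⟩ = 0 :=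
    fun v hv => Pi.single_eq_of_ne (hne v hv) _
  have hpath : ∀ v, ¬ InjPath Q (Fin.last (m + 2)) v (β' + simpleRoot (Fin.last (m + 2))) :=
    fun v hv => false_of_injPath hC hQ hj h1 h4 h5 h7 hv
  have hm : InjPath Q (Fin.last (m + 2)) ⟨m, by omega⟩
      (simpleRoot (Fin.last (m + 2)) + simpleRoot ⟨m, by omega⟩) := by
    refine InjPath.base.step (hne m (by omega)).symm (fun k _ => ?_) (hz m (by omega))
    rw [harr _ (hne m (by omega)), Fin.ext_iff, Fin.val_last]
    simp only [true_and]
    omega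
  obtain ⟨a', ha', rfl | rfl⟩ := shapeD_spin hβ' hβj' h2
  · refine hpath ⟨a', by omega⟩ ?_
    rw [seg_succ_right ha' (by omega), add_assoc, add_comm _ (simpleRoot (Fin.last _))]
    refine hm.extend_left (by omega) ha' (fun v _ h => ?_) fun v _ h k _ => ?_
    · rw [Pi.add_apply, hz v (by omega), simpleRoot, Pi.single_eq_of_ne, add_zero]
      simp only [ne_eq, Fin.ext_iff]
      omega
    · rw [harr v (hne v (by omega))]
      omega
  · obtain rfl | ha'm := eq_or_lt_of_le ha'
    · refine hpath ⟨a' + 1, by omega⟩ ?_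
      rw [seg_succ_right (by omega) (by omega), seg_succ_right le_rfl (by omega), seg_self, zero_add,
        add_comm _ (simpleRoot (Fin.last _)), ← add_assoc]
      refine hm.step (by simp [Fin.ext_iff]) (fun k _ => ?_) ?_
      · rw [harr _ (hne _ (by omega)), Fin.ext_iff]
        simp only [true_and]
        omega
      · rw [Pi.add_apply, hz _ (by omega), simpleRoot, Pi.single_eq_of_ne, add_zero]
        simp [Fin.ext_iff]
    · obtain ⟨a, ha, rfl | rfl⟩ := shapeD_spin hβ hβj h1
      · rw [hS2 _ _ ha'] at h3
        rw [hS1 _ _ ha] at h4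
        simp only [extend_seg (show m + 1 ≤ m + 3 by omega)] at h3
        simp only [extend_seg (show m + 2 ≤ m + 3 by omega)] at h4
        -- The vanishing form ⟨β', β⟩ is the coefficient of β' at a.
        have haa : a < a' := by
          split_ifs at h3 h4 <;> omega
        -- This set is down-closed and contains β' + α_j, whose support starts at a' > a on the arm.
        -- It misses β + α_j, which has coefficient 1 at a.
        have hS := h7.mem_of_closed' (S := fun x => (∀ v ≤ a, extend x v = 0) ∧
          extend x (m + 1) ≤ extend x (m + 2) ∧ 1 ≤ extend x (m + 2) + extend x m) ?_ ?_
        · have := hS.1 a le_rfl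
          rw [extend_last] at this
          split_ifs at this <;> omega
        · rintro z x hz hx ⟨g1, g2, g3⟩ hE
          obtain ⟨hmono, g4⟩ := monotone_of_spin hx g2 g3
          have hge : ∀ v ≤ m + 1, 0 < extend x v → a < v := by
            intro v hv h
            by_contra! hva
            rw [g1 v hva] at h
            omega
          have hn : ∀ v, 0 ≤ extend x v := by
            intro v
            unfold extend
            split_ifs
            exacts [hx.1 _, le_rfl]
          cases shapeD hz with
          | minus e f hef hf =>
            obtain h | rfl | rfl : f ≤ m ∨ f = m + 1 ∨ f = m + 2 := by omega
            · rw [hS0 _ _ _ hef.le h] at hE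
              have := hmono e f hef.le h
              omega
            · rw [hS1 _ _ (by omega)] at hE
              have := hge e (by omega) (by have := hn (m + 2); omega)
              refine ⟨fun v hv => ?_, ?_, ?_⟩ <;> simp only [extend_seg (show m + 1 ≤ m + 3 by omega)] <;>
                split_ifs <;> omega
            · obtain h | rfl : e ≤ m ∨ e = m + 1 := by omega
              · rw [hS2 _ _ h] at hE
                have := hmono e m h le_rfl
                omega
              · rw [seg_succ_right (by omega) (by omega), seg_self, zero_add, hES] at hE
                omega
          | plus e f hef hf =>
            rw [euler_add_right, euler_add_right, hEj, hS2 _ _ (by omega)] at hE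
            have : a < e := by
              refine hge e (by omega) ?_
              obtain h | rfl : f ≤ m ∨ f = m + 1 := by omega
              · rw [hS1 _ _ h] at hE
                have := hmono f m h le_rfl
                omega
              · rw [seg_self] at hE
                have : euler Q x 0 = 0 := by simp [euler]
                omega
            refine ⟨fun v hv => ?_, ?_, ?_⟩ <;> simp only [extend_plus] <;> split_ifs <;> omega
          | last e he =>
            rw [euler_add_right, hEj] at hE
            have : a < e := by
              obtain h | rfl : e ≤ m ∨ e = m + 1 := by omega
              · rw [hS1 _ _ h] at hE
                exact hge e (by omega) (by omega)
              · omega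
            refine ⟨fun v hv => ?_, ?_, ?_⟩ <;> simp only [extend_last] <;> split_ifs <;> omega
        · refine ⟨fun v hv => ?_, ?_, ?_⟩ <;>
            simp only [extend_add, extend_seg (show m + 2 ≤ m + 3 by omega), extend_simpleRoot,
              Fin.val_last] <;> split_ifs <;> omega
      -- Now the two Euler forms are the coefficients of β at a' and of β' at a. They cannot both
      -- vanish, since both intervals end at the same place.
      · rw [hS2 _ _ ha'] at h3
        rw [hS2 _ _ ha] at h4
        simp only [extend_seg (show m + 2 ≤ m + 3 by omega)] at h3 h4
        split_ifs at h3 h4 <;> omega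

lemma noCrossing_D (m : ℕ) : NoCrossing (CartanMatrix.D (m + 3)) := by
  rw [noCrossing_iff]
  intro j
  rcases le_or_gt (j : ℕ) m with h | h
  · exact noCrossingAt_D_arm h
  have hj := j.2
  obtain rfl | hjm : j = Fin.last (m + 2) ∨ (j : ℕ) = m + 1 := by
    rw [Fin.ext_iff, Fin.val_last]
    omega
  · exact noCrossingAt_D_last
  -- Exchanging the two spin ends is a diagram automorphism.
  · have he : (CartanMatrix.D (m + 3)).submatrix (Equiv.swap j (Fin.last (m + 2)))
        (Equiv.swap j (Fin.last (m + 2))) = CartanMatrix.D (m + 3) := by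
      ext a b
      have hval : ∀ c : Fin (m + 3), (Equiv.swap j (Fin.last (m + 2)) c : ℕ)
          = if (c : ℕ) = m + 1 then m + 2 else if (c : ℕ) = m + 2 then m + 1 else c := by
        intro c
        rw [Equiv.swap_apply_def]
        simp only [Fin.ext_iff, Fin.val_last, hjm]
        split_ifs <;> simp [hjm]
      have h1 := a.2
      have h2 := b.2
      rw [Matrix.submatrix_apply, cartanMatrix_D_apply, cartanMatrix_D_apply]
      simp only [Fin.ext_iff, hval]
      split_ifs <;> omega
    rw [← he]
    refine NoCrossingAt.submatrix _ ?_
    rw [Equiv.swap_apply_left]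
    exact noCrossingAt_D_last

end TypeD

/-! ### Nested pairs from a configuration of type D₄ -/

section Star

variable {I : Type*} [Fintype I] [DecidableEq I] {C : Matrix I I ℤ} {Q : I → I → Prop}

/-- Each added leaf contributes 2 to the norm and loses 2 against the centre, and leaves are
orthogonal to each other. -/
lemma PosRoot.star (hC : IsSimplyLaced C) (hQ : IsDynkinQuiver C Q) {c : I → ℤ} {l : Fin 3 → I → ℤ}
    (hc : PosRoot C c) (hl : ∀ i, PosRoot C (l i)) (hcl : ∀ i, euler Q c (l i) + euler Q (l i) c = -1)
    (hll : ∀ i k, i ≠ k → euler Q (l i) (l k) = 0) (d : Fin 3 → ℤ) (hd : ∀ i, d i = 0 ∨ d i = 1) :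
    PosRoot C (c + d 0 • l 0 + d 1 • l 1 + d 2 • l 2) := by
  refine ⟨fun i => ?_, ?_⟩
  · have h0 := hc.1 i
    have h : ∀ k, 0 ≤ d k * l k i := fun k =>
      mul_nonneg (by rcases hd k with h | h <;> rw [h] <;> norm_num) ((hl k).1 i)
    have h1 := h 0
    have h2 := h 1
    have h3 := h 2
    simp only [Pi.add_apply, Pi.smul_apply, smul_eq_mul]
    omega
  · have e0 := euler_self hC hQ hc.2
    have e1 := fun i => euler_self hC hQ (hl i).2
    have e2 := fun i => eq_sub_of_add_eq (hcl i)
    rw [← euler_add_euler hC hQ]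
    simp only [euler_add_left, euler_add_right, euler_smul_left, euler_smul_right, e0, e1, e2,
      hll 0 1 (by decide), hll 0 2 (by decide), hll 1 0 (by decide), hll 1 2 (by decide),
      hll 2 0 (by decide), hll 2 1 (by decide)]
    rcases hd 0 with h0 | h0 <;> rcases hd 1 with h1 | h1 <;> rcases hd 2 with h2 | h2 <;>
      rw [h0, h1, h2] <;> ring

/-- Two nested decompositions of `2c + l₀ + l₁ + l₂`. -/
lemma exists_nestedPairs_of_star (hC : IsSimplyLaced C) (hQ : IsDynkinQuiver C Q)
    {c : I → ℤ} {l : Fin 3 → I → ℤ} (hc : PosRoot C c) (hl : ∀ i, PosRoot C (l i))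
    (hcl : ∀ i, euler Q c (l i) = -1 ∧ euler Q (l i) c = 0 ∨
      euler Q c (l i) = 0 ∧ euler Q (l i) c = -1)
    (hll : ∀ i k, i ≠ k → euler Q (l i) (l k) = 0) :
    ∃ L : List ((I → ℤ) × (I → ℤ)), L ≠ [] ∧ L.length = 2 ∧
      (∀ p ∈ L, PosRoot C p.1 ∧ PosRoot C p.2 ∧ p.1 + p.2 = 2 • c + l 0 + l 1 + l 2 ∧
        euler Q p.1 p.2 < 0) ∧
      L.IsChain fun p q => p ≠ q ∧ 0 < euler Q p.1 q.1 ∧ 0 < euler Q q.2 p.2 := by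
  have hsum : ∀ i, euler Q c (l i) + euler Q (l i) c = -1 := fun i => by
    rcases hcl i with ⟨h1, h2⟩ | ⟨h1, h2⟩ <;> rw [h1, h2] <;> rfl
  -- The vector d marks the leaves l with ⟨l, c⟩ = -1. Giving exactly these to the first member of
  -- the pair yields the value -2, the outer pair.
  obtain ⟨d, hd⟩ : ∃ d : Fin 3 → ℤ, ∀ i, (d i = 0 ∨ d i = 1) ∧ euler Q (l i) c = -d i ∧
      euler Q c (l i) = d i - 1 := by
    refine ⟨fun i => -euler Q (l i) c, fun i => ?_⟩
    have := hcl i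
    dsimp only
    omega
  set x : (Fin 3 → ℤ) → I → ℤ := fun f => c + f 0 • l 0 + f 1 • l 1 + f 2 • l 2 with hx
  have hpos : ∀ f : Fin 3 → ℤ, (∀ i, f i = 0 ∨ f i = 1) → PosRoot C (x f) :=
    fun f hf => PosRoot.star hC hQ hc hl hsum hll f hf
  have hE : ∀ f g : Fin 3 → ℤ, euler Q (x f) (x g) = 1 + f 0 * (g 0 - d 0) + g 0 * (d 0 - 1)
      + f 1 * (g 1 - d 1) + g 1 * (d 1 - 1) + f 2 * (g 2 - d 2) + g 2 * (d 2 - 1) := by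
    intro f g
    have e1 := fun i => euler_self hC hQ (hl i).2
    have e2 := fun i => (hd i).2.1
    have e3 := fun i => (hd i).2.2
    simp only [hx, euler_add_left, euler_add_right, euler_smul_left, euler_smul_right,
      euler_self hC hQ hc.2, e1, e2, e3,
      hll 0 1 (by decide), hll 0 2 (by decide), hll 1 0 (by decide), hll 1 2 (by decide),
      hll 2 0 (by decide), hll 2 1 (by decide)]
    ring
  have hadd : ∀ f : Fin 3 → ℤ, x f + x (1 - f) = 2 • c + l 0 + l 1 + l 2 := by
    intro f
    simp only [hx, Pi.sub_apply, Pi.one_apply]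
    module
  have hd01 := fun i => (hd i).1
  -- Moving one leaf to the other member raises the value to -1 and gives the inner pair.
  set f : Fin 3 → ℤ := ![1 - d 0, d 1, d 2] with hf
  have hf01 : ∀ i, f i = 0 ∨ f i = 1 := by
    intro i
    have h0 := hd01 0
    have h1 := hd01 1
    have h2 := hd01 2
    fin_cases i <;> simp [hf] <;> omega
  have hc01 : ∀ g : Fin 3 → ℤ, (∀ i, g i = 0 ∨ g i = 1) → ∀ i, (1 - g) i = 0 ∨ (1 - g) i = 1 := by
    intro g hg i
    have := hg i
    simp only [Pi.sub_apply, Pi.one_apply]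
    omega
  have hf0 : f 0 = 1 - d 0 := rfl
  have hf1 : f 1 = d 1 := rfl
  have hf2 : f 2 = d 2 := rfl
  have E1 : euler Q (x f) (x (1 - f)) = -1 := by
    rw [hE]
    simp only [Pi.sub_apply, Pi.one_apply, hf0, hf1, hf2]
    rcases hd01 0 with h0 | h0 <;> rcases hd01 1 with h1 | h1 <;> rcases hd01 2 with h2 | h2 <;>
      rw [h0, h1, h2] <;> norm_num
  have E2 : euler Q (x d) (x (1 - d)) = -2 := by
    rw [hE]
    simp only [Pi.sub_apply, Pi.one_apply]
    rcases hd01 0 with h0 | h0 <;> rcases hd01 1 with h1 | h1 <;> rcases hd01 2 with h2 | h2 <;>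
      rw [h0, h1, h2] <;> norm_num
  have E3 : euler Q (x f) (x d) = 1 := by
    rw [hE]
    simp only [hf0, hf1, hf2]
    rcases hd01 0 with h0 | h0 <;> rcases hd01 1 with h1 | h1 <;> rcases hd01 2 with h2 | h2 <;>
      rw [h0, h1, h2] <;> norm_num
  have E4 : euler Q (x (1 - d)) (x (1 - f)) = 1 := by
    rw [hE]
    simp only [Pi.sub_apply, Pi.one_apply, hf0, hf1, hf2]
    rcases hd01 0 with h0 | h0 <;> rcases hd01 1 with h1 | h1 <;> rcases hd01 2 with h2 | h2 <;>
      rw [h0, h1, h2] <;> norm_num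
  refine ⟨[(x f, x (1 - f)), (x d, x (1 - d))], by simp, rfl, ?_, ?_⟩
  · intro p hp
    simp only [List.mem_cons, List.not_mem_nil, or_false] at hp
    rcases hp with rfl | rfl
    · exact ⟨hpos _ hf01, hpos _ (hc01 _ hf01), hadd f, by dsimp only; omega⟩
    · exact ⟨hpos _ hd01, hpos _ (hc01 _ hd01), hadd d, by dsimp only; omega⟩
  · rw [List.isChain_pair]
    refine ⟨fun h => ?_, by dsimp only; omega, by dsimp only; omega⟩
    rw [Prod.ext_iff] at h
    simp only at h
    rw [h.1, h.2, E2] at E1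
    omega

lemma euler_eq_zero_of_disjoint (hC : IsSimplyLaced C) (hQ : IsDynkinQuiver C Q) {x y : I → ℤ}
    (hx : PosRoot C x) (hy : PosRoot C y) (h : ∀ i, x i = 0 ∨ y i = 0) (h0 : form C x y = 0) :
    euler Q x y = 0 := by
  have e1 := euler_add_euler hC hQ x y
  have e2 : euler Q x y ≤ 0 := euler_nonpos_of_disjoint hx.1 hy.1 h
  have e3 : euler Q y x ≤ 0 := euler_nonpos_of_disjoint hy.1 hx.1 fun i => (h i).symm
  omega

lemma euler_of_disjoint (hC : IsSimplyLaced C) (hQ : IsDynkinQuiver C Q) {x y : I → ℤ}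
    (hx : PosRoot C x) (hy : PosRoot C y) (h : ∀ i, x i = 0 ∨ y i = 0) (h0 : form C x y = -1) :
    euler Q x y = -1 ∧ euler Q y x = 0 ∨ euler Q x y = 0 ∧ euler Q y x = -1 := by
  have e1 := euler_add_euler hC hQ x y
  have e2 : euler Q x y ≤ 0 := euler_nonpos_of_disjoint hx.1 hy.1 h
  have e3 : euler Q y x ≤ 0 := euler_nonpos_of_disjoint hy.1 hx.1 fun i => (h i).symm
  omega

end Star

/-! ### Type D: nested pairs -/

section TypeD

variable {m : ℕ}

/-- For multiplicity two, the centre c is the interval on which the coefficient is 2. The leaves are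
the arm segment before it and the two spin ends. -/
lemma hasNestedPairs_D (m : ℕ) : HasNestedPairs (CartanMatrix.D (m + 3)) := by
  intro Q γ hQ hγ hne
  have hC := isSimplyLaced_D m
  by_cases h1 : mul γ = 1
  · exact exists_nestedPairs_of_mul_eq_one hC hQ hγ hne h1
  have hmul : mul γ = 2 := by
    have := hγ.mul_pos
    have := mul_le (x := γ) (n := 2) fun i => by exact_mod_cast coeff_D hγ i
    omega
  obtain ⟨a, b, hab, hb, rfl⟩ : ∃ a b, a < b ∧ b ≤ m ∧ γ = seg (m + 3) a (m + 2)
      + seg (m + 3) b (m + 1) + simpleRoot (Fin.last (m + 2)) := by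
    have hthin : ¬ ∀ i, γ i ≤ (1 : ℕ) := fun h => by
      have := mul_le h
      omega
    cases shapeD hγ with
    | minus a b hab hb =>
      refine absurd (fun i => ?_) hthin
      rw [← extend_val (seg _ _ _) i, extend_seg (by omega)]
      split_ifs <;> norm_num
    | plus a b hab hb =>
      obtain h | rfl : b ≤ m ∨ b = m + 1 := by omega
      · exact ⟨a, b, hab, h, rfl⟩
      · refine absurd (fun i => ?_) hthin
        rw [← extend_val (_ + simpleRoot _) i, extend_plus]
        split_ifs <;> omega
    | last a ha =>
      refine absurd (fun i => ?_) hthin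
      rw [← extend_val (_ + simpleRoot _) i, extend_last]
      split_ifs <;> omega
  set c := seg (m + 3) b (m + 1) with hc
  set l : Fin 3 → Fin (m + 3) → ℤ :=
    ![seg (m + 3) a b, seg (m + 3) (m + 1) (m + 2), simpleRoot (Fin.last (m + 2))] with hl
  have hγ : seg (m + 3) a (m + 2) + c + simpleRoot (Fin.last (m + 2))
      = 2 • c + l 0 + l 1 + l 2 := by
    have : seg (m + 3) a (m + 2) = seg (m + 3) a b + c + seg (m + 3) (m + 1) (m + 2) := by
      refine extend_injective fun k hk => ?_
      rw [hc, extend_add, extend_add, extend_seg (by omega), extend_seg (by omega),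
        extend_seg (by omega), extend_seg (by omega)]
      split_ifs <;> omega
    rw [this]
    show _ = 2 • c + seg (m + 3) a b + seg (m + 3) (m + 1) (m + 2) + simpleRoot (Fin.last (m + 2))
    module
  have hseg : ∀ a b, a < b → b ≤ m + 2 → PosRoot (CartanMatrix.D (m + 3)) (seg (m + 3) a b) := by
    intro a b hab hb
    refine ⟨seg_nonneg, ?_⟩
    rw [form_D, coordD_seg hab hb]
    simp only [sub_dotProduct, dotProduct_sub, single_dotProduct, Pi.single_apply, Fin.ext_iff]
    split_ifs <;> omega
  have hcpos : PosRoot (CartanMatrix.D (m + 3)) c := hseg _ _ (by omega) (by omega)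
  have hlpos : ∀ i, PosRoot (CartanMatrix.D (m + 3)) (l i) := by
    intro i
    fin_cases i
    exacts [hseg _ _ hab (by omega), hseg _ _ (by omega) le_rfl, hC.posRoot_simpleRoot _]
  rw [hmul, hγ]
  refine exists_nestedPairs_of_star hC hQ hcpos hlpos (fun i => ?_) fun i k hik => ?_
  · refine euler_of_disjoint hC hQ hcpos (hlpos i) (fun k => ?_) ?_
    · rw [← extend_val c, ← extend_val (l i), hc, extend_seg (by omega)]
      fin_cases i
      · show _ ∨ extend (seg (m + 3) a b) k = 0
        rw [extend_seg (by omega)]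
        split_ifs <;> omega
      · show _ ∨ extend (seg (m + 3) (m + 1) (m + 2)) k = 0
        rw [extend_seg (by omega)]
        split_ifs <;> omega
      · show _ ∨ extend (simpleRoot (Fin.last (m + 2))) k = 0
        rw [extend_simpleRoot, Fin.val_last]
        split_ifs <;> omega
    · rw [form_D, hc, coordD_seg (by omega) (by omega)]
      fin_cases i
      · show _ ⬝ᵥ coordD m (seg (m + 3) a b) = _
        rw [coordD_seg hab (by omega)]
        simp only [sub_dotProduct, dotProduct_sub, single_dotProduct, Pi.single_apply, Fin.ext_iff]
        split_ifs <;> omega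
      · show _ ⬝ᵥ coordD m (seg (m + 3) (m + 1) (m + 2)) = _
        rw [coordD_seg (by omega) (by omega)]
        simp only [sub_dotProduct, dotProduct_sub, single_dotProduct, Pi.single_apply, Fin.ext_iff]
        split_ifs <;> omega
      · show _ ⬝ᵥ coordD m (simpleRoot (Fin.last (m + 2))) = _
        rw [coordD_simpleRoot_last]
        simp only [sub_dotProduct, dotProduct_add, single_dotProduct, Pi.single_apply, Fin.ext_iff,
          Fin.val_last]
        split_ifs <;> omega
  · have h01 : ∀ k : Fin (m + 3), seg (m + 3) a b k = 0 ∨ seg (m + 3) (m + 1) (m + 2) k = 0 := by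
      intro k
      simp only [seg]
      split_ifs <;> omega
    have h02 : ∀ k : Fin (m + 3), seg (m + 3) a b k = 0 ∨ simpleRoot (Fin.last (m + 2)) k = 0 := by
      intro k
      rw [← extend_val (simpleRoot _) k, extend_simpleRoot, Fin.val_last]
      simp only [seg]
      split_ifs <;> omega
    have h12 : ∀ k : Fin (m + 3), seg (m + 3) (m + 1) (m + 2) k = 0 ∨
        simpleRoot (Fin.last (m + 2)) k = 0 := by
      intro k
      rw [← extend_val (simpleRoot _) k, extend_simpleRoot, Fin.val_last]
      simp only [seg]
      split_ifs <;> omega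
    have f01 : form (CartanMatrix.D (m + 3)) (seg (m + 3) a b) (seg (m + 3) (m + 1) (m + 2)) = 0 := by
      rw [form_D, coordD_seg hab (by omega), coordD_seg (by omega) (by omega)]
      simp only [sub_dotProduct, dotProduct_sub, single_dotProduct, Pi.single_apply, Fin.ext_iff]
      split_ifs <;> omega
    have f02 : form (CartanMatrix.D (m + 3)) (seg (m + 3) a b) (simpleRoot (Fin.last (m + 2)))
        = 0 := by
      rw [form_D, coordD_seg hab (by omega), coordD_simpleRoot_last]
      simp only [sub_dotProduct, dotProduct_add, single_dotProduct, Pi.single_apply, Fin.ext_iff,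
        Fin.val_last]
      split_ifs <;> omega
    have f12 : form (CartanMatrix.D (m + 3)) (seg (m + 3) (m + 1) (m + 2))
        (simpleRoot (Fin.last (m + 2))) = 0 := by
      rw [form_D, coordD_seg (by omega) (by omega), coordD_simpleRoot_last]
      simp only [sub_dotProduct, dotProduct_add, single_dotProduct, Pi.single_apply, Fin.ext_iff,
        Fin.val_last]
      split_ifs <;> omega
    refine euler_eq_zero_of_disjoint hC hQ (hlpos i) (hlpos k) (fun v => ?_) ?_
    · fin_cases i <;> fin_cases k <;> first
        | exact absurd rfl hik
        | exact h01 v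
        | exact h02 v
        | exact h12 v
        | exact (h01 v).symm
        | exact (h02 v).symm
        | exact (h12 v).symm
    · fin_cases i <;> fin_cases k <;> first
        | exact absurd rfl hik
        | exact f01
        | exact f02
        | exact f12
        | exact (hC.form_comm _ _).trans f01
        | exact (hC.form_comm _ _).trans f02
        | exact (hC.form_comm _ _).trans f12

end TypeD

/-! ### Type E₆: the form and the list of positive roots -/

section TypeE

lemma form_E6 (x : Fin 6 → ℤ) : form CartanMatrix.E₆ x x = 2 * (x 0 * x 0 + x 1 * x 1 + x 2 * x 2
    + x 3 * x 3 + x 4 * x 4 + x 5 * x 5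
    - (x 0 * x 2 + x 2 * x 3 + x 3 * x 4 + x 4 * x 5 + x 1 * x 3)) := by
  simp [form, dotProduct, Matrix.mulVec, Fin.sum_univ_six, CartanMatrix.E₆]
  ring

/-- Completing squares from the three ends towards the branch vertex 3 yields both positive
definiteness and the coefficient bound. -/
lemma form_E6_eq_sum_squares (x : Fin 6 → ℤ) : 6 * form CartanMatrix.E₆ x x =
    3 * (2 * x 0 - x 2) ^ 2 + (3 * x 2 - 2 * x 3) ^ 2 + 3 * (2 * x 5 - x 4) ^ 2
      + (3 * x 4 - 2 * x 3) ^ 2 + 3 * (2 * x 1 - x 3) ^ 2 + x 3 ^ 2 := by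
  rw [form_E6]
  ring

lemma coeff_E6 {x : Fin 6 → ℤ} (hx : PosRoot CartanMatrix.E₆ x) (i : Fin 6) : x i ≤ 3 := by
  have h := form_E6_eq_sum_squares x
  rw [hx.2] at h
  have s1 := sq_nonneg (2 * x 0 - x 2)
  have s2 := sq_nonneg (3 * x 2 - 2 * x 3)
  have s3 := sq_nonneg (2 * x 5 - x 4)
  have s4 := sq_nonneg (3 * x 4 - 2 * x 3)
  have s5 := sq_nonneg (2 * x 1 - x 3)
  have s6 := sq_nonneg (x 3)
  -- The right-hand side totals 6 · 2 = 12.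
  have key : ∀ t : ℤ, t ^ 2 ≤ 12 → t ≤ 3 := fun t ht => by nlinarith
  have h3 := key (x 3) (by linarith)
  have h2 := key (3 * x 2 - 2 * x 3) (by linarith)
  have h4 := key (3 * x 4 - 2 * x 3) (by linarith)
  have h0 := key (2 * x 0 - x 2) (by linarith)
  have h5 := key (2 * x 5 - x 4) (by linarith)
  have h1 := key (2 * x 1 - x 3) (by linarith)
  fin_cases i <;> simp only [Fin.zero_eta, Fin.mk_one, Fin.reduceFinMk] <;> omega

lemma isSimplyLaced_E6 : IsSimplyLaced CartanMatrix.E₆ where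
  symm i := by fin_cases i <;> decide
  diag := by decide
  offDiag i := by fin_cases i <;> decide
  pos v hv := by
    by_contra! h
    have hs := form_E6_eq_sum_squares v
    have s1 := sq_nonneg (2 * v 0 - v 2)
    have s2 := sq_nonneg (3 * v 2 - 2 * v 3)
    have s3 := sq_nonneg (2 * v 5 - v 4)
    have s4 := sq_nonneg (3 * v 4 - 2 * v 3)
    have s5 := sq_nonneg (2 * v 1 - v 3)
    have s6 := sq_nonneg (v 3)
    have key : ∀ t : ℤ, t ^ 2 ≤ 0 → t = 0 := fun t ht => by nlinarith
    have h3 := key (v 3) (by linarith)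
    have h2 := key (3 * v 2 - 2 * v 3) (by linarith)
    have h4 := key (3 * v 4 - 2 * v 3) (by linarith)
    have h0 := key (2 * v 0 - v 2) (by linarith)
    have h5 := key (2 * v 5 - v 4) (by linarith)
    have h1 := key (2 * v 1 - v 3) (by linarith)
    refine hv (funext fun i => ?_)
    fin_cases i <;> simp only [Fin.zero_eta, Fin.mk_one, Fin.reduceFinMk, Pi.zero_apply] <;> omega
  bdd := ⟨3, fun v hv h2 i => coeff_E6 ⟨hv, h2⟩ i⟩
  conn := by
    have hsymm : Std.Symm fun a b : Fin 6 => CartanMatrix.E₆ a b = -1 :=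
      ⟨fun a => by fin_cases a <;> decide⟩
    have h2 : Relation.ReflTransGen (fun a b => CartanMatrix.E₆ a b = -1) 3 2 :=
      .single (by decide)
    have h4 : Relation.ReflTransGen (fun a b => CartanMatrix.E₆ a b = -1) 3 4 :=
      .single (by decide)
    have h : ∀ i, Relation.ReflTransGen (fun a b => CartanMatrix.E₆ a b = -1) 3 i := by
      intro i
      fin_cases i
      exacts [h2.tail (by decide), .single (by decide), h2, .refl, h4, h4.tail (by decide)]
    intro i j
    exact (Relation.ReflTransGen.stdSymm.symm _ _ (h i)).trans (h j)

/-- Sextuples of natural numbers. -/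
abbrev Vec6 := ℕ × ℕ × ℕ × ℕ × ℕ × ℕ

/-- The vector with the entries of a sextuple. -/
def vec : Vec6 → Fin 6 → ℤ
  | (a, b, c, d, e, f) => ![a, b, c, d, e, f]

section

variable (a b c d e f : ℕ)

lemma vec_zero : vec (a, b, c, d, e, f) 0 = a := rfl

lemma vec_one : vec (a, b, c, d, e, f) 1 = b := rfl

lemma vec_two : vec (a, b, c, d, e, f) 2 = c := rfl

lemma vec_three : vec (a, b, c, d, e, f) 3 = d := rfl

lemma vec_four : vec (a, b, c, d, e, f) 4 = e := rfl

lemma vec_five : vec (a, b, c, d, e, f) 5 = f := rfl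

end

/-- The positive roots of type `E₆`. -/
def rootsE6 : List Vec6 :=
  [(0, 0, 0, 0, 0, 1), (0, 0, 0, 0, 1, 0), (0, 0, 0, 1, 0, 0), (0, 0, 1, 0, 0, 0),
   (0, 1, 0, 0, 0, 0), (1, 0, 0, 0, 0, 0), (0, 0, 0, 0, 1, 1), (0, 0, 0, 1, 1, 0),
   (0, 0, 1, 1, 0, 0), (0, 1, 0, 1, 0, 0), (1, 0, 1, 0, 0, 0), (0, 0, 0, 1, 1, 1),
   (0, 0, 1, 1, 1, 0), (0, 1, 0, 1, 1, 0), (0, 1, 1, 1, 0, 0), (1, 0, 1, 1, 0, 0),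
   (0, 0, 1, 1, 1, 1), (0, 1, 0, 1, 1, 1), (0, 1, 1, 1, 1, 0), (1, 0, 1, 1, 1, 0),
   (1, 1, 1, 1, 0, 0), (0, 1, 1, 1, 1, 1), (0, 1, 1, 2, 1, 0), (1, 0, 1, 1, 1, 1),
   (1, 1, 1, 1, 1, 0), (0, 1, 1, 2, 1, 1), (1, 1, 1, 1, 1, 1), (1, 1, 1, 2, 1, 0),
   (0, 1, 1, 2, 2, 1), (1, 1, 1, 2, 1, 1), (1, 1, 2, 2, 1, 0), (1, 1, 1, 2, 2, 1),
   (1, 1, 2, 2, 1, 1), (1, 1, 2, 2, 2, 1), (1, 1, 2, 3, 2, 1), (1, 2, 2, 3, 2, 1)]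

/-- The pairing with respect to the standard basis. -/
def pairing : Vec6 → Vec6 → ℕ
  | (a, b, c, d, e, f), (a', b', c', d', e', f') =>
    a * a' + b * b' + c * c' + d * d' + e * e' + f * f'

/-- An orientation of the diagram of type `E₆`: the edges `02`, `23`, `34`, `45`, `13` are oriented
as written (`true`) or in the opposite direction (`false`). -/
abbrev Orientation6 := Bool × Bool × Bool × Bool × Bool

/-- The contribution of the arrows to the Euler form, up to sign. -/
def arrowPairing : Orientation6 → Vec6 → Vec6 → ℕ
  | (p, q, r, s, t), (a, b, c, d, e, f), (a', b', c', d', e', f') =>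
    (bif p then a * c' else c * a') + (bif q then c * d' else d * c')
      + (bif r then d * e' else e * d') + (bif s then e * f' else f * e')
      + (bif t then b * d' else d * b')

open Classical in
/-- The orientation given by a quiver. -/
noncomputable def orientation6 (Q : Fin 6 → Fin 6 → Prop) : Orientation6 :=
  (decide (Q 0 2), decide (Q 2 3), decide (Q 3 4), decide (Q 4 5), decide (Q 1 3))

/-- The arrows of an orientation. -/
def arrow6 : Orientation6 → Fin 6 → Fin 6 → Bool
  | (p, q, r, s, t) =>
    ![![false, false, p, false, false, false], ![false, false, false, t, false, false],
      ![!p, false, false, q, false, false], ![false, !t, !q, false, r, false],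
      ![false, false, false, !r, false, s], ![false, false, false, false, !s, false]]

lemma arrow_iff_arrow6 {Q : Fin 6 → Fin 6 → Prop} (hQ : IsDynkinQuiver CartanMatrix.E₆ Q)
    (i j : Fin 6) : Q i j ↔ arrow6 (orientation6 Q) i j = true := by
  have h1 : ∀ i j, CartanMatrix.E₆ i j ≠ -1 → ¬ Q i j := fun i j h h' => h (hQ.1 i j h')
  have h2 : Q 2 0 ↔ ¬ Q 0 2 := hQ.2 2 0 (by decide)
  have h3 : Q 3 2 ↔ ¬ Q 2 3 := hQ.2 3 2 (by decide)
  have h4 : Q 4 3 ↔ ¬ Q 3 4 := hQ.2 4 3 (by decide)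
  have h5 : Q 5 4 ↔ ¬ Q 4 5 := hQ.2 5 4 (by decide)
  have h6 : Q 3 1 ↔ ¬ Q 1 3 := hQ.2 3 1 (by decide)
  fin_cases i <;> fin_cases j <;> first
    | exact iff_of_false (h1 _ _ (by decide)) (by simp [arrow6, orientation6])
    | (simp [arrow6, orientation6]; done)
    | (simp [arrow6, orientation6]; exact h2)
    | (simp [arrow6, orientation6]; exact h3)
    | (simp [arrow6, orientation6]; exact h4)
    | (simp [arrow6, orientation6]; exact h5)
    | (simp [arrow6, orientation6]; exact h6)

lemma euler_vec {Q : Fin 6 → Fin 6 → Prop} (hQ : IsDynkinQuiver CartanMatrix.E₆ Q) (x y : Vec6) :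
    euler Q (vec x) (vec y) = pairing x y - arrowPairing (orientation6 Q) x y := by
  obtain ⟨a, b, c, d, e, f⟩ := x
  obtain ⟨a', b', c', d', e', f'⟩ := y
  have h := arrow_iff_arrow6 hQ
  generalize orientation6 Q = o at *
  obtain ⟨p, q, r, s, t⟩ := o
  have hM : ∀ i j, eulerMatrix Q i j = if i = j then 1
      else -((arrow6 (p, q, r, s, t) i j).toNat : ℤ) := by
    intro i j
    rw [eulerMatrix, Matrix.of_apply]
    simp only [h]
    split_ifs with h1 h2
    · rfl
    · simp [h2]
    · simp [Bool.eq_false_of_not_eq_true h2]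
  have hnot : ∀ b : Bool, ((!b).toNat : ℤ) = 1 - b.toNat := by decide
  have hcond : ∀ (b : Bool) (m n : ℕ), ((bif b then m else n : ℕ) : ℤ)
      = b.toNat * m + (1 - b.toNat) * n := fun b m n => by cases b <;> simp
  have hmat : eulerMatrix Q = !![1, 0, -(p.toNat : ℤ), 0, 0, 0; 0, 1, 0, -(t.toNat : ℤ), 0, 0;
      p.toNat - 1, 0, 1, -(q.toNat : ℤ), 0, 0;
      0, t.toNat - 1, q.toNat - 1, 1, -(r.toNat : ℤ), 0;
      0, 0, 0, r.toNat - 1, 1, -(s.toNat : ℤ); 0, 0, 0, 0, s.toNat - 1, 1] := by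
    ext i j
    rw [hM]
    fin_cases i <;> fin_cases j <;> simp [arrow6, hnot]
  rw [euler, hmat, dotProduct, Fin.sum_univ_six]
  simp only [Matrix.mulVec, dotProduct, Fin.sum_univ_six, pairing, arrowPairing, vec_zero, vec_one,
    vec_two, vec_three, vec_four, vec_five]
  push_cast [hcond]
  simp
  ring

lemma form_vec_self (x : Vec6) : form CartanMatrix.E₆ (vec x) (vec x) =
    2 * (pairing x x - arrowPairing (true, true, true, true, true) x x) := by
  obtain ⟨a, b, c, d, e, f⟩ := x
  rw [form_E6]
  simp [vec, pairing, arrowPairing]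

/-- The norm does not depend on the orientation, so one fixed orientation expresses it. The additive
form keeps the computation in ℕ free of subtraction. -/
lemma pairing_of_mem : ∀ x ∈ rootsE6,
    pairing x x = arrowPairing (true, true, true, true, true) x x + 1 := by
  decide +kernel

lemma vec_nonneg (x : Vec6) (i : Fin 6) : 0 ≤ vec x i := by
  obtain ⟨a, b, c, d, e, f⟩ := x
  fin_cases i <;> simp [vec]

lemma posRoot_vec {x : Vec6} (hx : x ∈ rootsE6) : PosRoot CartanMatrix.E₆ (vec x) := by
  refine ⟨vec_nonneg x, ?_⟩
  rw [form_vec_self, pairing_of_mem x hx]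
  push_cast
  ring

lemma vec_injective : Function.Injective vec := by
  rintro ⟨a, b, c, d, e, f⟩ ⟨a', b', c', d', e', f'⟩ h
  have h0 := congrFun h 0
  have h1 := congrFun h 1
  have h2 := congrFun h 2
  have h3 := congrFun h 3
  have h4 := congrFun h 4
  have h5 := congrFun h 5
  simp [vec] at h0 h1 h2 h3 h4 h5
  simp [h0, h1, h2, h3, h4, h5]

/-- The sum of sextuples. -/
def addVec : Vec6 → Vec6 → Vec6
  | (a, b, c, d, e, f), (a', b', c', d', e', f') => (a + a', b + b', c + c', d + d', e + e', f + f')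

lemma vec_addVec (x y : Vec6) : vec (addVec x y) = vec x + vec y := by
  obtain ⟨a, b, c, d, e, f⟩ := x
  obtain ⟨a', b', c', d', e', f'⟩ := y
  simp [addVec, vec]

/-- The sextuples of the simple roots. -/
def simpleVec : Fin 6 → Vec6 :=
  ![(1, 0, 0, 0, 0, 0), (0, 1, 0, 0, 0, 0), (0, 0, 1, 0, 0, 0), (0, 0, 0, 1, 0, 0),
    (0, 0, 0, 0, 1, 0), (0, 0, 0, 0, 0, 1)]

lemma vec_simpleVec (i : Fin 6) : vec (simpleVec i) = simpleRoot i := by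
  fin_cases i <;> decide

lemma simpleVec_mem : ∀ i, simpleVec i ∈ rootsE6 := by decide

lemma addVec_simpleVec_mem : ∀ x ∈ rootsE6, ∀ i, pairing (addVec x (simpleVec i))
      (addVec x (simpleVec i)) = arrowPairing (true, true, true, true, true)
      (addVec x (simpleVec i)) (addVec x (simpleVec i)) + 1 →
    addVec x (simpleVec i) ∈ rootsE6 := by
  decide +kernel

/-- The list contains the simple roots and is closed under adding a simple root when the sum has
norm two. Every other positive root arises in this way from one of smaller height. -/
lemma PosRoot.exists_vec {x : Fin 6 → ℤ} (hx : PosRoot CartanMatrix.E₆ x) :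
    ∃ v ∈ rootsE6, x = vec v := by
  induction hn : (∑ i, x i).toNat using Nat.strong_induction_on generalizing x with
  | _ n ih =>
  by_cases hs : ∃ i, x = simpleRoot i
  · obtain ⟨i, rfl⟩ := hs
    exact ⟨_, simpleVec_mem i, (vec_simpleVec i).symm⟩
  · obtain ⟨i, -, hi⟩ := hx.exists_sub isSimplyLaced_E6 (not_exists.1 hs)
    have hsum : ∑ k, (x - simpleRoot i) k = ∑ k, x k - 1 := by
      simp [Finset.sum_sub_distrib, simpleRoot]
    have hnonneg : 0 ≤ ∑ k, (x - simpleRoot i) k := Finset.sum_nonneg fun k _ => hi.1 k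
    obtain ⟨v, hv, hxv⟩ := ih _ (by omega) hi rfl
    have hx' : x = vec (addVec v (simpleVec i)) := by
      rw [vec_addVec, vec_simpleVec, ← hxv, sub_add_cancel]
    refine ⟨_, addVec_simpleVec_mem v hv i ?_, hx'⟩
    have h2 := hx.2
    rw [hx', form_vec_self] at h2
    omega

/-- The largest entry of a sextuple. -/
def maxVec : Vec6 → ℕ
  | (a, b, c, d, e, f) => max a (max b (max c (max d (max e f))))

lemma mul_vec (x : Vec6) : mul (vec x) = maxVec x := by
  obtain ⟨a, b, c, d, e, f⟩ := x
  rw [mul, show (Finset.univ : Finset (Fin 6)) = {0, 1, 2, 3, 4, 5} from rfl]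
  simp only [Finset.sup_insert, Finset.sup_singleton, vec_zero, vec_one, vec_two, vec_three,
    vec_four, vec_five, Int.toNat_natCast]
  rfl

end TypeE

/-! ### Type E₆: kernel computations over all orientations -/

section TypeE

/-- All orientations of the diagram of type `E₆`. -/
def orientations6 : List Orientation6 :=
  [true, false] ×ˢ [true, false] ×ˢ [true, false] ×ˢ [true, false] ×ˢ [true, false]

lemma mem_orientations6 (o : Orientation6) : o ∈ orientations6 := by
  obtain ⟨p, q, r, s, t⟩ := o
  have h : ∀ b : Bool, b ∈ [true, false] := by decide
  exact List.pair_mem_product.2 ⟨h p, List.pair_mem_product.2 ⟨h q, List.pair_mem_product.2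
    ⟨h r, List.pair_mem_product.2 ⟨h s, h t⟩⟩⟩⟩

/-- Whether a sextuple has norm two. -/
def isRootVec (x : Vec6) : Bool :=
  Nat.beq (pairing x x) (arrowPairing (true, true, true, true, true) x x + 1)

lemma posRoot_of_isRootVec {x : Vec6} (h : isRootVec x = true) :
    PosRoot CartanMatrix.E₆ (vec x) := by
  refine ⟨vec_nonneg x, ?_⟩
  rw [form_vec_self, Nat.eq_of_beq_eq_true h]
  push_cast
  ring

lemma isRootVec_of_posRoot {x : Vec6} (h : PosRoot CartanMatrix.E₆ (vec x)) :
    isRootVec x = true := by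
  have h2 := h.2
  rw [form_vec_self] at h2
  have : pairing x x = arrowPairing (true, true, true, true, true) x x + 1 := by omega
  rw [isRootVec, this]
  exact Nat.beq_refl _

/-- Coefficients up to 3 occur in E₆, so the argument for coefficients at most two does not cover
sums of multiplicity two. -/
lemma eulerBound_check : (rootsE6.all fun a => rootsE6.all fun b => !isRootVec (addVec a b) ||
    orientations6.all fun o =>
      Nat.ble (arrowPairing o a b) (pairing a b + maxVec (addVec a b))) = true := by
  decide +kernel

lemma eulerBound_E6 : EulerBound CartanMatrix.E₆ := by
  intro Q α β hQ hα hβ hαβ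
  obtain ⟨a, ha, rfl⟩ := hα.exists_vec
  obtain ⟨b, hb, rfl⟩ := hβ.exists_vec
  have h := List.all_eq_true.1 (List.all_eq_true.1 eulerBound_check a ha) b hb
  rw [← vec_addVec] at hαβ ⊢
  rw [isRootVec_of_posRoot hαβ, Bool.not_true, Bool.false_or] at h
  have := Nat.le_of_ble_eq_true (List.all_eq_true.1 h _ (mem_orientations6 (orientation6 Q)))
  rw [euler_vec hQ, mul_vec]
  omega

/-- The truncated difference of sextuples. -/
def subVec : Vec6 → Vec6 → Vec6
  | (a, b, c, d, e, f), (a', b', c', d', e', f') => (a - a', b - b', c - c', d - d', e - e', f - f')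

/-- The ordered decompositions of a positive root with negative Euler form. -/
def decompositions (o : Orientation6) (g : Vec6) : List (Vec6 × Vec6) :=
  (rootsE6.map fun a => (a, subVec g a)).filter fun p => isRootVec p.2 &&
    (addVec p.1 p.2 == g && Nat.blt (pairing p.1 p.2) (arrowPairing o p.1 p.2))

/-- Whether there are `n` decompositions successively nested outside `p`. -/
def hasNested (o : Orientation6) (D : List (Vec6 × Vec6)) : ℕ → Vec6 × Vec6 → Bool
  | 0, _ => true
  | n + 1, p => D.any fun q => (p.1 != q.1 && (Nat.blt (arrowPairing o p.1 q.1) (pairing p.1 q.1) &&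
      Nat.blt (arrowPairing o q.2 p.2) (pairing q.2 p.2))) && hasNested o D n q

lemma hasNested_check : (rootsE6.all fun g => (List.finRange 6).any (fun i => g == simpleVec i) ||
    orientations6.all fun o => (decompositions o g).any
      (hasNested o (decompositions o g) (maxVec g - 1))) = true := by
  decide +kernel

lemma exists_chain_of_hasNested {Q : Fin 6 → Fin 6 → Prop} (hQ : IsDynkinQuiver CartanMatrix.E₆ Q)
    {D : List (Vec6 × Vec6)} (n : ℕ) {p : Vec6 × Vec6} (hp : p ∈ D)
    (h : hasNested (orientation6 Q) D n p = true) :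
    ∃ L : List (Vec6 × Vec6), L.length = n ∧ (∀ q ∈ p :: L, q ∈ D) ∧
      (p :: L).IsChain fun p q => vec p.1 ≠ vec q.1 ∧ 0 < euler Q (vec p.1) (vec q.1) ∧
        0 < euler Q (vec q.2) (vec p.2) := by
  induction n generalizing p with
  | zero => exact ⟨[], rfl, by simpa using hp, by simp⟩
  | succ n ih =>
    rw [hasNested, List.any_eq_true] at h
    obtain ⟨q, hq, h⟩ := h
    simp only [Bool.and_eq_true, bne_iff_ne, Nat.blt_eq] at h
    obtain ⟨⟨h1, h2, h3⟩, h4⟩ := h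
    obtain ⟨L, e1, e2, e3⟩ := ih hq h4
    refine ⟨q :: L, by simp [e1], ?_, ?_⟩
    · intro r hr
      rcases List.mem_cons.1 hr with rfl | hr
      exacts [hp, e2 r hr]
    · refine List.isChain_cons_cons.2 ⟨⟨fun h => h1 (vec_injective h), ?_, ?_⟩, e3⟩
      · rw [euler_vec hQ]
        omega
      · rw [euler_vec hQ]
        omega

lemma hasNestedPairs_E6 : HasNestedPairs CartanMatrix.E₆ := by
  intro Q γ hQ hγ hne
  obtain ⟨g, hg, rfl⟩ := hγ.exists_vec
  have h := List.all_eq_true.1 hasNested_check g hg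
  have hs : ((List.finRange 6).any fun i => g == simpleVec i) = false := by
    rw [List.any_eq_false]
    intro i _ h
    rw [beq_iff_eq] at h
    exact hne i (by rw [h, vec_simpleVec])
  rw [hs, Bool.false_or] at h
  obtain ⟨p, hp, h⟩ := List.any_eq_true.1
    (List.all_eq_true.1 h _ (mem_orientations6 (orientation6 Q)))
  obtain ⟨L, e1, e2, e3⟩ := exists_chain_of_hasNested hQ _ hp h
  refine ⟨(p :: L).map fun q => (vec q.1, vec q.2), by simp, ?_, ?_, ?_⟩
  · have := hγ.mul_pos
    rw [mul_vec] at this ⊢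
    simp only [List.length_map, List.length_cons, e1]
    omega
  · intro r hr
    obtain ⟨q, hq, rfl⟩ := List.mem_map.1 hr
    obtain ⟨q1, q2⟩ := List.mem_filter.1 (e2 q hq)
    obtain ⟨a, ha, rfl⟩ := List.mem_map.1 q1
    simp only [Bool.and_eq_true, beq_iff_eq, Nat.blt_eq] at q2
    refine ⟨posRoot_vec ha, posRoot_of_isRootVec q2.1, ?_, ?_⟩
    · rw [← vec_addVec, q2.2.1]
    · have := q2.2.2
      dsimp only at this ⊢
      rw [euler_vec hQ]
      omega
  · rw [List.isChain_map]
    refine e3.imp fun p q h => ⟨fun h' => h.1 (congrArg Prod.fst h'), h.2⟩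

/-- The bit mask of a predicate on a list. -/
def bitMask {α : Type*} (p : α → Bool) : List α → ℕ
  | [] => 0
  | a :: l => 2 * bitMask p l + (p a).toNat

lemma testBit_bitMask {α : Type*} (p : α → Bool) (l : List α) (i : ℕ) :
    (bitMask p l).testBit i = (l[i]?).any p := by
  induction l generalizing i with
  | nil => simp [bitMask]
  | cons a l ih =>
    cases i with
    | zero => cases h : p a <;> simp [bitMask, h]
    | succ i =>
      rw [Nat.testBit_succ, List.getElem?_cons_succ, ← ih, bitMask]
      congr 1
      cases p a <;> simp <;> omega

/-- The mask of the positive roots `y` with positive Euler form `⟨y, x⟩`. -/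
def succMask (o : Orientation6) (x : Vec6) : ℕ :=
  bitMask (fun y => Nat.blt (arrowPairing o y x) (pairing y x)) rootsE6

/-- One step of the closure of a set of positive roots. -/
def closureStep (o : Orientation6) (U : ℕ) : ℕ :=
  rootsE6.foldr (fun x V => bif U.testBit (rootsE6.idxOf x) then V ||| succMask o x else V) U

/-- Whether a set of positive roots is closed. -/
def isClosedMask (o : Orientation6) (U : ℕ) : Bool :=
  rootsE6.all fun x => !U.testBit (rootsE6.idxOf x) || Nat.beq (U ||| succMask o x) U

/-- Whether `y` is in a closed set generated by `x`. -/
def reachable (o : Orientation6) (x y : Vec6) : Bool :=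
  let U := closureStep o (closureStep o (1 <<< rootsE6.idxOf x))
  !(isClosedMask o U && U.testBit (rootsE6.idxOf x)) || U.testBit (rootsE6.idxOf y)

/-- Only an over-approximation of `Prec` is needed. A mask not certified to be closed and to contain
x counts as reaching everything, so nothing has to be proved about `closureStep`; a certified mask
is an up-closed set through x. -/
lemma reachable_of_prec {Q : Fin 6 → Fin 6 → Prop} (hQ : IsDynkinQuiver CartanMatrix.E₆ Q)
    {x y : Vec6} (hx : x ∈ rootsE6) (hy : y ∈ rootsE6)
    (h : Prec CartanMatrix.E₆ Q (vec x) (vec y)) : reachable (orientation6 Q) x y = true := by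
  unfold reachable
  set U := closureStep (orientation6 Q) (closureStep (orientation6 Q) (1 <<< rootsE6.idxOf x))
  rw [Bool.or_eq_true, Bool.not_eq_true', Bool.and_eq_false_iff, or_iff_not_imp_left]
  intro hU
  rw [not_or, Bool.not_eq_false, Bool.not_eq_false] at hU
  obtain ⟨hcl, hUx⟩ := hU
  have key := h.mem_of_closed (S := fun z => ∀ v ∈ rootsE6, z = vec v →
    U.testBit (rootsE6.idxOf v) = true) ?_ ?_
  · exact key y hy rfl
  · intro a b ha hb hSa hE w hw hbw
    obtain ⟨v, hv, rfl⟩ := ha.exists_vec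
    subst hbw
    have h1 := List.all_eq_true.1 hcl v hv
    rw [hSa v hv rfl, Bool.not_true, Bool.false_or] at h1
    rw [← Nat.eq_of_beq_eq_true h1, Nat.testBit_or, succMask, testBit_bitMask,
      List.getElem?_idxOf hw, Option.any_some]
    rw [euler_vec hQ] at hE
    have : arrowPairing (orientation6 Q) w v < pairing w v := by omega
    rw [Nat.blt_eq.mpr this, Bool.or_true]
  · intro v hv hxv
    rw [← vec_injective hxv]
    exact hUx

/-- Whether `j` is the only source of an orientation. -/
def isUniqueSource (o : Orientation6) (j : Fin 6) : Bool :=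
  (List.finRange 6).all fun i => ((List.finRange 6).all fun k => !arrow6 o k i) == (i == j)

/-- Whether the norm of a sextuple grows by two under the simple reflection at `j`. -/
def isAdjacent (o : Orientation6) (j : Fin 6) (x : Vec6) : Bool :=
  Nat.beq (2 * pairing x (simpleVec j) + 1)
    (arrowPairing o x (simpleVec j) + arrowPairing o (simpleVec j) x)

/-- Equality of the pairing with both arrow pairings encodes the vanishing of the two Euler forms.
-/
lemma noCrossing_check : (orientations6.all fun o => (List.finRange 6).all fun j =>
    !isUniqueSource o j || rootsE6.all fun x => !isAdjacent o j x || rootsE6.all fun y =>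
      !(isAdjacent o j y && (Nat.beq (pairing x y) (arrowPairing o x y) &&
        (Nat.beq (pairing x y) (arrowPairing o y x) &&
        (Nat.beq (pairing x (simpleVec j)) (pairing y (simpleVec j)) &&
        (reachable o x y && reachable o (addVec x (simpleVec j)) (addVec y (simpleVec j)))))))) =
      true := by
  decide +kernel

lemma pairing_comm (x y : Vec6) : pairing x y = pairing y x := by
  obtain ⟨a, b, c, d, e, f⟩ := x
  obtain ⟨a', b', c', d', e', f'⟩ := y
  simp only [pairing, mul_comm]

lemma pairing_simpleVec (x : Vec6) (j : Fin 6) : (pairing x (simpleVec j) : ℤ) = vec x j := by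
  obtain ⟨a, b, c, d, e, f⟩ := x
  fin_cases j <;> simp [pairing, simpleVec, vec]

lemma noCrossing_E6 : NoCrossing CartanMatrix.E₆ := by
  intro Q j β β' hQ hj huniq hβ hβ' h1 h2 h3 h4 h5 h6 h7
  have hC := isSimplyLaced_E6
  obtain ⟨x, hx, rfl⟩ := hβ.exists_vec
  obtain ⟨y, hy, rfl⟩ := hβ'.exists_vec
  have hsrc : isUniqueSource (orientation6 Q) j = true := by
    have hs : ∀ i, ((List.finRange 6).all fun k => !arrow6 (orientation6 Q) k i) = true ↔
        IsSource Q i := by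
      intro i
      simp [IsSource, arrow_iff_arrow6 hQ]
    refine List.all_eq_true.2 fun i _ => ?_
    rw [beq_iff_eq, Bool.eq_iff_iff, hs, beq_iff_eq]
    exact ⟨huniq i, fun h => h ▸ hj⟩
  have hadj : ∀ z, form CartanMatrix.E₆ (vec z) (simpleRoot j) = -1 →
      isAdjacent (orientation6 Q) j z = true := by
    intro z hz
    rw [← euler_add_euler hC hQ, ← vec_simpleVec, euler_vec hQ, euler_vec hQ,
      pairing_comm (simpleVec j)] at hz
    rw [isAdjacent, Nat.beq_eq]
    omega
  have hadd : ∀ z ∈ rootsE6, form CartanMatrix.E₆ (vec z) (simpleRoot j) = -1 →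
      addVec z (simpleVec j) ∈ rootsE6 := by
    intro z hz h
    refine addVec_simpleVec_mem z hz j ?_
    have hp : PosRoot CartanMatrix.E₆ (vec (addVec z (simpleVec j))) := by
      rw [vec_addVec, vec_simpleVec]
      refine ⟨fun i => add_nonneg (vec_nonneg z i) ((hC.posRoot_simpleRoot j).1 i), ?_⟩
      have e1 := hC.form_comm (vec z) (simpleRoot j)
      have e2 := (posRoot_vec hz).2
      have e3 := (hC.posRoot_simpleRoot j).2
      simp only [form_add_left, form_add_right]
      omega
    exact Nat.eq_of_beq_eq_true (isRootVec_of_posRoot hp)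
  have h := List.all_eq_true.1 (List.all_eq_true.1 noCrossing_check _
    (mem_orientations6 (orientation6 Q))) j (List.mem_finRange j)
  rw [hsrc, Bool.not_true, Bool.false_or] at h
  have h := List.all_eq_true.1 h x hx
  rw [hadj x h1, Bool.not_true, Bool.false_or] at h
  have h := List.all_eq_true.1 h y hy
  rw [euler_vec hQ] at h3 h4
  rw [← pairing_simpleVec, ← pairing_simpleVec] at h5
  rw [pairing_comm] at h4
  have e3 : Nat.beq (pairing x y) (arrowPairing (orientation6 Q) x y) = true := by
    rw [Nat.beq_eq]
    omega
  have e4 : Nat.beq (pairing x y) (arrowPairing (orientation6 Q) y x) = true := by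
    rw [Nat.beq_eq]
    omega
  have e5 : Nat.beq (pairing x (simpleVec j)) (pairing y (simpleVec j)) = true := by
    rw [Nat.beq_eq]
    omega
  rw [← vec_simpleVec, ← vec_addVec, ← vec_addVec] at h7
  rw [hadj y h2, e3, e4, e5, reachable_of_prec hQ hx hy h6,
    reachable_of_prec hQ (hadd x hx h1) (hadd y hy h2) h7] at h
  exact absurd h (by decide)

end TypeE

end QRadius

/-! ### The main theorem -/

theorem mainTheorem5 {I : Type*} [Fintype I] [DecidableEq I] (C : Matrix I I ℤ)
    (hC : QRadius.IsTypeA C ∨ QRadius.IsTypeD C ∨ QRadius.IsTypeE6 C)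
    (γ : I → ℤ) (hγ : QRadius.IsPositiveRoot C γ) (hγ' : ∀ i, γ ≠ QRadius.simpleRoot i) :
    (∀ Q : I → I → Prop, QRadius.IsDynkinQuiver C Q →
      (∃ w, QRadius.Represents C w Q) ∧
        ∀ w, QRadius.Represents C w Q → QRadius.IsRadius C w γ (QRadius.mul γ)) ∧
    (∀ Q Q' : I → I → Prop, QRadius.IsDynkinQuiver C Q → QRadius.IsDynkinQuiver C Q' →
      ∀ w w', QRadius.Represents C w Q → QRadius.Represents C w' Q' →
        ∀ r, QRadius.IsRadius C w γ r ↔ QRadius.IsRadius C w' γ r) := by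
  obtain ⟨hS, hN, hB, hL⟩ : QRadius.IsSimplyLaced C ∧ QRadius.NoCrossing C ∧
      QRadius.EulerBound C ∧ QRadius.HasNestedPairs C := by
    rcases hC with ⟨n, -, e, rfl⟩ | ⟨n, hn, e, rfl⟩ | ⟨e, rfl⟩
    · exact ⟨(QRadius.isSimplyLaced_A n).submatrix e, (QRadius.noCrossing_A n).submatrix e,
        (QRadius.eulerBound_A n).submatrix e, (QRadius.hasNestedPairs_A n).submatrix e⟩
    · obtain ⟨m, rfl⟩ : ∃ m, n = m + 3 := ⟨n - 3, by omega⟩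
      exact ⟨(QRadius.isSimplyLaced_D m).submatrix e, (QRadius.noCrossing_D m).submatrix e,
        (QRadius.eulerBound_D m).submatrix e, (QRadius.hasNestedPairs_D m).submatrix e⟩
    · exact ⟨QRadius.isSimplyLaced_E6.submatrix e, QRadius.noCrossing_E6.submatrix e,
        QRadius.eulerBound_E6.submatrix e, QRadius.hasNestedPairs_E6.submatrix e⟩
  have hrad : ∀ Q : I → I → Prop, QRadius.IsDynkinQuiver C Q → ∀ w, QRadius.Represents C w Q →
      QRadius.IsRadius C w γ (QRadius.mul γ) := fun Q hQ w hw =>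
    QRadius.isRadius_mul hS hN hB hL hQ hw (hγ.posRoot hS) hγ'
  refine ⟨fun Q hQ => ⟨QRadius.exists_represents hS hQ, hrad Q hQ⟩,
    fun Q Q' hQ hQ' w w' hw hw' r => ⟨fun h => ?_, fun h => ?_⟩⟩
  · rw [h.unique (hrad Q hQ w hw)]
    exact hrad Q' hQ' w' hw'
  · rw [h.unique (hrad Q' hQ' w' hw')]
    exact hrad Q hQ w hw
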